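/- Fix a dimension $d\ge 1$ and a level $\alpha\in(0,1/2)$. For $L>0$ let $\mathcal L(L)$ be the set of probability densities $p$ on $\mathbb R^d$ with $|p(x)-p(y)|\le L\|x-y\|_2$ for all $x,y$. For $p_0\in\mathcal L(L)$ and $n\ge 1$ i.i.d. observations, consider testing $H_0:p=p_0$ against $H_1: p\in\mathcal L(L),\ \|p-p_0\|_1\ge\epsilon$, where $\|p-p_0\|_1=\int|p-p_0|$. A level-$\alpha$ test is a Borel map $\phi:(\mathbb R^d)^n\to\{0,1\}$ with $P_0^n(\phi=1)\le\alpha$, and the local critical radius is $$\epsilon_n(p_0,\mathcal L(L))=\inf\Big\{\epsilon\ge 0:\ \inf_{\phi\text{ of level }\alpha}\ \sup_{p\in\mathcal L(L),\ \|p-p_0\|_1\ge\epsilon}P^n(\phi=0)\le \tfrac12\Big\}.$$ Let $\gamma=2/(3+d)$ and, for $\sigma\geq 0$, let $$T_\sigma(p_0)=\inf\Big\{\Big(\int_B p_0(x)^\gamma\,dx\Big)^{1/\gamma}:\ B\text{ Borel},\ P_0(B)\ge 1-\sigma\Big\}\in[0,\infty].$$ Then there are constants $C_T\ge c_T>0$,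 depending only on $d$ and $\alpha$, such that the following holds. (0) For all $n\ge1$, $L>0$ and $p_0\in\mathcal L(L)$, the equations $$v_n=\Big(\frac{L^{d/2}\,T_{C_Tv_n}(p_0)}{n}\Big)^{2/(4+d)},\qquad w_n=\Big(\frac{L^{d/2}\,T_{c_Tw_n}(p_0)}{n}\Big)^{2/(4+d)}$$ have unique positive solutions $v_n=v_n(p_0)$ and $w_n=w_n(p_0)$. (1) There is a constant $C>0$, depending only on $d$ and $\alpha$, such that for all $n\ge 1$, $L>0$ and $p_0\in\mathcal L(L)$, $$\epsilon_n(p_0,\mathcal L(L))\le C\,w_n(p_0).$$ (2) For every $0\le c_{\mathrm{int}}<1$ there is a constant $c>0$, depending only on $d$, $\alpha$ and $c_{\mathrm{int}}$, such that for all $n\ge1$, $L>0$ and $p_0\in\mathcal L(c_{\mathrm{int}}L)$, $$c\,v_n(p_0)\le\epsilon_n(p_0,\mathcal L(L)).$$ In particular $L=L_n$ may vary with $n$, and the support of $p_0$ may be unbounded. -/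

import Mathlib

open MeasureTheory
open scoped ENNReal

noncomputable section

namespace LipschitzTesting

/-- The sample space of one observation: `ℝ^d` with the Euclidean norm and Lebesgue measure. -/
abbrev E (d : ℕ) : Type := EuclideanSpace ℝ (Fin d)

/-- The Lipschitz ball of densities: nonnegative functions on `ℝ^d` with integral one that are
`L`-Lipschitz for the Euclidean norm.  (A function with Bochner integral one is integrable.) -/
def lipBall (d : ℕ) (L : ℝ) : Set (E d → ℝ) :=
  {p | (∀ x, 0 ≤ p x) ∧ (∫ x, p x) = 1 ∧ ∀ x y, |p x - p y| ≤ L * ‖x - y‖}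

/-- The distribution with Lebesgue density `p`. -/
def law {d : ℕ} (p : E d → ℝ) : Measure (E d) :=
  volume.withDensity fun x => ENNReal.ofReal (p x)

/-- The joint distribution of `n` i.i.d. observations with density `p`. -/
def sampleLaw {d : ℕ} (n : ℕ) (p : E d → ℝ) : Measure (Fin n → E d) :=
  Measure.pi fun _ => law p

/-- The `ℓ₁` distance `∫ |p - q|` between two densities. -/
def l1Dist {d : ℕ} (p q : E d → ℝ) : ℝ≥0∞ :=
  ∫⁻ x, ENNReal.ofReal |p x - q x|

/-- The level `α` tests of the null density `p₀` from `n` observations: Borel maps into `{0, 1}`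
(`true` means that the null is rejected) with type I error at most `α`. -/
def levelTests {d : ℕ} (n : ℕ) (α : ℝ) (p₀ : E d → ℝ) : Set ((Fin n → E d) → Bool) :=
  {φ | Measurable φ ∧ sampleLaw n p₀ {z | φ z = true} ≤ ENNReal.ofReal α}

/-- The worst-case type II error of the test `φ` over the densities in `𝒞` whose `ℓ₁` distance
from `p₀` is at least `ε`. -/
def testRisk {d : ℕ} (n : ℕ) (φ : (Fin n → E d) → Bool) (p₀ : E d → ℝ) (ε : ℝ≥0∞)
    (𝒞 : Set (E d → ℝ)) : ℝ≥0∞ :=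
  ⨆ p ∈ {p | p ∈ 𝒞 ∧ ε ≤ l1Dist p p₀}, sampleLaw n p {z | φ z = false}

/-- The local minimax risk. -/
def minimaxRisk {d : ℕ} (n : ℕ) (α : ℝ) (p₀ : E d → ℝ) (ε : ℝ≥0∞) (𝒞 : Set (E d → ℝ)) : ℝ≥0∞ :=
  ⨅ φ ∈ levelTests n α p₀, testRisk n φ p₀ ε 𝒞

/-- The local critical radius: the infimum of the separations at which the local minimax risk
is at most `1/2`. -/
def criticalRadius {d : ℕ} (n : ℕ) (α : ℝ) (p₀ : E d → ℝ) (𝒞 : Set (E d → ℝ)) : ℝ≥0∞ :=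
  sInf {ε | minimaxRisk n α p₀ ε 𝒞 ≤ 1 / 2}

/-- The exponent `γ = 2 / (3 + d)`. -/
def gam (d : ℕ) : ℝ := 2 / (3 + d)

/-- The truncated `T`-functional: the infimum of `(∫_B p₀ ^ γ) ^ (1 / γ)` over the Borel sets `B`
of probability at least `1 - σ`.  It can be infinite at `σ = 0`, and it is `0` for `1 ≤ σ`. -/
def truncT {d : ℕ} (σ : ℝ) (p₀ : E d → ℝ) : ℝ≥0∞ :=
  ⨅ B ∈ {B : Set (E d) | MeasurableSet B ∧ ENNReal.ofReal (1 - σ) ≤ law p₀ B},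
    (∫⁻ x in B, ENNReal.ofReal (p₀ x ^ gam d)) ^ (1 / gam d)

/-- `v` is a positive solution of the critical equation with truncation constant `a`:
`v = (L ^ (d / 2) * T_{a v}(p₀) / n) ^ (2 / (4 + d))`. -/
def SolvesCriticalEq {d : ℕ} (n : ℕ) (L a : ℝ) (p₀ : E d → ℝ) (v : ℝ) : Prop :=
  0 < v ∧
    ENNReal.ofReal v =
      (ENNReal.ofReal (L ^ ((d : ℝ) / 2)) * truncT (a * v) p₀ / (n : ℝ≥0∞)) ^
        ((2 : ℝ) / (4 + (d : ℝ)))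

end LipschitzTesting

end

/-!
Both truncation constants can be taken to be `1`. Write `I(σ) = T_σ(p₀) ^ γ`, the infimum of
`∫_B p₀ ^ γ` over the Borel sets `B` of mass at least `1 - σ`. In these terms the critical equation
is the polynomial equation `n² v ^ (d + 4) = L ^ d I(v) ^ (d + 3)`. Its left side is increasing and
its right side is nonincreasing, continuous on `(0, ∞)` and zero for `v ≥ 1`, so there is exactly
one positive solution `v`, and `v < 1` (`existsUnique_solvesCriticalEq`). Put `θ = v / I(v)`; then
`n² θ ^ (d + 3) v = L ^ d`. The bulk is the set where `θ p₀ ^ γ ≤ p₀ ≠ 0`, and the local bandwidth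
on it is a multiple of `θ p₀ ^ γ / L`, a scale at which `p₀` is constant up to a factor.

Lower bound (`lower_bound`). Let the scale be `min (θ p₀ ^ γ) p₀`. Minimality of `I(v)` gives
`v ≤ ∫ scale`: either the bulk has mass at least `1 - v`, or the tail, where the scale equals `p₀`,
has mass at least `v` (`le_lintegral_scale`). By Vitali's covering theorem finitely many disjoint
balls of radius `κ / L` times the scale carry a fixed proportion of that integral
(`exists_packing`). On each of them `p₀` is perturbed by a centred bump with a random sign. The
slack between `cint * L` and `L` keeps the perturbed densities in the class, their `ℓ₁` distance
to `p₀` is a fixed multiple of `v`, and the `χ²` distance between the null and the mixture over all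
signs is at most `exp (ω κ ^ (d + 4) / 2) - 1`, with `ω` the volume of the unit ball, which is small
with `κ` (`exists_sign_measure_ge`).

Upper bound (`upper_bound`). The bulk carries all but `3 w` of the null's mass and satisfies
`∫ p₀ ^ γ ≤ 3 I(w)` on it (`bulk_spec`). The test combines two statistics (`bulkTest`). A density
that differs from `p₀` mostly off the bulk puts there a mass that is a large multiple of `w`, and is
detected by the number of observations outside the bulk. Otherwise, let `b_z` be the ball around
`z` of radius the bandwidth. The statistic `∫ (∑_{i ∈ S} (1_{b_z}(X_i) - P₀(b_z)))
(∑_{i ∈ T} (1_{b_z}(X_i) - P₀(b_z))) dμ(z)`, for two disjoint subsamples `S`, `T` of size `m` and a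
suitable weighted Lebesgue measure `μ` on the bulk, has mean `m² D` with
`D = ∫ (P(b_z) - P₀(b_z))² dμ(z)`. By the Cauchy-Schwarz inequality and the Lipschitz condition, `D`
is large if `P` is separated from `P₀` on the bulk (`sq_separation_le`). The variance is controlled
by the Hilbert-Schmidt norm of the kernel `P(b_z ∩ b_z')` (`variance_pairStat_le`,
`integral_covFun_sq_le`), which is bounded, uniformly in `P`, in terms of `∫_bulk p₀ ^ γ` and `D`
(`integral_inter_sq_le`). Chebyshev's inequality under `P₀` and `P` concludes.
-/

namespace LipschitzTesting

open Set Filter Topology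

variable {d : ℕ}

/-! ### Lipschitz densities and their laws -/

lemma gam_pos (d : ℕ) : 0 < gam d := by unfold gam; positivity

lemma gam_lt_one (d : ℕ) : gam d < 1 := by
  unfold gam
  have : (0 : ℝ) ≤ d := d.cast_nonneg
  rw [div_lt_one (by positivity)]; linarith

lemma rpow_gam_pow (d : ℕ) {s : ℝ} (hs : 0 ≤ s) : (s ^ gam d) ^ (d + 3) = s ^ 2 := by
  rw [← Real.rpow_natCast, ← Real.rpow_mul hs, ← Real.rpow_natCast]
  congr 1
  unfold gam
  push_cast
  field_simp
  ring

lemma rpow_gam_le_two_mul (d : ℕ) {a b : ℝ} (ha : 0 ≤ a) (hb : 0 ≤ b) (hab : a ≤ 2 * b) :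
    a ^ gam d ≤ 2 * b ^ gam d := by
  calc a ^ gam d ≤ (2 * b) ^ gam d := Real.rpow_le_rpow ha hab (gam_pos d).le
    _ = 2 ^ gam d * b ^ gam d := Real.mul_rpow (by norm_num) hb
    _ ≤ 2 * b ^ gam d := by
      gcongr
      calc (2 : ℝ) ^ gam d ≤ 2 ^ (1 : ℝ) :=
            Real.rpow_le_rpow_of_exponent_le (by norm_num) (gam_lt_one d).le
        _ = 2 := Real.rpow_one 2

lemma continuous_of_mem {L : ℝ} {p : E d → ℝ} (hp : p ∈ lipBall d L) : Continuous p := by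
  have h : LipschitzWith (Real.toNNReal L) p := by
    refine LipschitzWith.of_dist_le_mul fun x y => ?_
    rw [Real.dist_eq, dist_eq_norm]
    refine (hp.2.2 x y).trans ?_
    gcongr
    exact Real.le_coe_toNNReal L
  exact h.continuous

lemma integrable_of_mem {L : ℝ} {p : E d → ℝ} (hp : p ∈ lipBall d L) : Integrable p := by
  by_contra h
  have := hp.2.1
  rw [integral_undef h] at this
  exact zero_ne_one this

lemma law_apply (p : E d → ℝ) {s : Set (E d)} (hs : MeasurableSet s) :
    law p s = ∫⁻ x in s, ENNReal.ofReal (p x) := withDensity_apply _ hs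

lemma isProbabilityMeasure_law {L : ℝ} {p : E d → ℝ} (hp : p ∈ lipBall d L) :
    IsProbabilityMeasure (law p) := by
  constructor
  rw [law_apply p MeasurableSet.univ, Measure.restrict_univ,
    ← ofReal_integral_eq_lintegral_ofReal (integrable_of_mem hp)
      (Eventually.of_forall hp.1), hp.2.1, ENNReal.ofReal_one]

lemma law_real_apply {L : ℝ} {p : E d → ℝ} (hp : p ∈ lipBall d L) {s : Set (E d)}
    (hs : MeasurableSet s) : (law p).real s = ∫ x in s, p x := by
  rw [measureReal_def, law_apply p hs, integral_eq_lintegral_of_nonneg_ae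
    (Eventually.of_forall hp.1) (integrable_of_mem hp).aestronglyMeasurable.restrict]

lemma law_absolutelyContinuous (p : E d → ℝ) : law p ≪ volume :=
  withDensity_absolutelyContinuous _ _

/-- A finite measure with a Lebesgue density takes every intermediate value on the subsets of a
measurable set: intersect with balls of growing radius. -/
lemma exists_subset_measureReal_eq [Nonempty (Fin d)] (μ : Measure (E d)) [IsFiniteMeasure μ]
    (hμ : μ ≪ volume) {C : Set (E d)} (hC : MeasurableSet C) {δ : ℝ} (hδ : 0 ≤ δ)
    (hδC : δ ≤ μ.real C) : ∃ D ⊆ C, MeasurableSet D ∧ μ.real D = δ := by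
  rcases hδC.eq_or_lt with h | h
  · exact ⟨C, Subset.rfl, hC, h.symm⟩
  set F : ℝ → ℝ := fun r => ∫ x, (C ∩ Metric.closedBall 0 r).indicator (fun _ => (1 : ℝ)) x ∂μ
  have hF : ∀ r, F r = μ.real (C ∩ Metric.closedBall 0 r) := fun r =>
    integral_indicator_one (hC.inter measurableSet_closedBall)
  have hcont : Continuous F := by
    rw [continuous_iff_continuousAt]
    intro r
    refine continuousAt_of_dominated (bound := fun _ => 1) ?_ ?_ (integrable_const 1) ?_
    · exact Eventually.of_forall fun r =>
        ((measurable_const).indicator (hC.inter measurableSet_closedBall)).aestronglyMeasurable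
    · refine Eventually.of_forall fun r => Eventually.of_forall fun x => ?_
      refine (norm_indicator_le_norm_self _ _).trans (by simp)
    · have hs : μ (Metric.sphere (0 : E d) r) = 0 := hμ (Measure.addHaar_sphere _ _ _)
      filter_upwards [measure_eq_zero_iff_ae_notMem.1 hs] with x hx
      have hx' : ‖x‖ ≠ r := by simpa using hx
      by_cases hxC : x ∈ C
      · rcases lt_or_gt_of_ne hx' with h1 | h1
        · refine (continuousAt_const (y := (1 : ℝ))).congr ?_
          filter_upwards [lt_mem_nhds h1] with s hs
          rw [indicator_of_mem]
          exact ⟨hxC, by simpa using hs.le⟩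
        · refine (continuousAt_const (y := (0 : ℝ))).congr ?_
          filter_upwards [gt_mem_nhds h1] with s hs
          rw [indicator_of_notMem]
          intro h2
          have : ‖x‖ ≤ s := by simpa using h2.2
          linarith
      · refine (continuousAt_const (y := (0 : ℝ))).congr ?_
        refine Eventually.of_forall fun s => ?_
        simp only
        rw [indicator_of_notMem]
        exact fun h2 => hxC h2.1
  have h0 : F 0 = 0 := by
    rw [hF, measureReal_def, measure_mono_null (t := {(0 : E d)}) (by simp), ENNReal.toReal_zero]
    exact hμ (measure_singleton 0)
  have hlim : Tendsto (fun k : ℕ => F k) atTop (𝓝 (μ.real C)) := by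
    have h1 : Tendsto (fun k : ℕ => μ (C ∩ Metric.closedBall 0 (k : ℝ))) atTop
        (𝓝 (μ (⋃ k : ℕ, C ∩ Metric.closedBall 0 (k : ℝ)))) := by
      refine tendsto_measure_iUnion_atTop fun a b hab => ?_
      exact inter_subset_inter_right _ (Metric.closedBall_subset_closedBall (by exact_mod_cast hab))
    rw [← inter_iUnion, Metric.iUnion_closedBall_nat, inter_univ] at h1
    simp_rw [hF]
    exact (ENNReal.tendsto_toReal (measure_ne_top μ C)).comp h1
  obtain ⟨k, hk⟩ := (hlim.eventually (lt_mem_nhds h)).exists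
  obtain ⟨r, -, hr⟩ := intermediate_value_Icc (k.cast_nonneg : (0 : ℝ) ≤ k) hcont.continuousOn
    (show δ ∈ Icc (F 0) (F k) from ⟨h0.le.trans hδ, hk.le⟩)
  exact ⟨_, inter_subset_left, hC.inter measurableSet_closedBall, by rw [← hF, hr]⟩

/-! ### The truncated functional and the critical equation -/

/-- The `γ`-th power of the truncated functional, a real number: the infimum of `∫_B p ^ γ` over
the Borel sets `B` of probability at least `1 - σ`. -/
noncomputable def truncI (σ : ℝ) (p : E d → ℝ) : ℝ := (truncT σ p ^ gam d).toReal

/-- Powers with positive exponents commute with infima. -/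
lemma truncT_rpow (σ : ℝ) (p : E d → ℝ) :
    truncT σ p ^ gam d =
      ⨅ B ∈ {B : Set (E d) | MeasurableSet B ∧ ENNReal.ofReal (1 - σ) ≤ law p B},
        ∫⁻ x in B, ENNReal.ofReal (p x ^ gam d) := by
  have hg := gam_pos d
  have key : ∀ y : ℝ≥0∞, (y ^ (1 / gam d)) ^ gam d = y := fun y => by
    rw [← ENNReal.rpow_mul, one_div_mul_cancel hg.ne', ENNReal.rpow_one]
  unfold truncT
  have h1 := (ENNReal.orderIsoRpow (gam d) hg).map_iInf
    (fun B => ⨅ (_ : B ∈ {B : Set (E d) | MeasurableSet B ∧ ENNReal.ofReal (1 - σ) ≤ law p B}),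
    (∫⁻ x in B, ENNReal.ofReal (p x ^ gam d)) ^ (1 / gam d))
  simp only [ENNReal.orderIsoRpow_apply] at h1
  rw [h1]
  congr 1; ext1 B
  have h2 := (ENNReal.orderIsoRpow (gam d) hg).map_iInf
    (fun (_ : B ∈ {B : Set (E d) | MeasurableSet B ∧ ENNReal.ofReal (1 - σ) ≤ law p B}) =>
    (∫⁻ x in B, ENNReal.ofReal (p x ^ gam d)) ^ (1 / gam d))
  simp only [ENNReal.orderIsoRpow_apply] at h2
  rw [h2]
  simp_rw [key]

lemma truncT_rpow_le {σ : ℝ} {p : E d → ℝ} {B : Set (E d)} (hB : MeasurableSet B)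
    (hB' : ENNReal.ofReal (1 - σ) ≤ law p B) :
    truncT σ p ^ gam d ≤ ∫⁻ x in B, ENNReal.ofReal (p x ^ gam d) := by
  rw [truncT_rpow]
  exact iInf₂_le B ⟨hB, hB'⟩

lemma truncT_anti (p : E d → ℝ) : Antitone fun σ => truncT σ p := by
  intro σ σ' h
  refine le_iInf₂ fun B hB => iInf₂_le B ⟨hB.1, le_trans ?_ hB.2⟩
  exact ENNReal.ofReal_le_ofReal (by linarith)

lemma truncT_of_one_le {σ : ℝ} (hσ : 1 ≤ σ) (p : E d → ℝ) : truncT σ p = 0 := by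
  refine le_antisymm (iInf₂_le_of_le ∅ ⟨MeasurableSet.empty, ?_⟩ ?_) zero_le
  · rw [ENNReal.ofReal_of_nonpos (by linarith)]; exact zero_le
  · simp [gam_pos d]

lemma exists_lowerLevel_le {L : ℝ} {p : E d → ℝ} (hp : p ∈ lipBall d L) {τ : ℝ} (hτ : 0 < τ) :
    ∃ t > 0, (law p).real {x | p x ≤ t} ≤ τ := by
  have := isProbabilityMeasure_law hp
  have hm := (continuous_of_mem hp).measurable
  have h1 : Tendsto (fun k : ℕ => law p {x | p x ≤ 1 / ((k : ℝ) + 1)}) atTop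
      (𝓝 (law p (⋂ k : ℕ, {x | p x ≤ 1 / ((k : ℝ) + 1)}))) := by
    refine tendsto_measure_iInter_atTop
      (fun k => (measurableSet_le hm measurable_const).nullMeasurableSet) ?_ ⟨0, by finiteness⟩
    intro a b hab x hx
    exact le_trans (show p x ≤ _ from hx) (Nat.one_div_le_one_div hab)
  have h2 : law p (⋂ k : ℕ, {x | p x ≤ 1 / ((k : ℝ) + 1)}) = 0 := by
    rw [law_apply p (MeasurableSet.iInter fun k => measurableSet_le hm measurable_const)]
    refine setLIntegral_eq_zero (MeasurableSet.iInter fun k => measurableSet_le hm measurable_const)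
      fun x hx => ?_
    simp only [mem_iInter, mem_ofPred_eq] at hx
    simpa using ge_of_tendsto' tendsto_one_div_add_atTop_nhds_zero_nat hx
  rw [h2] at h1
  obtain ⟨k, hk⟩ := (h1.eventually (gt_mem_nhds (ENNReal.ofReal_pos.2 hτ))).exists
  exact ⟨1 / ((k : ℝ) + 1), by positivity, ENNReal.toReal_le_of_le_ofReal hτ.le hk.le⟩

/-- On a set where `t < p`, the integral of `p ^ γ` is at most `t ^ (γ - 1)` times the mass. -/
lemma setLIntegral_rpow_le {p : E d → ℝ} {t : ℝ} (ht : 0 < t) {D : Set (E d)}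
    (hD : MeasurableSet D) (hDt : ∀ x ∈ D, t < p x) :
    ∫⁻ x in D, ENNReal.ofReal (p x ^ gam d) ≤ ENNReal.ofReal (t ^ (gam d - 1)) * law p D := by
  rw [law_apply p hD, ← lintegral_const_mul' _ _ ENNReal.ofReal_ne_top]
  refine setLIntegral_mono' hD fun x hx => ?_
  have hx := hDt x hx
  rw [← ENNReal.ofReal_mul (by positivity)]
  refine ENNReal.ofReal_le_ofReal ?_
  have hpx : 0 < p x := ht.trans hx
  calc p x ^ gam d = p x ^ (gam d - 1) * p x := by
        rw [Real.rpow_sub_one hpx.ne']; field_simp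
    _ ≤ t ^ (gam d - 1) * p x := by
        refine mul_le_mul_of_nonneg_right ?_ hpx.le
        exact Real.rpow_le_rpow_of_nonpos ht hx.le (by have := gam_lt_one d; linarith)

/-- The local Lipschitz estimate for the truncated functional: a Borel set of mass at least `1 - σ`
is enlarged by a set of mass `σ - σ'` on which the density is bounded below. -/
lemma truncT_rpow_lipschitz [Nonempty (Fin d)] {L : ℝ} {p : E d → ℝ} (hp : p ∈ lipBall d L)
    {τ : ℝ} (hτ : 0 < τ) : ∃ K : ℝ, 0 < K ∧ ∀ σ' σ, τ ≤ σ' → σ' ≤ σ → σ ≤ σ' + τ / 2 →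
      truncT σ' p ^ gam d ≤ truncT σ p ^ gam d + ENNReal.ofReal (K * (σ - σ')) := by
  have := isProbabilityMeasure_law hp
  have hm := (continuous_of_mem hp).measurable
  obtain ⟨t, ht, htτ⟩ := exists_lowerLevel_le hp (half_pos hτ)
  refine ⟨t ^ (gam d - 1), by positivity, fun σ' σ h1 h2 h3 => ?_⟩
  conv_rhs => rw [truncT_rpow]
  simp only [ENNReal.iInf_add]
  refine le_iInf₂ fun B hB => ?_
  obtain ⟨hBm, hB⟩ := hB
  have hB : 1 - σ ≤ (law p).real B := (ENNReal.ofReal_le_iff_le_toReal (measure_ne_top _ _)).1 hB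
  by_cases hcase : 1 - σ' ≤ (law p).real B
  · refine le_add_right (truncT_rpow_le hBm ?_)
    exact (ENNReal.ofReal_le_iff_le_toReal (measure_ne_top _ _)).2 hcase
  push Not at hcase
  set C := Bᶜ \ {x | p x ≤ t}
  have hlev : MeasurableSet {x | p x ≤ t} := measurableSet_le hm measurable_const
  have hCm : MeasurableSet C := hBm.compl.diff hlev
  have hC : σ - σ' ≤ (law p).real C := by
    have e1 : (law p).real Bᶜ = 1 - (law p).real B := probReal_compl_eq_one_sub hBm
    have e2 : (law p).real Bᶜ - (law p).real {x | p x ≤ t} ≤ (law p).real C :=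
      le_measureReal_sdiff
    linarith
  obtain ⟨D, hDC, hDm, hD⟩ := exists_subset_measureReal_eq (law p) (law_absolutelyContinuous p)
    hCm (sub_nonneg.2 h2) hC
  have hDB : Disjoint B D := by
    rw [Set.disjoint_left]
    exact fun x hx hx' => (hDC hx').1 hx
  have hU : 1 - σ' ≤ (law p).real (B ∪ D) := by
    rw [measureReal_union hDB hDm]; linarith
  refine (truncT_rpow_le (hBm.union hDm)
    ((ENNReal.ofReal_le_iff_le_toReal (measure_ne_top _ _)).2 hU)).trans ?_
  rw [lintegral_union hDm hDB]
  gcongr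
  refine (setLIntegral_rpow_le ht hDm fun x hx => ?_).trans ?_
  · exact not_le.1 (hDC hx).2
  · rw [ENNReal.ofReal_mul (by positivity), ← hD, ofReal_measureReal]

lemma truncT_rpow_ne_top [Nonempty (Fin d)] {L : ℝ} {p : E d → ℝ} (hp : p ∈ lipBall d L)
    {σ : ℝ} (hσ : 0 < σ) : truncT σ p ^ gam d ≠ ⊤ := by
  have := isProbabilityMeasure_law hp
  have hm := (continuous_of_mem hp).measurable
  obtain ⟨t, ht, htσ⟩ := exists_lowerLevel_le hp hσ
  have hlev : MeasurableSet {x | p x ≤ t} := measurableSet_le hm measurable_const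
  refine ne_top_of_le_ne_top ?_ (truncT_rpow_le hlev.compl ?_)
  · refine ne_top_of_le_ne_top ?_ (setLIntegral_rpow_le ht hlev.compl fun x hx => not_le.1 hx)
    finiteness
  · refine (ENNReal.ofReal_le_iff_le_toReal (measure_ne_top _ _)).2 ?_
    have := probReal_compl_eq_one_sub (μ := law p) hlev
    rw [measureReal_def] at this
    rw [this]; linarith

lemma truncT_ne_top [Nonempty (Fin d)] {L : ℝ} {p : E d → ℝ} (hp : p ∈ lipBall d L)
    {σ : ℝ} (hσ : 0 < σ) : truncT σ p ≠ ⊤ := by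
  intro h
  apply truncT_rpow_ne_top hp hσ
  rw [h, ENNReal.top_rpow_of_pos (gam_pos d)]

lemma exists_upperLevel_le {L : ℝ} {p : E d → ℝ} (hp : p ∈ lipBall d L) {τ : ℝ} (hτ : 0 < τ) :
    ∃ M > 0, (law p).real {x | M < p x} ≤ τ := by
  have := isProbabilityMeasure_law hp
  have hm := (continuous_of_mem hp).measurable
  have h1 : Tendsto (fun k : ℕ => law p {x | (k : ℝ) + 1 < p x}) atTop
      (𝓝 (law p (⋂ k : ℕ, {x | (k : ℝ) + 1 < p x}))) := by
    refine tendsto_measure_iInter_atTop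
      (fun k => (measurableSet_lt measurable_const hm).nullMeasurableSet) ?_ ⟨0, by finiteness⟩
    intro a b hab x hx
    have : (a : ℝ) ≤ b := by exact_mod_cast hab
    exact lt_of_le_of_lt (by linarith) (show (b : ℝ) + 1 < p x from hx)
  have h2 : (⋂ k : ℕ, {x | (k : ℝ) + 1 < p x}) = ∅ := by
    refine eq_empty_of_forall_notMem fun x hx => ?_
    simp only [mem_iInter, mem_ofPred_eq] at hx
    obtain ⟨k, hk⟩ := exists_nat_gt (p x)
    linarith [hx k]
  rw [h2, measure_empty] at h1
  obtain ⟨k, hk⟩ := (h1.eventually (gt_mem_nhds (ENNReal.ofReal_pos.2 hτ))).exists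
  exact ⟨(k : ℝ) + 1, by positivity, ENNReal.toReal_le_of_le_ofReal hτ.le hk.le⟩

/-- Up to a small part of its mass `p` is at most some `M`, and there
`p ≤ M ^ (1 - γ) p ^ γ`. -/
lemma truncT_ne_zero {L : ℝ} {p : E d → ℝ} (hp : p ∈ lipBall d L)
    {σ : ℝ} (hσ : σ < 1) : truncT σ p ≠ 0 := by
  have := isProbabilityMeasure_law hp
  have hm := (continuous_of_mem hp).measurable
  obtain ⟨M, hM, hMσ⟩ := exists_upperLevel_le hp (half_pos (sub_pos.2 hσ))
  have hlev : MeasurableSet {x | M < p x} := measurableSet_lt measurable_const hm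
  intro h0
  have h1 : truncT σ p ^ gam d = 0 := by rw [h0, ENNReal.zero_rpow_of_pos (gam_pos d)]
  rw [truncT_rpow] at h1
  have h2 : ENNReal.ofReal ((1 - σ) / 2) ≤ ENNReal.ofReal (M ^ (1 - gam d)) *
      ⨅ B ∈ {B : Set (E d) | MeasurableSet B ∧ ENNReal.ofReal (1 - σ) ≤ law p B},
        ∫⁻ x in B, ENNReal.ofReal (p x ^ gam d) := by
    have hMp : ENNReal.ofReal (M ^ (1 - gam d)) ≠ 0 := by
      rw [Ne, ENNReal.ofReal_eq_zero, not_le]; positivity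
    simp only [ENNReal.mul_iInf_of_ne hMp ENNReal.ofReal_ne_top]
    refine le_iInf₂ fun B ⟨hBm, hB⟩ => ?_
    have hB : 1 - σ ≤ (law p).real B :=
      (ENNReal.ofReal_le_iff_le_toReal (measure_ne_top _ _)).1 hB
    have h3 : (1 - σ) / 2 ≤ (law p).real (B \ {x | M < p x}) := by
      have : (law p).real B - (law p).real {x | M < p x} ≤ _ := le_measureReal_sdiff
      linarith
    refine ((ENNReal.ofReal_le_iff_le_toReal (measure_ne_top _ _)).2 h3).trans ?_
    rw [law_apply p (hBm.diff hlev), ← lintegral_const_mul' _ _ ENNReal.ofReal_ne_top]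
    refine le_trans (setLIntegral_mono' (hBm.diff hlev) fun x hx => ?_)
      (lintegral_mono_set sdiff_subset)
    rw [← ENNReal.ofReal_mul (by positivity)]
    refine ENNReal.ofReal_le_ofReal ?_
    have hx2 : p x ≤ M := not_lt.1 hx.2
    rcases (hp.1 x).eq_or_lt with h | hpx
    · rw [← h]; positivity
    calc p x = p x ^ (1 - gam d) * p x ^ gam d := by
          rw [← Real.rpow_add hpx]; simp
      _ ≤ _ := by
          gcongr
          have := gam_lt_one d; linarith
  rw [h1, mul_zero, nonpos_iff_eq_zero, ENNReal.ofReal_eq_zero] at h2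
  linarith

lemma truncI_pos [Nonempty (Fin d)] {L : ℝ} {p : E d → ℝ} (hp : p ∈ lipBall d L)
    {σ : ℝ} (hσ : 0 < σ) (hσ' : σ < 1) : 0 < truncI σ p := by
  refine ENNReal.toReal_pos ?_ (truncT_rpow_ne_top hp hσ)
  rw [Ne, ENNReal.rpow_eq_zero_iff]
  have := gam_pos d
  have := truncT_ne_zero hp hσ'
  have := truncT_ne_top hp hσ
  simp_all

lemma truncI_of_one_le {σ : ℝ} (hσ : 1 ≤ σ) (p : E d → ℝ) : truncI σ p = 0 := by
  rw [truncI, truncT_of_one_le hσ, ENNReal.zero_rpow_of_pos (gam_pos d), ENNReal.toReal_zero]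

lemma truncI_nonneg (σ : ℝ) (p : E d → ℝ) : 0 ≤ truncI σ p := ENNReal.toReal_nonneg

lemma truncI_anti [Nonempty (Fin d)] {L : ℝ} {p : E d → ℝ} (hp : p ∈ lipBall d L) {σ σ' : ℝ}
    (hσ : 0 < σ) (h : σ ≤ σ') : truncI σ' p ≤ truncI σ p :=
  ENNReal.toReal_mono (truncT_rpow_ne_top hp hσ)
    (ENNReal.rpow_le_rpow (truncT_anti p h) (gam_pos d).le)

lemma continuousOn_truncI [Nonempty (Fin d)] {L : ℝ} {p : E d → ℝ} (hp : p ∈ lipBall d L) :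
    ContinuousOn (fun σ => truncI σ p) (Ioi 0) := by
  intro σ hσ
  apply ContinuousAt.continuousWithinAt
  have hσ : 0 < σ := hσ
  obtain ⟨K, hK, hKl⟩ := truncT_rpow_lipschitz hp (half_pos hσ)
  have key : ∀ a b, σ / 2 ≤ a → a ≤ b → b ≤ a + σ / 2 / 2 →
      |truncI a p - truncI b p| ≤ K * |a - b| := by
    intro a b h1 h2 h3
    have ha : 0 < a := by linarith
    have hb : 0 < b := by linarith
    have h4 := hKl a b h1 h2 h3
    have h5 : truncI a p ≤ truncI b p + K * (b - a) := by
      have := ENNReal.toReal_mono (by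
        have := truncT_rpow_ne_top hp hb
        finiteness) h4
      rwa [ENNReal.toReal_add (truncT_rpow_ne_top hp hb) ENNReal.ofReal_ne_top,
        ENNReal.toReal_ofReal (mul_nonneg hK.le (sub_nonneg.2 h2))] at this
    have h6 := truncI_anti hp ha h2
    rw [abs_of_nonneg (by linarith), abs_of_nonpos (by linarith)]
    linarith
  rw [Metric.continuousAt_iff]
  intro ε hε
  refine ⟨min (σ / 4) (ε / K), by positivity, fun {b} hb => ?_⟩
  rw [Real.dist_eq] at hb ⊢
  obtain ⟨hb1, hb2⟩ := lt_min_iff.1 hb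
  rw [lt_div_iff₀ hK] at hb2
  obtain ⟨hb3, hb4⟩ := abs_lt.1 hb1
  rcases le_total b σ with h | h
  · linarith [key b σ (by linarith) h (by linarith)]
  · rw [abs_sub_comm] at hb2 ⊢
    linarith [key σ b (by linarith) h (by linarith)]

/-- The critical equation with truncation constant `1`, in polynomial form. -/
lemma solvesCriticalEq_one_iff [Nonempty (Fin d)] {n : ℕ} (hn : 1 ≤ n) {L : ℝ} (hL : 0 < L)
    {L' : ℝ} {p : E d → ℝ} (hp : p ∈ lipBall d L') {v : ℝ} :
    SolvesCriticalEq n L 1 p v ↔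
      0 < v ∧ (n : ℝ) ^ 2 * v ^ (d + 4) = L ^ d * truncI v p ^ (d + 3) := by
  unfold SolvesCriticalEq
  rw [one_mul]
  refine and_congr_right fun hv => ?_
  have hT : truncT v p = ENNReal.ofReal (truncI v p ^ (((d : ℝ) + 3) / 2)) := by
    have hg := gam_pos d
    have h1 : truncT v p ^ gam d = ENNReal.ofReal (truncI v p) :=
      (ENNReal.ofReal_toReal (truncT_rpow_ne_top hp hv)).symm
    rw [← ENNReal.ofReal_rpow_of_nonneg (truncI_nonneg v p) (by positivity), ← h1,
      ← ENNReal.rpow_mul]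
    have : gam d * (((d : ℝ) + 3) / 2) = 1 := by
      unfold gam; field_simp; ring
    rw [this, ENNReal.rpow_one]
  have hI := truncI_nonneg v p
  have hn' : (0 : ℝ) < n := by exact_mod_cast hn
  set I := truncI v p
  rw [hT, ← ENNReal.ofReal_mul (by positivity), ← ENNReal.ofReal_natCast n,
    ← ENNReal.ofReal_div_of_pos hn', ENNReal.ofReal_rpow_of_nonneg (by positivity) (by positivity),
    ENNReal.ofReal_eq_ofReal_iff hv.le (by positivity)]
  -- both sides are raised to the power `d + 4`
  have h2 : (((L ^ ((d : ℝ) / 2) * I ^ (((d : ℝ) + 3) / 2) / n) ^ ((2 : ℝ) / (4 + (d : ℝ))))) ^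
      (d + 4) = L ^ d * I ^ (d + 3) / (n : ℝ) ^ 2 := by
    rw [← Real.rpow_natCast _ (d + 4), ← Real.rpow_mul (by positivity)]
    have : (2 : ℝ) / (4 + (d : ℝ)) * ((d + 4 : ℕ) : ℝ) = (2 : ℕ) := by
      push_cast; field_simp; ring
    rw [this, Real.rpow_natCast, div_pow, mul_pow, ← Real.rpow_natCast (L ^ _) 2,
      ← Real.rpow_natCast (I ^ _) 2, ← Real.rpow_mul hL.le, ← Real.rpow_mul hI]
    congr 2
    · rw [← Real.rpow_natCast]; congr 1; push_cast; ring
    · rw [← Real.rpow_natCast]; congr 1; push_cast; ring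
  rw [← pow_left_inj₀ hv.le (by positivity) (show d + 4 ≠ 0 by omega), h2,
    eq_div_iff (by positivity), mul_comm]

/-- The left side of the polynomial equation is increasing in `v`, the right side is nonincreasing,
continuous, positive at `1 / 2` and zero at `1`. -/
lemma existsUnique_solvesCriticalEq [Nonempty (Fin d)] {n : ℕ} (hn : 1 ≤ n) {L : ℝ} (hL : 0 < L)
    {p : E d → ℝ} (hp : p ∈ lipBall d L) : ∃! v : ℝ, SolvesCriticalEq n L 1 p v := by
  simp_rw [solvesCriticalEq_one_iff hn hL hp]
  have hn' : (0 : ℝ) < n := by exact_mod_cast hn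
  have hlt : ∀ a b : ℝ, 0 < a → a < b →
      (n : ℝ) ^ 2 * b ^ (d + 4) = L ^ d * truncI b p ^ (d + 3) →
      (n : ℝ) ^ 2 * a ^ (d + 4) ≠ L ^ d * truncI a p ^ (d + 3) := by
    intro a b ha hab hb
    have h1 : L ^ d * truncI b p ^ (d + 3) ≤ L ^ d * truncI a p ^ (d + 3) := by
      have := truncI_nonneg b p
      gcongr
      exact truncI_anti hp ha hab.le
    have h2 : (n : ℝ) ^ 2 * a ^ (d + 4) < (n : ℝ) ^ 2 * b ^ (d + 4) := by gcongr
    exact (by linarith : _ < _).ne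
  have hI : 0 < truncI (1 / 2) p := truncI_pos hp (by norm_num) (by norm_num)
  set c := L ^ d * truncI (1 / 2) p ^ (d + 3) / (n : ℝ) ^ 2 with hc
  have hcpos : 0 < c := by positivity
  set v₀ := min (1 / 2) c
  have hv₀ : 0 < v₀ := by positivity
  have hv₀1 : v₀ ≤ 1 / 2 := min_le_left _ _
  have hcont : ContinuousOn
      (fun v => (n : ℝ) ^ 2 * v ^ (d + 4) - L ^ d * truncI v p ^ (d + 3)) (Icc v₀ 1) := by
    have h1 : ContinuousOn (fun σ => truncI σ p) (Icc v₀ 1) :=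
      (continuousOn_truncI hp).mono fun x hx => hv₀.trans_le hx.1
    fun_prop
  obtain ⟨v, hv, hv0⟩ := intermediate_value_Icc (by linarith) hcont
    (show (0 : ℝ) ∈ Icc _ _ from ⟨by
      have h1 : L ^ d * truncI (1 / 2) p ^ (d + 3) ≤ L ^ d * truncI v₀ p ^ (d + 3) := by
        gcongr
        exact truncI_anti hp hv₀ hv₀1
      have h2 : (n : ℝ) ^ 2 * v₀ ^ (d + 4) ≤ (n : ℝ) ^ 2 * c := by
        gcongr
        calc v₀ ^ (d + 4) ≤ v₀ ^ 1 := by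
              exact pow_le_pow_of_le_one hv₀.le (by linarith) (by omega)
          _ ≤ c := by rw [pow_one]; exact min_le_right _ _
      have h3 : (n : ℝ) ^ 2 * c = L ^ d * truncI (1 / 2) p ^ (d + 3) := by
        rw [hc]; field_simp
      linarith, by
      simp [truncI_of_one_le le_rfl]⟩)
  have hvpos : 0 < v := hv₀.trans_le hv.1
  have hveq := sub_eq_zero.1 hv0
  refine ⟨v, ⟨hvpos, hveq⟩, fun y hy => ?_⟩
  rcases lt_trichotomy y v with h | h | h
  · exact absurd hy.2 (hlt y v hy.1 h hveq)
  · exact h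
  · exact absurd hveq (hlt v y hvpos h hy.2)

/-- What the critical equation says about a solution `v`, with `I = T_v(p) ^ γ`: the equation
itself in polynomial form, minimality of `I`, and a nearly minimizing set. -/
lemma SolvesCriticalEq.spec [Nonempty (Fin d)] {n : ℕ} (hn : 1 ≤ n) {L : ℝ} (hL : 0 < L)
    {L' : ℝ} {p : E d → ℝ} (hp : p ∈ lipBall d L') {v : ℝ} (hv : SolvesCriticalEq n L 1 p v) :
    0 < v ∧ v < 1 ∧ ∃ I : ℝ, 0 < I ∧ (n : ℝ) ^ 2 * v ^ (d + 4) = L ^ d * I ^ (d + 3) ∧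
      (∀ B, MeasurableSet B → 1 - v ≤ (law p).real B →
        ENNReal.ofReal I ≤ ∫⁻ x in B, ENNReal.ofReal (p x ^ gam d)) ∧
      ∃ B, MeasurableSet B ∧ 1 - v ≤ (law p).real B ∧
        ∫⁻ x in B, ENNReal.ofReal (p x ^ gam d) ≤ ENNReal.ofReal (2 * I) := by
  have := isProbabilityMeasure_law hp
  obtain ⟨h0, heq⟩ := (solvesCriticalEq_one_iff hn hL hp).1 hv
  have hn' : (0 : ℝ) < n := by exact_mod_cast hn
  have h1 : v < 1 := by
    by_contra! h
    rw [truncI_of_one_le h] at heq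
    have : 0 < (n : ℝ) ^ 2 * v ^ (d + 4) := by positivity
    simp at heq
    rcases heq with h | h <;> linarith
  have hI := truncI_pos hp h0 h1
  have hT : truncT v p ^ gam d = ENNReal.ofReal (truncI v p) :=
    (ENNReal.ofReal_toReal (truncT_rpow_ne_top hp h0)).symm
  refine ⟨h0, h1, truncI v p, hI, heq, fun B hB hB' => ?_, ?_⟩
  · rw [← hT]
    exact truncT_rpow_le hB ((ENNReal.ofReal_le_iff_le_toReal (measure_ne_top _ _)).2 hB')
  · have h2 : truncT v p ^ gam d < ENNReal.ofReal (2 * truncI v p) := by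
      rw [hT, ENNReal.ofReal_lt_ofReal_iff (by positivity)]; linarith
    simp only [truncT_rpow, iInf_lt_iff] at h2
    obtain ⟨B, hB, hB'⟩ := h2
    exact ⟨B, hB.1, (ENNReal.ofReal_le_iff_le_toReal (measure_ne_top _ _)).1 hB.2, hB'.le⟩

/-! ### Le Cam's method with a sign mixture -/

section LeCam

variable {X : Type*} [MeasurableSpace X]

lemma lintegral_pi_prod {n : ℕ} (ν : Measure X) [IsProbabilityMeasure ν] (f : Fin n → X → ℝ≥0∞)
    (hf : ∀ i, Measurable (f i)) :
    ∫⁻ z, ∏ i, f i (z i) ∂(Measure.pi fun _ : Fin n => ν) = ∏ i, ∫⁻ x, f i x ∂ν := by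
  have h1 : ProbabilityTheory.iIndepFun (fun (i : Fin n) (z : Fin n → X) => f i (z i))
      (Measure.pi fun _ : Fin n => ν) :=
    ProbabilityTheory.iIndepFun_pi (μ := fun _ => ν) fun i => (hf i).aemeasurable
  rw [ProbabilityTheory.lintegral_prod_eq_prod_lintegral_of_indepFun _ _ h1
    fun i => (hf i).comp (measurable_pi_apply i)]
  refine Finset.prod_congr rfl fun i _ => ?_
  exact (measurePreserving_eval (fun _ : Fin n => ν) i).lintegral_comp (hf i)

lemma pi_withDensity {n : ℕ} (ν : Measure X) [IsProbabilityMeasure ν] {f : X → ℝ≥0∞}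
    (hf : Measurable f) [IsFiniteMeasure (ν.withDensity f)] :
    Measure.pi (fun _ : Fin n => ν.withDensity f) =
      (Measure.pi fun _ : Fin n => ν).withDensity fun z => ∏ i, f (z i) := by
  refine Measure.pi_eq fun s hs => ?_
  rw [withDensity_apply _ (MeasurableSet.univ_pi hs),
    ← lintegral_indicator (MeasurableSet.univ_pi hs)]
  have h1 : (fun z : Fin n → X => (univ.pi s).indicator (fun z => ∏ i, f (z i)) z) =
      fun z => ∏ i, (s i).indicator f (z i) := by
    funext z
    by_cases hz : z ∈ univ.pi s
    · rw [indicator_of_mem hz]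
      exact Finset.prod_congr rfl fun i _ => (indicator_of_mem (hz i trivial) f).symm
    · rw [indicator_of_notMem hz]
      simp only [Set.mem_pi, mem_univ, true_imp_iff, not_forall] at hz
      obtain ⟨i, hi⟩ := hz
      exact (Finset.prod_eq_zero (Finset.mem_univ i) (indicator_of_notMem hi f)).symm
  rw [h1, lintegral_pi_prod ν _ fun i => hf.indicator (hs i)]
  refine Finset.prod_congr rfl fun i _ => ?_
  rw [lintegral_indicator (hs i), withDensity_apply _ (hs i)]

/-- The real number `±1` that belongs to a truth value. -/
def sgn (e : Bool) : ℝ := if e then 1 else -1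

variable {ι : Type*} [Fintype ι]

/-- The sum over all sign vectors factorizes into a product of hyperbolic cosines, and
`cosh t ≤ exp (t² / 2)`. -/
lemma sum_exp_sgn_le [DecidableEq ι] (ε' : ι → Bool) (t : ι → ℝ) :
    ∑ ε : ι → Bool, Real.exp (∑ b, sgn (ε b) * sgn (ε' b) * t b) ≤
      2 ^ Fintype.card ι * Real.exp ((∑ b, t b ^ 2) / 2) := by
  have h1 : ∑ ε : ι → Bool, Real.exp (∑ b, sgn (ε b) * sgn (ε' b) * t b) =
      ∏ b, ∑ e : Bool, Real.exp (sgn e * sgn (ε' b) * t b) := by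
    rw [Finset.prod_univ_sum, Fintype.piFinset_univ]
    simp_rw [Real.exp_sum]
  have h2 : ∀ b, ∑ e : Bool, Real.exp (sgn e * sgn (ε' b) * t b) = 2 * Real.cosh (t b) := by
    intro b
    rw [Real.cosh_eq]
    cases h : ε' b <;> simp [sgn] <;> ring
  rw [h1]
  simp_rw [h2]
  rw [Finset.prod_mul_distrib, Finset.prod_const, Finset.card_univ, Finset.sum_div, Real.exp_sum]
  gcongr with b
  exact Real.cosh_le_exp_half_sq _

lemma integral_perturb_mul {ν : Measure X} [IsProbabilityMeasure ν] {g : ι → X → ℝ} {a : ι → ℝ}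
    (hint : ∀ b, Integrable (g b) ν)
    (hint2 : ∀ b b', Integrable (fun x => g b x * g b' x) ν)
    (hzero : ∀ b, ∫ x, g b x ∂ν = 0)
    (horth : ∀ b b', b ≠ b' → ∫ x, g b x * g b' x ∂ν = 0)
    (hsq : ∀ b, ∫ x, g b x * g b x ∂ν = a b) (s s' : ι → ℝ) :
    ∫ x, (1 + ∑ b, s b * g b x) * (1 + ∑ b, s' b * g b x) ∂ν = 1 + ∑ b, s b * s' b * a b := by
  classical
  have h1 : ∀ x, (1 + ∑ b, s b * g b x) * (1 + ∑ b, s' b * g b x) =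
      (1 + ∑ b, (s b + s' b) * g b x) + ∑ b, ∑ b', (s b * s' b') * (g b x * g b' x) := by
    intro x
    have e1 : ∑ b, (s b + s' b) * g b x = ∑ b, s b * g b x + ∑ b, s' b * g b x := by
      rw [← Finset.sum_add_distrib]; simp_rw [add_mul]
    have e2 : ∑ b, ∑ b', (s b * s' b') * (g b x * g b' x) =
        (∑ b, s b * g b x) * ∑ b, s' b * g b x := by
      rw [Finset.sum_mul_sum]
      exact Finset.sum_congr rfl fun b _ => Finset.sum_congr rfl fun b' _ => by ring
    rw [e1, e2]; ring
  simp_rw [h1]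
  have i1 : Integrable (fun x => ∑ b, (s b + s' b) * g b x) ν :=
    integrable_finsetSum _ fun b _ => (hint b).const_mul _
  have i2 : Integrable (fun x => ∑ b, ∑ b', (s b * s' b') * (g b x * g b' x)) ν :=
    integrable_finsetSum _ fun b _ => integrable_finsetSum _ fun b' _ => (hint2 b b').const_mul _
  have e1 : ∫ x, ∑ b, (s b + s' b) * g b x ∂ν = 0 := by
    rw [integral_finsetSum _ fun b _ => (hint b).const_mul _]
    simp [integral_const_mul, hzero]
  have e2 : ∫ x, ∑ b, ∑ b', (s b * s' b') * (g b x * g b' x) ∂ν = ∑ b, s b * s' b * a b := by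
    rw [integral_finsetSum _ fun b _ =>
      integrable_finsetSum _ fun b' _ => (hint2 b b').const_mul _]
    refine Finset.sum_congr rfl fun b _ => ?_
    rw [integral_finsetSum _ fun b' _ => (hint2 b b').const_mul _,
      Finset.sum_eq_single b]
    · rw [integral_const_mul, hsq]
    · intro b' _ hb'
      rw [integral_const_mul, horth b b' hb'.symm, mul_zero]
    · simp
  have i3 : Integrable (fun x => 1 + ∑ b, (s b + s' b) * g b x) ν := (integrable_const 1).add i1
  rw [integral_add i3 i2, integral_add (integrable_const 1) i1, e1, e2]
  simp

/-- Le Cam's two-point method for the mixture over all sign vectors: if the perturbations `g b` of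
the likelihood are centred and orthogonal, then on any event one of the alternatives is nearly as
likely as the null. The bound is the `χ²` distance between the null and the uniform mixture. -/
lemma exists_sign_measure_ge [DecidableEq ι] {n : ℕ} (ν : Measure X)
    [IsProbabilityMeasure ν] {g : ι → X → ℝ} {a : ι → ℝ} (hg : ∀ b, Measurable (g b))
    (hbd : ∀ ε : ι → Bool, ∀ x, |∑ b, sgn (ε b) * g b x| ≤ 1)
    (hbd1 : ∀ b x, |g b x| ≤ 1)
    (hzero : ∀ b, ∫ x, g b x ∂ν = 0)
    (horth : ∀ b b', b ≠ b' → ∫ x, g b x * g b' x ∂ν = 0)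
    (hsq : ∀ b, ∫ x, g b x * g b x ∂ν = a b)
    {A : Set (Fin n → X)} (hA : MeasurableSet A) :
    ∃ ε : ι → Bool, (Measure.pi fun _ : Fin n => ν).real A -
        Real.sqrt (Real.exp (n ^ 2 * (∑ b, a b ^ 2) / 2) - 1) ≤
      (Measure.pi fun _ : Fin n => ν.withDensity fun x =>
        ENNReal.ofReal (1 + ∑ b, sgn (ε b) * g b x)).real A := by
  set N := Measure.pi fun _ : Fin n => ν with hN
  set r : (ι → Bool) → X → ℝ := fun ε x => 1 + ∑ b, sgn (ε b) * g b x with hr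
  have hint : ∀ b, Integrable (g b) ν := fun b =>
    Integrable.of_bound (hg b).aestronglyMeasurable 1 (Eventually.of_forall (hbd1 b))
  have hint2 : ∀ b b', Integrable (fun x => g b x * g b' x) ν := fun b b' =>
    Integrable.of_bound ((hg b).mul (hg b')).aestronglyMeasurable 1
      (Eventually.of_forall fun x => by
        rw [Real.norm_eq_abs, abs_mul]
        exact mul_le_one₀ (hbd1 b x) (abs_nonneg _) (hbd1 b' x))
  have hrm : ∀ ε, Measurable (r ε) := fun ε => by
    simp only [hr]
    exact measurable_const.add (Finset.measurable_sum _ fun b _ => (hg b).const_mul _)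
  have hr0 : ∀ ε x, 0 ≤ r ε x := fun ε x => by have := abs_le.1 (hbd ε x); simp only [hr]; linarith
  have hr2 : ∀ ε x, r ε x ≤ 2 := fun ε x => by have := abs_le.1 (hbd ε x); simp only [hr]; linarith
  have hrint : ∀ ε, Integrable (r ε) ν := fun ε =>
    Integrable.of_bound (hrm ε).aestronglyMeasurable 2 (Eventually.of_forall fun x => by
      rw [Real.norm_eq_abs, abs_of_nonneg (hr0 ε x)]; exact hr2 ε x)
  have hr1 : ∀ ε, ∫ x, r ε x ∂ν = 1 := fun ε => by
    have := integral_perturb_mul hint hint2 hzero horth hsq (fun b => sgn (ε b)) (fun _ => 0)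
    simpa using this
  set R : (ι → Bool) → (Fin n → X) → ℝ := fun ε z => ∏ i, r ε (z i) with hR
  have hRm : ∀ ε, Measurable (R ε) := fun ε =>
    Finset.measurable_prod _ fun i _ => (hrm ε).comp (measurable_pi_apply i)
  have hR0 : ∀ ε z, 0 ≤ R ε z := fun ε z => Finset.prod_nonneg fun i _ => hr0 ε _
  have hR2 : ∀ ε z, R ε z ≤ 2 ^ n := fun ε z => by
    refine (Finset.prod_le_prod (fun i _ => hr0 ε _) fun i _ => hr2 ε _).trans ?_
    simp
  have hRint : ∀ ε, Integrable (R ε) N := fun ε =>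
    Integrable.of_bound (hRm ε).aestronglyMeasurable (2 ^ n) (Eventually.of_forall fun x => by
      rw [Real.norm_eq_abs, abs_of_nonneg (hR0 ε x)]; exact hR2 ε x)
  have hRRint : ∀ ε ε', Integrable (fun z => R ε z * R ε' z) N := fun ε ε' =>
    Integrable.of_bound ((hRm ε).mul (hRm ε')).aestronglyMeasurable (2 ^ n * 2 ^ n)
      (Eventually.of_forall fun x => by
        rw [Real.norm_eq_abs, abs_of_nonneg (mul_nonneg (hR0 ε x) (hR0 ε' x))]
        exact mul_le_mul (hR2 ε x) (hR2 ε' x) (hR0 ε' x) (by positivity))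
  have hR1 : ∀ ε, ∫ z, R ε z ∂N = 1 := fun ε => by
    simp only [hR, hN]
    rw [integral_fintype_prod_eq_prod]
    simp [hr1]
  have hRR : ∀ ε ε', ∫ z, R ε z * R ε' z ∂N ≤
      Real.exp (∑ b, sgn (ε b) * sgn (ε' b) * (n * a b)) := fun ε ε' => by
    simp only [hR, hN, ← Finset.prod_mul_distrib]
    rw [integral_fintype_prod_eq_prod (𝕜 := ℝ) (fun (i : Fin n) x => r ε x * r ε' x)]
    simp only [hr, Finset.prod_const, Finset.card_univ, Fintype.card_fin]
    have h0 : 0 ≤ ∫ x, r ε x * r ε' x ∂ν := integral_nonneg fun x => mul_nonneg (hr0 _ _) (hr0 _ _)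
    simp only [hr] at h0
    rw [integral_perturb_mul hint hint2 hzero horth hsq] at h0 ⊢
    refine (pow_le_pow_left₀ h0 ((add_comm _ _).le.trans (Real.add_one_le_exp _)) n).trans ?_
    rw [← Real.exp_nat_mul, Finset.mul_sum]
    refine (congrArg Real.exp (Finset.sum_congr rfl fun b _ => ?_)).le
    ring
  have hmeas : ∀ ε, (Measure.pi fun _ : Fin n => ν.withDensity fun x =>
      ENNReal.ofReal (r ε x)).real A = ∫ z in A, R ε z ∂N := fun ε => by
    have hfin : IsFiniteMeasure (ν.withDensity fun x => ENNReal.ofReal (r ε x)) :=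
      isFiniteMeasure_withDensity_ofReal (hrint ε).2
    rw [pi_withDensity ν (hrm ε).ennreal_ofReal, measureReal_def, withDensity_apply _ hA,
      integral_eq_lintegral_of_nonneg_ae (Eventually.of_forall (hR0 ε))
        (hRm ε).aestronglyMeasurable]
    simp only [hR, ENNReal.ofReal_prod_of_nonneg (fun i _ => hr0 ε _), hN]
  set K : ℝ := 2 ^ Fintype.card ι with hK
  have hKpos : 0 < K := by positivity
  have hcard : (Fintype.card (ι → Bool) : ℝ) = K := by simp [hK]
  set D := Real.exp (n ^ 2 * (∑ b, a b ^ 2) / 2)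
  set Λ : (Fin n → X) → ℝ := fun z => K⁻¹ * ∑ ε, R ε z with hΛ
  have hΛint : Integrable Λ N := (integrable_finsetSum _ fun ε _ => hRint ε).const_mul _
  have hΛ1 : ∫ z, Λ z ∂N = 1 := by
    simp only [hΛ]
    rw [integral_const_mul, integral_finsetSum _ fun ε _ => hRint ε]
    simp only [hR1, Finset.sum_const, Finset.card_univ, nsmul_eq_mul, mul_one, hcard]
    exact inv_mul_cancel₀ hKpos.ne'
  have hΛsq : ∀ z, Λ z ^ 2 = (K⁻¹ * K⁻¹) * ∑ ε, ∑ ε', R ε z * R ε' z := fun z => by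
    simp only [hΛ]
    rw [mul_pow, sq (∑ ε, R ε z), Finset.sum_mul_sum, sq]
  have hΛsqint : Integrable (fun z => Λ z ^ 2) N := by
    simp_rw [hΛsq]
    exact (integrable_finsetSum _ fun ε _ =>
      integrable_finsetSum _ fun ε' _ => hRRint ε ε').const_mul _
  have hΛ2 : ∫ z, Λ z ^ 2 ∂N ≤ D := by
    simp_rw [hΛsq]
    rw [integral_const_mul, integral_finsetSum _ fun ε _ =>
      integrable_finsetSum _ fun ε' _ => hRRint ε ε']
    have h1 : ∑ ε, ∫ z, ∑ ε', R ε z * R ε' z ∂N ≤ K * (K * D) := by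
      simp_rw [integral_finsetSum _ fun ε' _ => hRRint _ ε']
      rw [Finset.sum_comm]
      refine (Finset.sum_le_sum fun ε' _ => (Finset.sum_le_sum fun ε _ => hRR ε ε').trans
        (sum_exp_sgn_le ε' _)).trans ?_
      simp only [Finset.sum_const, Finset.card_univ, nsmul_eq_mul, hcard, mul_pow,
        ← Finset.mul_sum]
      rfl
    calc _ ≤ (K⁻¹ * K⁻¹) * (K * (K * D)) := by gcongr
      _ = D := by field_simp
  have hdint : Integrable (fun z => 1 - Λ z) N := (integrable_const 1).sub hΛint
  have hdsq : ∫ z, (1 - Λ z) ^ 2 ∂N ≤ D - 1 := by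
    have : ∀ z, (1 - Λ z) ^ 2 = (1 - 2 * Λ z) + Λ z ^ 2 := fun z => by ring
    simp_rw [this]
    have i1 : Integrable (fun z => 1 - 2 * Λ z) N := (integrable_const 1).sub (hΛint.const_mul 2)
    rw [integral_add i1 hΛsqint,
      integral_sub (integrable_const 1) (hΛint.const_mul 2), integral_const_mul, hΛ1]
    simp
    linarith
  have hdabs : ∫ z, |1 - Λ z| ∂N ≤ Real.sqrt (D - 1) := by
    refine Real.le_sqrt_of_sq_le (le_trans ?_ hdsq)
    have hm : MemLp (fun z => |1 - Λ z|) 2 N := by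
      refine MemLp.abs ?_
      rw [memLp_two_iff_integrable_sq hdint.aestronglyMeasurable]
      have : ∀ z, (1 - Λ z) ^ 2 = (1 - 2 * Λ z) + Λ z ^ 2 := fun z => by ring
      simp_rw [this]
      exact ((integrable_const 1).sub (hΛint.const_mul 2)).add hΛsqint
    have := ProbabilityTheory.variance_nonneg (fun z => |1 - Λ z|) N
    rw [ProbabilityTheory.variance_eq_sub hm] at this
    simpa using this
  have hAΛ : N.real A - Real.sqrt (D - 1) ≤ ∫ z in A, Λ z ∂N := by
    have h1 : N.real A - ∫ z in A, Λ z ∂N = ∫ z in A, (1 - Λ z) ∂N := by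
      rw [integral_sub (integrable_const 1) hΛint.integrableOn]
      simp
    have h2 : ∫ z in A, (1 - Λ z) ∂N ≤ ∫ z, |1 - Λ z| ∂N :=
      (integral_mono hdint.integrableOn hdint.abs.integrableOn fun z => le_abs_self _).trans
        (setIntegral_le_integral hdint.abs (Eventually.of_forall fun z => abs_nonneg _))
    linarith
  by_contra! hcon
  have h1 : ∫ z in A, Λ z ∂N = K⁻¹ * ∑ ε, ∫ z in A, R ε z ∂N := by
    simp only [hΛ]
    rw [integral_const_mul, integral_finsetSum _ fun ε _ => (hRint ε).integrableOn]
  have h2 : ∑ ε, ∫ z in A, R ε z ∂N < ∑ ε : ι → Bool, (N.real A - Real.sqrt (D - 1)) := by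
    refine Finset.sum_lt_sum_of_nonempty Finset.univ_nonempty fun ε _ => ?_
    rw [← hmeas]
    exact hcon ε
  rw [Finset.sum_const, Finset.card_univ, nsmul_eq_mul, hcard] at h2
  rw [h1] at hAΛ
  have h3 := mul_lt_mul_of_pos_left h2 (inv_pos.2 hKpos)
  rw [inv_mul_cancel_left₀ hKpos.ne'] at h3
  linarith

end LeCam

/-! ### Disjoint perturbations -/

lemma sum_le_of_pairwise_zero {ι : Type*} {s : Finset ι} {f : ι → ℝ} {c : ℝ} (hc : 0 ≤ c)
    (hf : ∀ b ∈ s, f b ≤ c) (h0 : ∀ b ∈ s, ∀ b' ∈ s, b ≠ b' → f b = 0 ∨ f b' = 0) :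
    ∑ b ∈ s, f b ≤ c := by
  by_cases h : ∃ b ∈ s, f b ≠ 0
  · obtain ⟨b, hb, hb0⟩ := h
    rw [Finset.sum_eq_single_of_mem b hb fun b' hb' hne =>
      (h0 b hb b' hb' hne.symm).resolve_left hb0]
    exact hf b hb
  · push Not at h
    rw [Finset.sum_eq_zero h]
    exact hc

lemma abs_sgn_mul (e : Bool) (x : ℝ) : |sgn e * x| = |x| := by
  cases e <;> simp [sgn]

lemma abs_sum_sgn_mul {ι : Type*} {s : Finset ι} {f : ι → ℝ} (e : ι → Bool)
    (h0 : ∀ b ∈ s, ∀ b' ∈ s, b ≠ b' → f b = 0 ∨ f b' = 0) :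
    |∑ b ∈ s, sgn (e b) * f b| = ∑ b ∈ s, |f b| := by
  by_cases h : ∃ b ∈ s, f b ≠ 0
  · obtain ⟨b, hb, hb0⟩ := h
    have h1 : ∀ b' ∈ s, b' ≠ b → f b' = 0 := fun b' hb' hne =>
      (h0 b hb b' hb' hne.symm).resolve_left hb0
    rw [Finset.sum_eq_single_of_mem b hb fun b' hb' hne => by rw [h1 b' hb' hne, mul_zero],
      Finset.sum_eq_single_of_mem b hb fun b' hb' hne => by rw [h1 b' hb' hne, abs_zero],
      abs_sgn_mul]
  · push Not at h
    rw [Finset.sum_eq_zero fun b hb => by rw [h b hb, mul_zero],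
      Finset.sum_eq_zero fun b hb => by rw [h b hb, abs_zero], abs_zero]

/-- The cone of height `r` over the ball of radius `r` around `a`. -/
noncomputable def tent (a : E d) (r : ℝ) (y : E d) : ℝ := max 0 (r - ‖y - a‖)

lemma continuous_tent (a : E d) (r : ℝ) : Continuous (tent a r) := by
  unfold tent; fun_prop

lemma tent_nonneg (a : E d) (r : ℝ) (y : E d) : 0 ≤ tent a r y := le_max_left _ _

lemma tent_le {a : E d} {r : ℝ} (hr : 0 ≤ r) (y : E d) : tent a r y ≤ r :=
  max_le hr (by linarith [norm_nonneg (y - a)])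

lemma tent_eq_zero {a : E d} {r : ℝ} {y : E d} (h : r ≤ ‖y - a‖) : tent a r y = 0 :=
  max_eq_left (by linarith)

lemma abs_tent_sub_le (a : E d) (r : ℝ) (x y : E d) : |tent a r x - tent a r y| ≤ ‖x - y‖ := by
  unfold tent
  refine (abs_max_sub_max_le_max _ _ _ _).trans ?_
  rw [sub_self, abs_zero, max_eq_right (abs_nonneg _)]
  have : r - ‖x - a‖ - (r - ‖y - a‖) = ‖y - a‖ - ‖x - a‖ := by ring
  rw [this, abs_sub_comm]
  refine (abs_norm_sub_norm_le _ _).trans ?_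
  rw [sub_sub_sub_cancel_right]

lemma integrable_tent (a : E d) (r : ℝ) : Integrable (tent a r) := by
  refine (continuous_tent a r).integrable_of_hasCompactSupport
    (HasCompactSupport.of_support_subset_isCompact (isCompact_closedBall a r) fun y hy => ?_)
  rw [mem_closedBall_iff_norm]
  by_contra! h
  exact hy (tent_eq_zero h.le)

lemma integral_tent (a : E d) (r : ℝ) : ∫ y, tent a r y = ∫ y, tent (0 : E d) r y := by
  rw [← integral_sub_right_eq_self (tent 0 r) a]
  simp [tent]

/-- A centred bump supported on the ball of radius `h` around `x`: the difference of two cones over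
the disjoint balls of radius `h / 2` around `x ± h c`, where `c` is a vector of length `1 / 2`. -/
noncomputable def bump (c x : E d) (h : ℝ) (y : E d) : ℝ :=
  tent (x + h • c) (h / 2) y - tent (x - h • c) (h / 2) y

lemma continuous_bump (c x : E d) (h : ℝ) : Continuous (bump c x h) :=
  (continuous_tent _ _).sub (continuous_tent _ _)

lemma integrable_bump (c x : E d) (h : ℝ) : Integrable (bump c x h) :=
  (integrable_tent _ _).sub (integrable_tent _ _)

lemma integral_bump (c x : E d) (h : ℝ) : ∫ y, bump c x h y = 0 := by
  unfold bump
  rw [integral_sub (integrable_tent _ _) (integrable_tent _ _), integral_tent,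
    integral_tent (_ - _), sub_self]

lemma abs_bump_le {h : ℝ} (hh : 0 ≤ h) (c x y : E d) : |bump c x h y| ≤ h / 2 := by
  unfold bump
  have h2 : 0 ≤ h / 2 := by linarith
  rw [abs_le]
  constructor
  · linarith [tent_nonneg (x + h • c) (h / 2) y, tent_le (a := x - h • c) h2 y]
  · linarith [tent_nonneg (x - h • c) (h / 2) y, tent_le (a := x + h • c) h2 y]

lemma abs_bump_sub_le (c x : E d) (h : ℝ) (y z : E d) :
    |bump c x h y - bump c x h z| ≤ 2 * ‖y - z‖ := by
  unfold bump
  rw [sub_sub_sub_comm]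
  refine (abs_sub _ _).trans ?_
  linarith [abs_tent_sub_le (x + h • c) (h / 2) y z, abs_tent_sub_le (x - h • c) (h / 2) y z]

lemma bump_eq_zero {c x : E d} (hc : ‖c‖ = 1 / 2) {h : ℝ} (hh : 0 ≤ h) {y : E d}
    (hy : y ∉ Metric.closedBall x h) : bump c x h y = 0 := by
  rw [mem_closedBall_iff_norm, not_le] at hy
  have hn : ‖h • c‖ = h / 2 := by rw [norm_smul, hc, Real.norm_of_nonneg hh]; ring
  unfold bump
  rw [tent_eq_zero, tent_eq_zero, sub_zero]
  · have : ‖y - x‖ ≤ ‖y - (x - h • c)‖ + ‖h • c‖ := by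
      have := norm_sub_le (y - (x - h • c)) (h • c)
      rwa [show y - (x - h • c) - h • c = y - x by abel] at this
    linarith
  · have : ‖y - x‖ ≤ ‖y - (x + h • c)‖ + ‖h • c‖ := by
      have := norm_add_le (y - (x + h • c)) (h • c)
      rwa [show y - (x + h • c) + h • c = y - x by abel] at this
    linarith

/-- The volume of the Euclidean unit ball. -/
noncomputable def unitVol (d : ℕ) : ℝ := volume.real (Metric.ball (0 : E d) 1)

lemma unitVol_pos (d : ℕ) : 0 < unitVol d :=
  ENNReal.toReal_pos (Metric.measure_ball_pos _ _ one_pos).ne' measure_ball_lt_top.ne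

lemma volume_closedBall (x : E d) {r : ℝ} (hr : 0 ≤ r) :
    volume (Metric.closedBall x r) = ENNReal.ofReal (unitVol d * r ^ d) := by
  rw [Measure.addHaar_closedBall _ _ hr, mul_comm, ENNReal.ofReal_mul (unitVol_pos d).le, unitVol,
    ofReal_measureReal measure_ball_lt_top.ne]
  simp

lemma volume_real_closedBall (x : E d) {r : ℝ} (hr : 0 ≤ r) :
    volume.real (Metric.closedBall x r) = unitVol d * r ^ d := by
  rw [measureReal_def, volume_closedBall x hr, ENNReal.toReal_ofReal]
  have := unitVol_pos d
  positivity

lemma le_integral_abs_bump {c x : E d} (hc : ‖c‖ = 1 / 2) {h : ℝ} (hh : 0 ≤ h) :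
    unitVol d * (h / 4) ^ (d + 1) ≤ ∫ y, |bump c x h y| := by
  have hn : ‖h • c‖ = h / 2 := by rw [norm_smul, hc, Real.norm_of_nonneg hh]; ring
  have h1 : ∀ y ∈ Metric.closedBall (x + h • c) (h / 4), h / 4 ≤ |bump c x h y| := by
    intro y hy
    rw [mem_closedBall_iff_norm] at hy
    refine le_trans ?_ (le_abs_self _)
    have h3 : ‖h • c‖ + ‖h • c‖ ≤ ‖y - (x - h • c)‖ + ‖y - (x + h • c)‖ := by
      have := norm_sub_le (y - (x - h • c)) (y - (x + h • c))
      rw [show y - (x - h • c) - (y - (x + h • c)) = (2 : ℝ) • (h • c) by rw [two_smul]; abel,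
        norm_smul] at this
      norm_num at this ⊢
      linarith
    unfold bump
    rw [tent_eq_zero (a := x - h • c) (by linarith), sub_zero]
    exact le_trans (by linarith) (le_max_right _ _)
  have h2 := setIntegral_mono_on (μ := volume) (s := Metric.closedBall (x + h • c) (h / 4))
    (f := fun _ => h / 4) (integrableOn_const (measure_closedBall_lt_top.ne))
    (integrable_bump c x h).abs.integrableOn measurableSet_closedBall h1
  rw [setIntegral_const, volume_real_closedBall _ (by linarith), smul_eq_mul] at h2
  calc _ = unitVol d * (h / 4) ^ d * (h / 4) := by ring
    _ ≤ _ := h2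
    _ ≤ _ := setIntegral_le_integral (integrable_bump c x h).abs
        (Eventually.of_forall fun _ => abs_nonneg _)

/-! ### An adaptive packing -/

/-- The local scale `min (θ s ^ γ) s` at density value `s`. On the bulk `θ s ^ γ ≤ s` it is the
optimal bandwidth up to constants and the factor `L`; in the tail, where the density is too small
for that, a perturbation can only be as large as the density itself. -/
noncomputable def scale (d : ℕ) (θ s : ℝ) : ℝ := min (θ * s ^ gam d) s

lemma scale_le (d : ℕ) (θ s : ℝ) : scale d θ s ≤ s := min_le_right _ _

lemma scale_pos {θ s : ℝ} (hθ : 0 < θ) (hs : 0 < s) : 0 < scale d θ s := by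
  unfold scale; positivity

lemma scale_nonneg {θ s : ℝ} (hθ : 0 ≤ θ) (hs : 0 ≤ s) : 0 ≤ scale d θ s := by
  unfold scale; positivity

lemma scale_zero (d : ℕ) (θ : ℝ) : scale d θ 0 = 0 := by
  unfold scale
  rw [Real.zero_rpow (gam_pos d).ne']; simp

lemma scale_pow_le {θ s : ℝ} (hθ : 0 ≤ θ) (hs : 0 ≤ s) :
    scale d θ s ^ (d + 3) ≤ θ ^ (d + 3) * s ^ 2 := by
  calc scale d θ s ^ (d + 3) ≤ (θ * s ^ gam d) ^ (d + 3) :=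
        pow_le_pow_left₀ (scale_nonneg hθ hs) (min_le_left _ _) _
    _ = _ := by rw [mul_pow, rpow_gam_pow d hs]

lemma scale_le_two_mul {θ s t : ℝ} (hθ : 0 ≤ θ) (hs : 0 ≤ s) (ht : 0 ≤ t) (hst : s ≤ 2 * t) :
    scale d θ s ≤ 2 * scale d θ t := by
  unfold scale
  rw [mul_min_of_nonneg _ _ (by norm_num : (0 : ℝ) ≤ 2)]
  refine min_le_min ?_ hst
  have h1 : s ^ gam d ≤ 2 * t ^ gam d := rpow_gam_le_two_mul d hs ht hst
  nlinarith

/-- A consequence of the minimality of `I`: either the bulk is an admissible set, or the tail, where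
the scale is the density itself, has mass at least `v`. -/
lemma le_lintegral_scale {L : ℝ} {p : E d → ℝ} (hp : p ∈ lipBall d L) {v I : ℝ} (hv : 0 < v)
    (hI : 0 < I) (hmin : ∀ B, MeasurableSet B → 1 - v ≤ (law p).real B →
        ENNReal.ofReal I ≤ ∫⁻ x in B, ENNReal.ofReal (p x ^ gam d)) :
    ENNReal.ofReal v ≤ ∫⁻ x, ENNReal.ofReal (scale d (v / I) (p x)) := by
  have := isProbabilityMeasure_law hp
  have hm := (continuous_of_mem hp).measurable
  set D := {x | v / I * p x ^ gam d ≤ p x}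
  have hD : MeasurableSet D := measurableSet_le (by fun_prop) hm
  rcases le_or_gt v ((law p).real Dᶜ) with h | h
  · calc ENNReal.ofReal v ≤ law p Dᶜ :=
          (ENNReal.ofReal_le_iff_le_toReal (measure_ne_top _ _)).2 h
      _ = ∫⁻ x in Dᶜ, ENNReal.ofReal (p x) := law_apply p hD.compl
      _ = ∫⁻ x in Dᶜ, ENNReal.ofReal (scale d (v / I) (p x)) :=
          setLIntegral_congr_fun hD.compl fun x hx => by
            have hx : p x < v / I * p x ^ gam d := not_le.1 hx
            simp only [scale, min_eq_right hx.le]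
      _ ≤ _ := setLIntegral_le_lintegral _ _
  · have h1 : 1 - v ≤ (law p).real D := by
      have := probReal_compl_eq_one_sub (μ := law p) hD
      linarith
    calc ENNReal.ofReal v = ENNReal.ofReal (v / I) * ENNReal.ofReal I := by
          rw [← ENNReal.ofReal_mul (by positivity), div_mul_cancel₀ _ hI.ne']
      _ ≤ ENNReal.ofReal (v / I) * ∫⁻ x in D, ENNReal.ofReal (p x ^ gam d) := by
          gcongr; exact hmin D hD h1
      _ = ∫⁻ x in D, ENNReal.ofReal (scale d (v / I) (p x)) := by
          rw [← lintegral_const_mul' _ _ ENNReal.ofReal_ne_top]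
          refine setLIntegral_congr_fun hD fun x hx => ?_
          have hx : v / I * p x ^ gam d ≤ p x := hx
          simp only [scale, min_eq_left hx]
          rw [ENNReal.ofReal_mul (by positivity)]
      _ ≤ _ := setLIntegral_le_lintegral _ _

/-- Vitali's covering theorem for the balls of radius `κ / L * scale (p x)`: finitely many disjoint
ones carry a fixed proportion of the integral of the scale. -/
lemma exists_packing [Nonempty (Fin d)] {L : ℝ} (hL : 0 < L) {p : E d → ℝ} (hp : p ∈ lipBall d L)
    {θ v κ : ℝ} (hθ : 0 < θ) (hv : 0 < v) (hκ : 0 < κ) (hκ' : κ ≤ 1 / 10)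
    (hint : ENNReal.ofReal v ≤ ∫⁻ x, ENNReal.ofReal (scale d θ (p x))) :
    ∃ F : Finset (E d), (∀ b ∈ F, 0 < p b) ∧
      ((F : Set (E d)).PairwiseDisjoint fun b => Metric.closedBall b (κ / L * scale d θ (p b))) ∧
      v / (4 * 5 ^ d) ≤
        ∑ b ∈ F, scale d θ (p b) * (unitVol d * (κ / L * scale d θ (p b)) ^ d) := by
  have hm := (continuous_of_mem hp).measurable
  set h : E d → ℝ := fun x => κ / L * scale d θ (p x) with hh
  have hω := unitVol_pos d
  set S : ℕ → Set (E d) := fun k => {x | 0 < p x} ∩ Metric.closedBall 0 (k : ℝ)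
  set ν : Measure (E d) := volume.withDensity fun x => ENNReal.ofReal (scale d θ (p x))
  have hlim : Tendsto (fun k => ν (S k)) atTop (𝓝 (ν (⋃ k, S k))) := by
    refine tendsto_measure_iUnion_atTop fun a b hab => ?_
    exact inter_subset_inter_right _ (Metric.closedBall_subset_closedBall (by exact_mod_cast hab))
  have hpos : MeasurableSet {x | 0 < p x} := measurableSet_lt measurable_const hm
  have hU : ENNReal.ofReal v ≤ ν (⋃ k, S k) := by
    rw [← inter_iUnion, Metric.iUnion_closedBall_nat, inter_univ, withDensity_apply _ hpos]
    refine hint.trans_eq ?_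
    rw [← lintegral_indicator hpos]
    refine lintegral_congr fun x => ?_
    by_cases hx : 0 < p x
    · rw [indicator_of_mem (show x ∈ {x | 0 < p x} from hx)]
    · rw [indicator_of_notMem (show x ∉ {x | 0 < p x} from hx),
        le_antisymm (not_lt.1 hx) (hp.1 x), scale_zero, ENNReal.ofReal_zero]
  obtain ⟨k, hk⟩ := (hlim.eventually (lt_mem_nhds (lt_of_lt_of_le
    ((ENNReal.ofReal_lt_ofReal_iff hv).2 (half_lt_self hv)) hU))).exists
  have hrad : ∀ x ∈ S k, h x ≤ κ / L * (p 0 + L * k) := by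
    intro x hx
    have h1 := hp.2.2 x 0
    have h2 : ‖x‖ ≤ k := by simpa using hx.2
    rw [sub_zero] at h1
    have h3 : L * ‖x‖ ≤ L * k := by gcongr
    simp only [hh]
    gcongr
    linarith [scale_le d θ (p x), le_abs_self (p x - p 0)]
  obtain ⟨u, huS, hdisj, hcov⟩ := Vitali.exists_disjoint_subfamily_covering_enlargement_closedBall
    (S k) id h _ hrad 5 (by norm_num)
  simp only [id] at hdisj hcov
  have hupos : ∀ b ∈ u, 0 < p b := fun b hb => (huS hb).1
  have hhpos : ∀ b ∈ u, 0 < h b := fun b hb => by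
    have := scale_pos (d := d) hθ (hupos b hb)
    simp only [hh]; positivity
  have hcount : u.Countable := by
    refine hdisj.countable_of_nonempty_interior fun b hb => ?_
    exact ⟨b, Metric.ball_subset_interior_closedBall (Metric.mem_ball_self (hhpos b hb))⟩
  have : Countable u := hcount.to_subtype
  have hscale : ∀ b ∈ u, ∀ y ∈ Metric.closedBall b (5 * h b),
      scale d θ (p y) ≤ 2 * scale d θ (p b) := by
    intro b hb y hy
    refine scale_le_two_mul hθ.le (hp.1 y) (hp.1 b) ?_
    rw [mem_closedBall_iff_norm] at hy
    have h1 := (le_abs_self _).trans (hp.2.2 y b)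
    have h2 : L * ‖y - b‖ ≤ L * (5 * h b) := by gcongr
    have h3 : L * (5 * h b) = 5 * κ * scale d θ (p b) := by simp only [hh]; field_simp
    have h4 : 5 * κ * scale d θ (p b) ≤ 1 * p b :=
      mul_le_mul (by linarith) (scale_le _ _ _) (scale_nonneg hθ.le (hp.1 b)) zero_le_one
    linarith
  set W : E d → ℝ := fun b => scale d θ (p b) * (unitVol d * h b ^ d) with hW
  have hsum : ν (S k) ≤ ∑' b : u, ENNReal.ofReal (2 * 5 ^ d * W b) := by
    calc ν (S k) ≤ ν (⋃ b : u, Metric.closedBall (b : E d) (5 * h b)) := by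
          refine measure_mono fun x hx => ?_
          obtain ⟨b, hb, hsub⟩ := hcov x hx
          have hx0 : 0 ≤ h x := by
            have := scale_nonneg (d := d) hθ.le (hp.1 x)
            simp only [hh]; positivity
          exact mem_iUnion.2 ⟨⟨b, hb⟩, hsub (Metric.mem_closedBall_self hx0)⟩
      _ ≤ ∑' b : u, ν (Metric.closedBall (b : E d) (5 * h b)) := measure_iUnion_le _
      _ ≤ _ := by
          refine ENNReal.tsum_le_tsum fun b => ?_
          have hb := hhpos b b.2
          have hsc := scale_pos (d := d) hθ (hupos b b.2)
          rw [withDensity_apply _ measurableSet_closedBall]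
          refine (setLIntegral_mono' measurableSet_closedBall
            (g := fun _ => ENNReal.ofReal (2 * scale d θ (p b))) fun y hy =>
            ENNReal.ofReal_le_ofReal (hscale b b.2 y hy)).trans ?_
          rw [setLIntegral_const, volume_closedBall _ (by positivity),
            ← ENNReal.ofReal_mul (by positivity)]
          refine ENNReal.ofReal_le_ofReal (le_of_eq ?_)
          simp only [hW]
          ring
  have hlt := hk.trans_le hsum
  rw [ENNReal.tsum_eq_iSup_sum, lt_iSup_iff] at hlt
  obtain ⟨F, hF⟩ := hlt
  refine ⟨F.map (Function.Embedding.subtype _), ?_, ?_, ?_⟩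
  · intro b hb
    obtain ⟨b', -, rfl⟩ := Finset.mem_map.1 hb
    exact hupos b' b'.2
  · refine hdisj.subset fun b hb => ?_
    obtain ⟨b', -, rfl⟩ := Finset.mem_map.1 (Finset.mem_coe.1 hb)
    exact b'.2
  · rw [Finset.sum_map]
    simp only [Function.Embedding.subtype_apply]
    rw [← ENNReal.ofReal_sum_of_nonneg, ENNReal.ofReal_lt_ofReal_iff_of_nonneg (by positivity),
      ← Finset.mul_sum] at hF
    · rw [div_le_iff₀ (by positivity)]
      simp only [hW] at hF
      linarith
    · intro b _
      have hb := hhpos b b.2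
      have hsc := scale_pos (d := d) hθ (hupos b b.2)
      simp only [hW]
      positivity

/-! ### The lower bound -/

/-- The perturbation of `p` by `A` times the bumps of radii `h b` with signs `ε b` around the points
`b` of a finite set. -/
noncomputable def perturb (p : E d → ℝ) (A : ℝ) (c : E d) (h : E d → ℝ) {F : Finset (E d)}
    (ε : F → Bool) (y : E d) : ℝ :=
  p y + A * ∑ b : F, sgn (ε b) * bump c b (h b) y

section Perturb

variable {L cint A : ℝ} {p : E d → ℝ} {c : E d} {h : E d → ℝ} {F : Finset (E d)}

lemma bump_pairwise_zero (hc : ‖c‖ = 1 / 2) (hh : ∀ b ∈ F, 0 ≤ h b)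
    (hF : (F : Set (E d)).PairwiseDisjoint fun b => Metric.closedBall b (h b)) (y : E d)
    {b b' : F} (hne : b ≠ b') : bump c b (h b) y = 0 ∨ bump c b' (h b') y = 0 := by
  by_contra! hcon
  have h1 : y ∈ Metric.closedBall (b : E d) (h b) := by
    by_contra hy
    exact hcon.1 (bump_eq_zero hc (hh b b.2) hy)
  have h2 : y ∈ Metric.closedBall (b' : E d) (h b') := by
    by_contra hy
    exact hcon.2 (bump_eq_zero hc (hh b' b'.2) hy)
  exact Set.disjoint_left.1 (hF b.2 b'.2 fun h => hne (Subtype.ext h)) h1 h2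

lemma half_le_of_mem_closedBall (hL : 0 < L) (hp : ∀ x y, |p x - p y| ≤ L * ‖x - y‖) {b y : E d}
    {r : ℝ} (hr : L * r ≤ p b / 2) (hy : y ∈ Metric.closedBall b r) : p b / 2 ≤ p y := by
  rw [mem_closedBall_iff_norm] at hy
  have h1 := (neg_abs_le _).trans' (neg_le_neg (hp y b))
  have h2 : L * ‖y - b‖ ≤ L * r := by gcongr
  linarith

lemma mul_abs_bump_le (hL : 0 < L) (hp0 : ∀ x, 0 ≤ p x)
    (hp : ∀ x y, |p x - p y| ≤ L * ‖x - y‖) (hAL : A ≤ L)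
    (hc : ‖c‖ = 1 / 2) {b : E d} {r : ℝ} (hr0 : 0 ≤ r) (hr : L * r ≤ p b / 2) (y : E d) :
    A * |bump c b r y| ≤ p y := by
  by_cases hy : y ∈ Metric.closedBall b r
  · have h1 := half_le_of_mem_closedBall hL hp hr hy
    have h2 : A * |bump c b r y| ≤ L * (r / 2) :=
      mul_le_mul hAL (abs_bump_le hr0 c b y) (abs_nonneg _) hL.le
    nlinarith
  · rw [bump_eq_zero hc hr0 hy, abs_zero, mul_zero]
    exact hp0 y

lemma perturb_mem_lipBall (hL : 0 < L) (hcint : 0 ≤ cint)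
    (hp : p ∈ lipBall d (cint * L)) (hA : 0 ≤ A)
    (hAL : 4 * A ≤ (1 - cint) * L) (hc : ‖c‖ = 1 / 2) (hh : ∀ b ∈ F, 0 ≤ h b)
    (hhp : ∀ b ∈ F, L * h b ≤ p b / 2)
    (hF : (F : Set (E d)).PairwiseDisjoint fun b => Metric.closedBall b (h b)) (ε : F → Bool) :
    perturb p A c h ε ∈ lipBall d L := by
  have hpL : ∀ x y, |p x - p y| ≤ L * ‖x - y‖ := fun x y => (hp.2.2 x y).trans (by
    gcongr; nlinarith)
  have hAL' : A ≤ L := by nlinarith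
  refine ⟨fun y => ?_, ?_, fun y z => ?_⟩
  · have h1 : |A * ∑ b : F, sgn (ε b) * bump c b (h b) y| ≤ p y := by
      rw [abs_mul, abs_of_nonneg hA,
        abs_sum_sgn_mul ε fun b _ b' _ hne => bump_pairwise_zero hc hh hF y hne, Finset.mul_sum]
      refine sum_le_of_pairwise_zero (hp.1 y) (fun b _ =>
        mul_abs_bump_le hL hp.1 hpL hAL' hc (hh b b.2) (hhp b b.2) y) fun b _ b' _ hne => ?_
      rcases bump_pairwise_zero hc hh hF y hne with h0 | h0 <;> simp [h0]
    have := neg_abs_le (A * ∑ b : F, sgn (ε b) * bump c b (h b) y)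
    unfold perturb
    linarith
  · unfold perturb
    have hi : Integrable fun y => ∑ b : F, sgn (ε b) * bump c b (h b) y :=
      integrable_finsetSum _ fun b _ => (integrable_bump _ _ _).const_mul _
    rw [integral_add (integrable_of_mem hp) (hi.const_mul A), integral_const_mul,
      integral_finsetSum _ fun b _ => (integrable_bump _ _ _).const_mul _, hp.2.1]
    simp [integral_const_mul, integral_bump]
  · -- at `y` and at `z` at most one bump is nonzero, and each bump is `2`-Lipschitz
    have key : ∀ y z : E d, ∑ b : F, (Metric.closedBall (b : E d) (h b)).indicator
        (fun _ => 2 * ‖y - z‖) y ≤ 2 * ‖y - z‖ := by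
      intro y z
      refine sum_le_of_pairwise_zero (by positivity) (fun b _ =>
        indicator_le_self' (fun _ _ => by positivity) _) fun b _ b' _ hne => ?_
      by_contra! hcon
      exact Set.disjoint_left.1 (hF b.2 b'.2 fun h => hne (Subtype.ext h))
        (mem_of_indicator_ne_zero hcon.1) (mem_of_indicator_ne_zero hcon.2)
    have h1 : ∀ b : F, |bump c b (h b) y - bump c b (h b) z| ≤
        (Metric.closedBall (b : E d) (h b)).indicator (fun _ => 2 * ‖y - z‖) y +
        (Metric.closedBall (b : E d) (h b)).indicator (fun _ => 2 * ‖z - y‖) z := by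
      intro b
      have h2 := abs_bump_sub_le c b (h b) y z
      have h3 : 0 ≤ ‖y - z‖ := norm_nonneg _
      by_cases hy : y ∈ Metric.closedBall (b : E d) (h b) <;>
        by_cases hz : z ∈ Metric.closedBall (b : E d) (h b)
      · rw [indicator_of_mem hy, indicator_of_mem hz, norm_sub_rev z y]; linarith
      · rw [indicator_of_mem hy, indicator_of_notMem hz]; linarith
      · rw [indicator_of_notMem hy, indicator_of_mem hz, norm_sub_rev z y]; linarith
      · rw [indicator_of_notMem hy, indicator_of_notMem hz, bump_eq_zero hc (hh b b.2) hy,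
          bump_eq_zero hc (hh b b.2) hz]; simp
    have h4 : |∑ b : F, sgn (ε b) * bump c b (h b) y - ∑ b : F, sgn (ε b) * bump c b (h b) z| ≤
        4 * ‖y - z‖ := by
      rw [← Finset.sum_sub_distrib]
      refine (Finset.abs_sum_le_sum_abs _ _).trans ?_
      have h5 : ∑ b : F, |sgn (ε b) * bump c b (h b) y - sgn (ε b) * bump c b (h b) z| ≤
          ∑ b : F, ((Metric.closedBall (b : E d) (h b)).indicator (fun _ => 2 * ‖y - z‖) y +
        (Metric.closedBall (b : E d) (h b)).indicator (fun _ => 2 * ‖z - y‖) z) := by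
        refine Finset.sum_le_sum fun b _ => ?_
        rw [← mul_sub, abs_sgn_mul]
        exact h1 b
      rw [Finset.sum_add_distrib] at h5
      have h6 := key y z
      have h7 := key z y
      rw [norm_sub_rev z y] at h7 h5
      linarith
    unfold perturb
    rw [show ∀ a b s t : ℝ, a + A * s - (b + A * t) = (a - b) + A * (s - t) by intros; ring]
    refine (abs_add_le _ _).trans ?_
    rw [abs_mul, abs_of_nonneg hA]
    have h8 : A * |∑ b : F, sgn (ε b) * bump c b (h b) y -
        ∑ b : F, sgn (ε b) * bump c b (h b) z| ≤ A * (4 * ‖y - z‖) := by gcongr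
    have h9 : (4 * A) * ‖y - z‖ ≤ ((1 - cint) * L) * ‖y - z‖ := by gcongr
    linarith [hp.2.2 y z]

lemma le_l1Dist_perturb (hA : 0 ≤ A) (hc : ‖c‖ = 1 / 2) (hh : ∀ b ∈ F, 0 ≤ h b)
    (hF : (F : Set (E d)).PairwiseDisjoint fun b => Metric.closedBall b (h b)) (ε : F → Bool) :
    ENNReal.ofReal (A * ∑ b ∈ F, unitVol d * (h b / 4) ^ (d + 1)) ≤
      l1Dist (perturb p A c h ε) p := by
  unfold l1Dist perturb
  have hi : Integrable fun y => A * ∑ b : F, |bump c b (h b) y| :=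
    (integrable_finsetSum _ fun b _ => (integrable_bump _ _ _).abs).const_mul A
  have h1 : ∀ y, |p y + A * ∑ b : F, sgn (ε b) * bump c b (h b) y - p y| =
      A * ∑ b : F, |bump c b (h b) y| := fun y => by
    rw [add_sub_cancel_left, abs_mul, abs_of_nonneg hA,
      abs_sum_sgn_mul ε fun b _ b' _ hne => bump_pairwise_zero hc hh hF y hne]
  simp_rw [h1]
  rw [← ofReal_integral_eq_lintegral_ofReal hi (Eventually.of_forall fun y =>
    mul_nonneg hA (Finset.sum_nonneg fun _ _ => abs_nonneg _)), integral_const_mul,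
    integral_finsetSum _ fun b _ => (integrable_bump _ _ _).abs]
  refine ENNReal.ofReal_le_ofReal ?_
  gcongr
  rw [← Finset.sum_coe_sort]
  exact Finset.sum_le_sum fun b _ => le_integral_abs_bump hc (hh b b.2)

lemma integral_law {p : E d → ℝ} (hp : Measurable p) (hp0 : ∀ x, 0 ≤ p x) (f : E d → ℝ) :
    ∫ x, f x ∂(law p) = ∫ x, p x * f x := by
  unfold law
  rw [integral_withDensity_eq_integral_toReal_smul hp.ennreal_ofReal
    (Eventually.of_forall fun _ => ENNReal.ofReal_lt_top)]
  simp [ENNReal.toReal_ofReal (hp0 _)]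

/-- Le Cam's method for the perturbations of `p`: on any event one of them is nearly as likely as
`p`. The summands are the squares of bounds on the `χ²` contributions of the single bumps, which
live on balls where `p` is at least half of its value at the centre. -/
lemma exists_sign_law_perturb_ge [Nonempty (Fin d)] (hL : 0 < L) {n : ℕ} (hcint : 0 ≤ cint)
    (hp : p ∈ lipBall d (cint * L)) (hA : 0 ≤ A) (hAL : 4 * A ≤ (1 - cint) * L)
    (hc : ‖c‖ = 1 / 2) (hh : ∀ b ∈ F, 0 ≤ h b) (hpF : ∀ b ∈ F, 0 < p b)
    (hhp : ∀ b ∈ F, L * h b ≤ p b / 2)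
    (hF : (F : Set (E d)).PairwiseDisjoint fun b => Metric.closedBall b (h b))
    {B : Set (Fin n → E d)} (hB : MeasurableSet B) :
    ∃ ε : F → Bool, (sampleLaw n p).real B - Real.sqrt (Real.exp (n ^ 2 *
        (∑ b ∈ F, (A ^ 2 * (h b) ^ 2 / (2 * p b) * (unitVol d * h b ^ d)) ^ 2) / 2) - 1) ≤
      (sampleLaw n (perturb p A c h ε)).real B := by
  classical
  have hpr := isProbabilityMeasure_law hp
  have hm := (continuous_of_mem hp).measurable
  have hpL : ∀ x y, |p x - p y| ≤ L * ‖x - y‖ := fun x y => (hp.2.2 x y).trans (by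
    gcongr; nlinarith)
  have hAL' : A ≤ L := by nlinarith
  set g : F → E d → ℝ := fun b y => A * bump c b (h b) y / p y with hg
  have hgm : ∀ b, Measurable (g b) := fun b =>
    ((continuous_bump c b (h b)).measurable.const_mul A).div hm
  have hgabs : ∀ b y, |g b y| ≤ 1 := fun b y => by
    simp only [hg]
    rw [abs_div, abs_mul, abs_of_nonneg hA, abs_of_nonneg (hp.1 y)]
    exact div_le_one_of_le₀ (mul_abs_bump_le hL hp.1 hpL hAL' hc (hh b b.2) (hhp b b.2) y)
      (hp.1 y)
  have hgz : ∀ y (b b' : F), b ≠ b' → g b y = 0 ∨ g b' y = 0 := fun y b b' hne => by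
    rcases bump_pairwise_zero hc hh hF y hne with h0 | h0 <;> simp [hg, h0]
  have hpg : ∀ b y, p y * g b y = A * bump c b (h b) y := fun b y => by
    simp only [hg]
    rcases (hp.1 y).eq_or_lt with h0 | h0
    · have := mul_abs_bump_le hL hp.1 hpL hAL' hc (hh b b.2) (hhp b b.2) y
      rw [← h0, ← abs_of_nonneg hA, ← abs_mul] at this
      rw [← h0, zero_mul, abs_nonpos_iff.1 this]
    · field_simp
  have hsum : ∀ (ε : F → Bool) y, |∑ b, sgn (ε b) * g b y| ≤ 1 := fun ε y => by
    rw [abs_sum_sgn_mul ε fun b _ b' _ hne => hgz y b b' hne]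
    refine sum_le_of_pairwise_zero zero_le_one (fun b _ => hgabs b y) fun b _ b' _ hne => ?_
    rcases hgz y b b' hne with h0 | h0 <;> simp [h0]
  obtain ⟨ε, hε⟩ := exists_sign_measure_ge (n := n) (law p) (g := g)
    (a := fun b => ∫ x, g b x * g b x ∂(law p)) hgm hsum hgabs
    (fun b => by
      rw [integral_law hm hp.1]
      simp_rw [hpg]
      rw [integral_const_mul, integral_bump, mul_zero])
    (fun b b' hne => by
      have : ∀ x, g b x * g b' x = 0 := fun x => by
        rcases hgz x b b' hne with h0 | h0 <;> simp [h0]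
      simp [this])
    (fun b => rfl) hB
  refine ⟨ε, le_trans ?_ (hε.trans_eq ?_)⟩
  · unfold sampleLaw
    gcongr
    rw [← Finset.sum_coe_sort F]
    refine Finset.sum_le_sum fun b _ => ?_
    have h0 : 0 ≤ ∫ x, g b x * g b x ∂(law p) := integral_nonneg fun x => mul_self_nonneg _
    refine pow_le_pow_left₀ h0 ?_ 2
    rw [integral_law hm hp.1]
    have hpb := hpF b b.2
    have hhb := hh b b.2
    have h1 : ∀ x, p x * (g b x * g b x) ≤ (Metric.closedBall (b : E d) (h b)).indicator
        (fun _ => A ^ 2 * (h b) ^ 2 / (2 * p b)) x := by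
      intro x
      by_cases hx : x ∈ Metric.closedBall (b : E d) (h b)
      · rw [indicator_of_mem hx]
        have h2 := half_le_of_mem_closedBall hL hpL (hhp b b.2) hx
        have h3 : 0 < p x := by linarith
        have h4 : p x * (g b x * g b x) = A ^ 2 * bump c b (h b) x ^ 2 / p x := by
          simp only [hg]; field_simp
        rw [h4]
        have h5 : bump c b (h b) x ^ 2 ≤ (h b / 2) ^ 2 :=
          sq_le_sq' (by linarith [(abs_le.1 (abs_bump_le hhb c b x)).1])
            (abs_le.1 (abs_bump_le hhb c b x)).2
        calc A ^ 2 * bump c b (h b) x ^ 2 / p x ≤ A ^ 2 * (h b / 2) ^ 2 / (p b / 2) := by gcongr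
          _ = _ := by field_simp
      · rw [indicator_of_notMem hx]
        simp [hg, bump_eq_zero hc hhb hx]
    have h6 : Integrable ((Metric.closedBall (b : E d) (h b)).indicator
        (fun _ => A ^ 2 * (h b) ^ 2 / (2 * p b))) :=
      (integrable_indicator_iff measurableSet_closedBall).2
        (integrableOn_const measure_closedBall_lt_top.ne)
    refine (integral_mono_of_nonneg (Eventually.of_forall fun x =>
      mul_nonneg (hp.1 x) (mul_self_nonneg _)) h6 (Eventually.of_forall h1)).trans_eq ?_
    rw [integral_indicator measurableSet_closedBall, setIntegral_const,
      volume_real_closedBall _ hhb, smul_eq_mul]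
    ring
  · unfold sampleLaw
    congr 2
    funext i
    unfold law
    rw [← withDensity_mul _ hm.ennreal_ofReal (by fun_prop)]
    congr 1
    funext y
    rw [Pi.mul_apply, ← ENNReal.ofReal_mul (hp.1 y)]
    congr 1
    unfold perturb
    rw [mul_add, mul_one, Finset.mul_sum, Finset.mul_sum]
    congr 1
    refine Finset.sum_congr rfl fun b _ => ?_
    rw [mul_left_comm, hpg]; ring

end Perturb

/-- A small constant `κ`: with bandwidths `κ` times the local scale, the `χ²` distance between the
null and the mixture is at most `exp (ω κ ^ (d + 4) / 2) - 1`. -/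
lemma exists_small_kappa (d : ℕ) {η : ℝ} (hη : 0 < η) :
    ∃ κ : ℝ, 0 < κ ∧ κ ≤ 1 / 10 ∧
      Real.sqrt (Real.exp (unitVol d * κ ^ (d + 4) / 2) - 1) < η := by
  have hcont : Continuous fun κ : ℝ => Real.sqrt (Real.exp (unitVol d * κ ^ (d + 4) / 2) - 1) := by
    fun_prop
  have h0 : Real.sqrt (Real.exp (unitVol d * (0 : ℝ) ^ (d + 4) / 2) - 1) < η := by simpa using hη
  have h1 := hcont.continuousAt.eventually (gt_mem_nhds h0)
  rw [Metric.eventually_nhds_iff] at h1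
  obtain ⟨δ, hδ, h2⟩ := h1
  refine ⟨min (δ / 2) (1 / 10), by positivity, min_le_right _ _, h2 ?_⟩
  rw [Real.dist_eq, sub_zero, abs_of_pos (by positivity)]
  exact lt_of_le_of_lt (min_le_left _ _) (half_lt_self hδ)

/-- The mixture over the signs of the bumps shows that at a separation that is a small multiple of
the critical one no test of level `α` has type II error at most `1 / 2`. -/
theorem lower_bound [Nonempty (Fin d)] {α : ℝ} (hα : 0 < α) (hα' : α < 1 / 2) {cint : ℝ}
    (hcint : 0 ≤ cint) (hcint' : cint < 1) :
    ∃ c : ℝ, 0 < c ∧ ∀ (n : ℕ) (L : ℝ) (p : E d → ℝ), 1 ≤ n → 0 < L → p ∈ lipBall d (cint * L) →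
      ∀ v : ℝ, SolvesCriticalEq n L 1 p v →
        ENNReal.ofReal (c * v) ≤ criticalRadius n α p (lipBall d L) := by
  obtain ⟨κ, hκ, hκ1, hκη⟩ := exists_small_kappa d (show 0 < (1 / 2 - α) / 2 by linarith)
  have hω := unitVol_pos d
  have h1c : 0 < 1 - cint := by linarith
  refine ⟨(1 - cint) / 4 * κ / 4 ^ (d + 1) / (4 * 5 ^ d), by positivity, ?_⟩
  intro n L p hn hL hp v hv
  have hpr := isProbabilityMeasure_law hp
  obtain ⟨hv0, -, I, hI, hcrit, hmin, -⟩ := hv.spec hn hL hp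
  have hn' : (0 : ℝ) < n := by exact_mod_cast hn
  set θ := v / I with hθdef
  have hθ : 0 < θ := by positivity
  have hkey : (n : ℝ) ^ 2 * θ ^ (d + 3) * v = L ^ d := by
    have h1 : θ ^ (d + 3) = v ^ (d + 3) / I ^ (d + 3) := div_pow _ _ _
    rw [h1, mul_div_assoc', div_mul_eq_mul_div, div_eq_iff (by positivity), ← hcrit]
    ring
  obtain ⟨F, hFpos, hFdisj, hFsum⟩ := exists_packing hL
    (show p ∈ lipBall d L from ⟨hp.1, hp.2.1, fun x y => (hp.2.2 x y).trans (by
      gcongr; nlinarith)⟩) hθ hv0 hκ hκ1 (le_lintegral_scale hp hv0 hI hmin)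
  set h : E d → ℝ := fun x => κ / L * scale d θ (p x) with hh
  set W := ∑ b ∈ F, scale d θ (p b) * (unitVol d * h b ^ d) with hW
  have hWpos : 0 < W := lt_of_lt_of_le (by positivity) hFsum
  set δ := v / (4 * 5 ^ d) with hδ
  have hδpos : 0 < δ := by positivity
  have hδv : δ ≤ v := by
    rw [hδ]
    refine div_le_self hv0.le ?_
    have : (1 : ℝ) ≤ 5 ^ d := one_le_pow₀ (by norm_num)
    linarith
  -- the amplitude is chosen so that the separation is exactly a multiple of `v`
  set lam := δ / W with hlam
  have hlam1 : lam ≤ 1 := div_le_one_of_le₀ hFsum hWpos.le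
  have hlam0 : 0 < lam := by positivity
  have hlamW : lam * W = δ := by rw [hlam]; field_simp
  set A := lam * ((1 - cint) * L / 4) with hA
  have hA0 : 0 ≤ A := by positivity
  have hAL : 4 * A ≤ (1 - cint) * L := by
    have : lam * ((1 - cint) * L) ≤ 1 * ((1 - cint) * L) := by gcongr
    rw [hA]; linarith
  have hAL' : A ≤ lam * (L / 4) := by
    rw [hA]; gcongr; nlinarith
  obtain ⟨c, hc⟩ := exists_norm_eq (E d) (show (0 : ℝ) ≤ 1 / 2 by norm_num)
  have hh0 : ∀ b ∈ F, 0 < h b := fun b hb => by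
    have := scale_pos (d := d) hθ (hFpos b hb)
    simp only [hh]; positivity
  have hLh : ∀ b, L * h b = κ * scale d θ (p b) := fun b => by simp only [hh]; field_simp
  have hhp : ∀ b ∈ F, L * h b ≤ p b / 2 := fun b hb => by
    rw [hLh]
    have h1 := scale_le d θ (p b)
    have h2 := scale_pos (d := d) hθ (hFpos b hb)
    nlinarith
  -- the `χ²` bound
  have hchi : (n : ℝ) ^ 2 * ∑ b ∈ F, (A ^ 2 * (h b) ^ 2 / (2 * p b) * (unitVol d * h b ^ d)) ^ 2 ≤
      unitVol d * κ ^ (d + 4) := by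
    have hterm : ∀ b ∈ F, (A ^ 2 * (h b) ^ 2 / (2 * p b) * (unitVol d * h b ^ d)) ^ 2 ≤
        lam * (unitVol d * κ ^ (d + 4) * (θ ^ (d + 3) / L ^ d)) *
          (scale d θ (p b) * (unitVol d * h b ^ d)) := by
      intro b hb
      have hb0 := hh0 b hb
      have hpb := hFpos b hb
      have hs := scale_pos (d := d) hθ hpb
      have e1 : h b ^ (d + 3) ≤ κ ^ (d + 3) / L ^ (d + 3) * (θ ^ (d + 3) * p b ^ 2) := by
        simp only [hh]
        rw [mul_pow, div_pow]
        gcongr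
        exact scale_pow_le hθ.le hpb.le
      have e2 : A ^ 4 ≤ lam * L ^ 4 := by
        calc A ^ 4 ≤ (lam * (L / 4)) ^ 4 := pow_le_pow_left₀ hA0 hAL' 4
          _ = lam ^ 4 * (L ^ 4 / 256) := by ring
          _ ≤ lam * (L ^ 4) := by
            gcongr
            · calc lam ^ 4 ≤ lam ^ 1 := pow_le_pow_of_le_one hlam0.le hlam1 (by norm_num)
                _ = lam := pow_one _
            · have : 0 < L ^ 4 := by positivity
              linarith
      calc (A ^ 2 * (h b) ^ 2 / (2 * p b) * (unitVol d * h b ^ d)) ^ 2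
          = A ^ 4 * unitVol d ^ 2 / (4 * p b ^ 2) * h b ^ (d + 1) * h b ^ (d + 3) := by
            field_simp; ring
        _ ≤ (lam * L ^ 4) * unitVol d ^ 2 / (p b ^ 2) * h b ^ (d + 1) *
            (κ ^ (d + 3) / L ^ (d + 3) * (θ ^ (d + 3) * p b ^ 2)) := by
            gcongr
            have : 0 < p b ^ 2 := by positivity
            linarith
        _ = lam * (unitVol d * κ ^ (d + 3) * (θ ^ (d + 3) / L ^ d)) * (unitVol d * h b ^ d) *
            (L * h b) := by
            field_simp; ring
        _ = _ := by rw [hLh]; ring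
    calc (n : ℝ) ^ 2 * ∑ b ∈ F, (A ^ 2 * (h b) ^ 2 / (2 * p b) * (unitVol d * h b ^ d)) ^ 2
        ≤ (n : ℝ) ^ 2 * ∑ b ∈ F, lam * (unitVol d * κ ^ (d + 4) * (θ ^ (d + 3) / L ^ d)) *
          (scale d θ (p b) * (unitVol d * h b ^ d)) := by
          gcongr with b hb
          exact hterm b hb
      _ = unitVol d * κ ^ (d + 4) * (((n : ℝ) ^ 2 * θ ^ (d + 3) * v) / L ^ d) *
          ((lam * W) / v) := by
          rw [← Finset.mul_sum, ← hW]; field_simp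
      _ ≤ unitVol d * κ ^ (d + 4) * 1 * 1 := by
          rw [hkey, hlamW]
          gcongr
          · rw [div_self (by positivity)]
          · exact div_le_one_of_le₀ hδv hv0.le
      _ = _ := by ring
  -- the separation
  have hsep : A * ∑ b ∈ F, unitVol d * (h b / 4) ^ (d + 1) =
      (1 - cint) / 4 * κ / 4 ^ (d + 1) / (4 * 5 ^ d) * v := by
    have e1 : ∑ b ∈ F, unitVol d * (h b / 4) ^ (d + 1) = κ / L / 4 ^ (d + 1) * W := by
      rw [hW, Finset.mul_sum]
      refine Finset.sum_congr rfl fun b _ => ?_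
      rw [div_pow, pow_succ (h b)]
      conv_lhs => rw [show h b ^ d * h b = h b ^ d * (κ / L * scale d θ (p b)) from rfl]
      ring
    rw [e1, hA]
    calc _ = (1 - cint) / 4 * κ / 4 ^ (d + 1) * (lam * W) := by field_simp
      _ = _ := by rw [hlamW, hδ]; ring
  refine le_sInf fun ε hε => ?_
  by_contra! hlt
  have hε : minimaxRisk n α p ε (lipBall d L) ≤ 1 / 2 := hε
  refine absurd hε (not_le.2 ?_)
  refine lt_of_lt_of_le (b := ENNReal.ofReal (1 - α - (1 / 2 - α) / 2)) ?_ ?_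
  · rw [ENNReal.lt_ofReal_iff_toReal_lt (by simp)]
    simp only [ENNReal.toReal_div, ENNReal.toReal_one, ENNReal.toReal_ofNat]
    linarith
  refine le_iInf₂ fun φ hφ => ?_
  have hpi : IsProbabilityMeasure (sampleLaw n p) := by unfold sampleLaw; infer_instance
  have hB : MeasurableSet {z | φ z = false} := hφ.1 (measurableSet_singleton false)
  have hBp : 1 - α ≤ (sampleLaw n p).real {z | φ z = false} := by
    have hT : MeasurableSet {z | φ z = true} := hφ.1 (measurableSet_singleton true)
    have e1 : {z | φ z = false} = {z | φ z = true}ᶜ := by ext z; simp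
    rw [e1, probReal_compl_eq_one_sub hT]
    have e2 := hφ.2
    have e3 : (sampleLaw n p).real {z | φ z = true} ≤ α :=
      ENNReal.toReal_le_of_le_ofReal hα.le e2
    linarith
  obtain ⟨e, he⟩ := exists_sign_law_perturb_ge (n := n) hL hcint hp hA0 hAL hc
    (fun b hb => (hh0 b hb).le) hFpos hhp hFdisj hB
  have hmem := perturb_mem_lipBall hL hcint hp hA0 hAL hc (fun b hb => (hh0 b hb).le)
    hhp hFdisj e
  have hdist := le_l1Dist_perturb (p := p) hA0 hc (fun b hb => (hh0 b hb).le) hFdisj e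
  rw [hsep] at hdist
  refine le_trans ?_ (le_iSup₂_of_le (perturb p A c h e) ⟨hmem, hlt.le.trans hdist⟩ le_rfl)
  have hqpr := isProbabilityMeasure_law hmem
  have hqpi : IsProbabilityMeasure (sampleLaw n (perturb p A c h e)) := by
    unfold sampleLaw; infer_instance
  rw [ENNReal.ofReal_le_iff_le_toReal (measure_ne_top _ _), ← measureReal_def]
  refine le_trans ?_ he
  have hs : Real.sqrt (Real.exp (n ^ 2 *
      (∑ b ∈ F, (A ^ 2 * (h b) ^ 2 / (2 * p b) * (unitVol d * h b ^ d)) ^ 2) / 2) - 1) ≤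
      Real.sqrt (Real.exp (unitVol d * κ ^ (d + 4) / 2) - 1) := by
    gcongr
  linarith

/-! ### Second moments of an integrated product statistic -/

section Statistic

variable {X Z : Type*} [MeasurableSpace X] [MeasurableSpace Z]

lemma integrable_of_abs_le {Ω : Type*} [MeasurableSpace Ω] {P : Measure Ω} [IsFiniteMeasure P]
    {f : Ω → ℝ} (hf : Measurable f) {K : ℝ} (hK : ∀ x, |f x| ≤ K) : Integrable f P :=
  Integrable.of_bound hf.aestronglyMeasurable K (Eventually.of_forall hK)

/-- The second moment of an integral over a parameter. -/
lemma integral_sq_integral {Ω : Type*} [MeasurableSpace Ω] (P : Measure Ω) [IsFiniteMeasure P]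
    (μ : Measure Z) [IsFiniteMeasure μ] {F : Z → Ω → ℝ}
    (hF : Measurable fun zω : Z × Ω => F zω.1 zω.2) {K : ℝ} (hK : ∀ z ω, |F z ω| ≤ K) :
    ∫ ω, (∫ z, F z ω ∂μ) ^ 2 ∂P = ∫ zz : Z × Z, ∫ ω, F zz.1 ω * F zz.2 ω ∂P ∂(μ.prod μ) := by
  have h1 : ∀ ω, (∫ z, F z ω ∂μ) ^ 2 = ∫ zz : Z × Z, F zz.1 ω * F zz.2 ω ∂(μ.prod μ) := fun ω => by
    rw [integral_prod_mul (fun z => F z ω) (fun z => F z ω), sq]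
  simp_rw [h1]
  refine integral_integral_swap (f := fun ω (zz : Z × Z) => F zz.1 ω * F zz.2 ω) ?_
  refine integrable_of_abs_le (K := K * K) ?_ fun x => ?_
  · have e1 : Measurable fun x : Ω × (Z × Z) => F x.2.1 x.1 :=
      hF.comp (measurable_snd.fst.prodMk measurable_fst)
    have e2 : Measurable fun x : Ω × (Z × Z) => F x.2.2 x.1 :=
      hF.comp (measurable_snd.snd.prodMk measurable_fst)
    exact e1.mul e2
  · simp only [Function.uncurry]
    rw [abs_mul]
    exact mul_le_mul (hK _ _) (hK _ _) (abs_nonneg _) ((abs_nonneg _).trans (hK x.2.1 x.1))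

variable {n : ℕ} (Q : Measure X) [IsProbabilityMeasure Q]

lemma integral_pi_eval (u : X → ℝ) (hu : Measurable u) (i : Fin n) :
    ∫ ω, u (ω i) ∂(Measure.pi fun _ : Fin n => Q) = ∫ x, u x ∂Q :=
  integral_comp_eval (μ := fun _ : Fin n => Q) hu.aestronglyMeasurable

lemma integral_pi_eval_mul {u v : X → ℝ} (hu : Measurable u) (hv : Measurable v) {i j : Fin n}
    (hij : i ≠ j) :
    ∫ ω, u (ω i) * v (ω j) ∂(Measure.pi fun _ : Fin n => Q) = (∫ x, u x ∂Q) * ∫ x, v x ∂Q := by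
  have h1 : ProbabilityTheory.iIndepFun (fun (i : Fin n) (ω : Fin n → X) => ω i)
      (Measure.pi fun _ : Fin n => Q) :=
    ProbabilityTheory.iIndepFun_pi (μ := fun _ => Q) (X := fun _ => id) fun i => aemeasurable_id
  have h2 := (h1.indepFun hij).comp hu hv
  have h3 := h2.integral_fun_mul_eq_mul_integral
    (hu.comp (measurable_pi_apply i)).aestronglyMeasurable
    (hv.comp (measurable_pi_apply j)).aestronglyMeasurable
  simp only [Function.comp_def] at h3
  rw [h3, integral_pi_eval Q u hu, integral_pi_eval Q v hv]

lemma integral_sum_eval (S : Finset (Fin n)) {u : X → ℝ} (hu : Measurable u)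
    (hu1 : ∀ x, |u x| ≤ 1) :
    ∫ ω, ∑ i ∈ S, u (ω i) ∂(Measure.pi fun _ : Fin n => Q) = S.card * ∫ x, u x ∂Q := by
  have hi : ∀ i : Fin n,
      Integrable (fun ω : Fin n → X => u (ω i)) (Measure.pi fun _ : Fin n => Q) :=
    fun i => integrable_of_abs_le (hu.comp (measurable_pi_apply i)) fun ω => hu1 _
  rw [integral_finsetSum _ fun i _ => hi i]
  simp [integral_pi_eval Q u hu]

lemma integral_sum_mul_sum (S : Finset (Fin n)) {u v : X → ℝ} (hu : Measurable u)
    (hv : Measurable v) (hu1 : ∀ x, |u x| ≤ 1) (hv1 : ∀ x, |v x| ≤ 1) :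
    ∫ ω, (∑ i ∈ S, u (ω i)) * (∑ i ∈ S, v (ω i)) ∂(Measure.pi fun _ : Fin n => Q) =
      S.card * (∫ x, u x * v x ∂Q - (∫ x, u x ∂Q) * ∫ x, v x ∂Q) +
        (S.card : ℝ) ^ 2 * ((∫ x, u x ∂Q) * ∫ x, v x ∂Q) := by
  simp_rw [Finset.sum_mul_sum]
  have hi : ∀ i j : Fin n, Integrable (fun ω : Fin n → X => u (ω i) * v (ω j))
      (Measure.pi fun _ : Fin n => Q) := fun i j =>
    integrable_of_abs_le ((hu.comp (measurable_pi_apply i)).mul (hv.comp (measurable_pi_apply j)))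
      (K := 1) fun ω => by
        rw [abs_mul]; exact mul_le_one₀ (hu1 _) (abs_nonneg _) (hv1 _)
  rw [integral_finsetSum _ fun i _ => integrable_finsetSum _ fun j _ => hi i j]
  simp_rw [integral_finsetSum _ fun j _ => hi _ j]
  have h1 : ∀ i ∈ S, ∑ j ∈ S, ∫ ω, u (ω i) * v (ω j) ∂(Measure.pi fun _ : Fin n => Q) =
      (∫ x, u x * v x ∂Q - (∫ x, u x ∂Q) * ∫ x, v x ∂Q) +
        S.card * ((∫ x, u x ∂Q) * ∫ x, v x ∂Q) := by
    intro i hi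
    have h2 : ∀ j ∈ S, ∫ ω, u (ω i) * v (ω j) ∂(Measure.pi fun _ : Fin n => Q) =
        (if i = j then (∫ x, u x * v x ∂Q - (∫ x, u x ∂Q) * ∫ x, v x ∂Q) else 0) +
          (∫ x, u x ∂Q) * ∫ x, v x ∂Q := by
      intro j _
      split_ifs with hij
      · subst hij
        rw [integral_pi_eval Q (fun x => u x * v x) (hu.mul hv)]; ring
      · rw [integral_pi_eval_mul Q hu hv hij, zero_add]
    rw [Finset.sum_congr rfl h2, Finset.sum_add_distrib, Finset.sum_ite_eq, if_pos hi,
      Finset.sum_const, nsmul_eq_mul]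
  rw [Finset.sum_congr rfl h1, Finset.sum_const, nsmul_eq_mul]
  ring

lemma integral_mul_of_disjoint {S T : Finset (Fin n)} (hST : Disjoint S T) {u v : X → ℝ}
    {u' v' : X → ℝ} (hu : Measurable u) (hv : Measurable v) (hu' : Measurable u')
    (hv' : Measurable v') :
    ∫ ω, ((∑ i ∈ S, u (ω i)) * ∑ i ∈ S, v (ω i)) * ((∑ i ∈ T, u' (ω i)) * ∑ i ∈ T, v' (ω i))
      ∂(Measure.pi fun _ : Fin n => Q) =
    (∫ ω, (∑ i ∈ S, u (ω i)) * ∑ i ∈ S, v (ω i) ∂(Measure.pi fun _ : Fin n => Q)) *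
      ∫ ω, (∑ i ∈ T, u' (ω i)) * ∑ i ∈ T, v' (ω i) ∂(Measure.pi fun _ : Fin n => Q) := by
  have h1 : ProbabilityTheory.iIndepFun (fun (i : Fin n) (ω : Fin n → X) => ω i)
      (Measure.pi fun _ : Fin n => Q) :=
    ProbabilityTheory.iIndepFun_pi (μ := fun _ => Q) (X := fun _ => id) fun i => aemeasurable_id
  have h2 := h1.indepFun_finset S T hST fun i => measurable_pi_apply i
  have hsum : ∀ (R : Finset (Fin n)) (w : X → ℝ), Measurable w →
      Measurable fun y : R → X => ∑ i : R, w (y i) := fun R w hw =>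
    Finset.measurable_sum _ fun i _ => hw.comp (measurable_pi_apply i)
  have hsum' : ∀ (R : Finset (Fin n)) (w : X → ℝ), Measurable w →
      Measurable fun y : Fin n → X => ∑ i ∈ R, w (y i) := fun R w hw =>
    Finset.measurable_sum _ fun i _ => hw.comp (measurable_pi_apply i)
  have h3 := h2.comp ((hsum S u hu).mul (hsum S v hv)) ((hsum T u' hu').mul (hsum T v' hv'))
  have e : ∀ (R : Finset (Fin n)) (w : X → ℝ) (ω : Fin n → X),
      ∑ i : R, w (ω i) = ∑ i ∈ R, w (ω i) := fun R w ω =>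
    Finset.sum_coe_sort R fun i => w (ω i)
  simp only [Function.comp_def, Pi.mul_def] at h3
  simp only [e] at h3
  exact h3.integral_fun_mul_eq_mul_integral
    ((hsum' S u hu).mul (hsum' S v hv)).aestronglyMeasurable
    ((hsum' T u' hu').mul (hsum' T v' hv')).aestronglyMeasurable

/-- The statistic `∫ (∑_{i ∈ S} g_z(ω_i)) (∑_{i ∈ T} g_z(ω_i)) dμ(z)`, where `S` and `T` are two
disjoint subsamples. Its mean is `m² ∫ (E g_z)² dμ(z)` when both have `m` elements. -/
noncomputable def pairStat (μ : Measure Z) (g : Z → X → ℝ) (S T : Finset (Fin n))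
    (ω : Fin n → X) : ℝ :=
  ∫ z, (∑ i ∈ S, g z (ω i)) * ∑ i ∈ T, g z (ω i) ∂μ

lemma abs_sum_le_card {X : Type*} (S : Finset (Fin n)) {u : X → ℝ}
    (hu1 : ∀ x, |u x| ≤ 1) (ω : Fin n → X) :
    |∑ i ∈ S, u (ω i)| ≤ S.card := by
  refine (Finset.abs_sum_le_sum_abs _ _).trans ((Finset.sum_le_sum fun i _ => hu1 (ω i)).trans ?_)
  simp

lemma measurable_sum_eval {g : Z → X → ℝ} (hg : Measurable fun zx : Z × X => g zx.1 zx.2)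
    (S : Finset (Fin n)) : Measurable fun zω : Z × (Fin n → X) => ∑ i ∈ S, g zω.1 (zω.2 i) :=
  Finset.measurable_sum _ fun i _ =>
    hg.comp (measurable_fst.prodMk ((measurable_pi_apply i).comp measurable_snd))

lemma measurable_pairIntegrand {g : Z → X → ℝ} (hg : Measurable fun zx : Z × X => g zx.1 zx.2)
    (S T : Finset (Fin n)) : Measurable fun zω : Z × (Fin n → X) =>
      (∑ i ∈ S, g zω.1 (zω.2 i)) * ∑ i ∈ T, g zω.1 (zω.2 i) :=
  (measurable_sum_eval hg S).mul (measurable_sum_eval hg T)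

lemma abs_pairIntegrand_le {X Z : Type*} {g : Z → X → ℝ} (hg1 : ∀ z x, |g z x| ≤ 1)
    (S T : Finset (Fin n)) (z : Z) (ω : Fin n → X) :
    |(∑ i ∈ S, g z (ω i)) * ∑ i ∈ T, g z (ω i)| ≤ S.card * T.card := by
  rw [abs_mul]
  exact mul_le_mul (abs_sum_le_card S (hg1 z) ω) (abs_sum_le_card T (hg1 z) ω) (abs_nonneg _)
    (by positivity)

lemma measurable_pairStat (μ : Measure Z) [IsFiniteMeasure μ] {g : Z → X → ℝ}
    (hg : Measurable fun zx : Z × X => g zx.1 zx.2) (S T : Finset (Fin n)) :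
    Measurable (pairStat μ g S T) := by
  have h := ((measurable_pairIntegrand hg S T).comp measurable_swap).stronglyMeasurable
  exact (h.integral_prod_right' (ν := μ)).measurable

lemma abs_pairStat_le {X : Type*} (μ : Measure Z) [IsFiniteMeasure μ] {g : Z → X → ℝ}
    (hg1 : ∀ z x, |g z x| ≤ 1) (S T : Finset (Fin n)) (ω : Fin n → X) :
    |pairStat μ g S T ω| ≤ S.card * T.card * μ.real univ :=
  norm_integral_le_of_norm_le_const (μ := μ)
    (f := fun z => (∑ i ∈ S, g z (ω i)) * ∑ i ∈ T, g z (ω i))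
    (Eventually.of_forall fun z => abs_pairIntegrand_le hg1 S T z ω)

lemma measurable_mean {g : Z → X → ℝ} (hg : Measurable fun zx : Z × X => g zx.1 zx.2) :
    Measurable fun z => ∫ x, g z x ∂Q :=
  (hg.stronglyMeasurable.integral_prod_right' (ν := Q)).measurable

lemma abs_mean_le {Z : Type*} {g : Z → X → ℝ} (hg1 : ∀ z x, |g z x| ≤ 1) (z : Z) :
    |∫ x, g z x ∂Q| ≤ 1 := by
  have := norm_integral_le_of_norm_le_const (μ := Q) (f := g z) (Eventually.of_forall (hg1 z))
  simpa using this

/-- The covariance of `g_z` and `g_z'` under one observation. -/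
noncomputable def covFun (g : Z → X → ℝ) (zz : Z × Z) : ℝ :=
  ∫ x, g zz.1 x * g zz.2 x ∂Q - (∫ x, g zz.1 x ∂Q) * ∫ x, g zz.2 x ∂Q

lemma measurable_covFun {g : Z → X → ℝ} (hg : Measurable fun zx : Z × X => g zx.1 zx.2) :
    Measurable (covFun Q g) := by
  have h1 : Measurable fun zzx : (Z × Z) × X => g zzx.1.1 zzx.2 * g zzx.1.2 zzx.2 :=
    (hg.comp (measurable_fst.fst.prodMk measurable_snd)).mul
      (hg.comp (measurable_fst.snd.prodMk measurable_snd))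
  exact ((h1.stronglyMeasurable.integral_prod_right' (ν := Q)).measurable).sub
    (((measurable_mean Q hg).comp measurable_fst).mul ((measurable_mean Q hg).comp measurable_snd))

lemma abs_covFun_le {Z : Type*} {g : Z → X → ℝ} (hg1 : ∀ z x, |g z x| ≤ 1) (zz : Z × Z) :
    |covFun Q g zz| ≤ 2 := by
  unfold covFun
  have h1 : |∫ x, g zz.1 x * g zz.2 x ∂Q| ≤ 1 := by
    have := norm_integral_le_of_norm_le_const (μ := Q) (C := 1)
      (f := fun x => g zz.1 x * g zz.2 x) (Eventually.of_forall fun x => by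
        rw [norm_mul]; exact mul_le_one₀ (hg1 _ _) (norm_nonneg _) (hg1 _ _))
    simpa using this
  have h2 : |(∫ x, g zz.1 x ∂Q) * ∫ x, g zz.2 x ∂Q| ≤ 1 := by
    rw [abs_mul]
    exact mul_le_one₀ (abs_mean_le Q hg1 _) (abs_nonneg _) (abs_mean_le Q hg1 _)
  exact (abs_sub _ _).trans (by linarith)

variable (μ : Measure Z) [IsFiniteMeasure μ] {g : Z → X → ℝ} {S T : Finset (Fin n)} {m : ℕ}

lemma integral_pairStat (hg : Measurable fun zx : Z × X => g zx.1 zx.2) (hg1 : ∀ z x, |g z x| ≤ 1)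
    (hST : Disjoint S T) (hS : S.card = m) (hT : T.card = m) :
    ∫ ω, pairStat μ g S T ω ∂(Measure.pi fun _ : Fin n => Q) =
      (m : ℝ) ^ 2 * ∫ z, (∫ x, g z x ∂Q) ^ 2 ∂μ := by
  unfold pairStat
  have hgz : ∀ z, Measurable (g z) := fun z => hg.comp measurable_prodMk_left
  rw [integral_integral_swap, ← integral_const_mul]
  · refine integral_congr_ae (Eventually.of_forall fun z => ?_)
    simp only
    have hi : ∀ i j : Fin n, Integrable (fun ω : Fin n → X => g z (ω i) * g z (ω j))
        (Measure.pi fun _ : Fin n => Q) := fun i j =>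
      integrable_of_abs_le (((hgz z).comp (measurable_pi_apply i)).mul
        ((hgz z).comp (measurable_pi_apply j))) (K := 1) fun ω => by
          rw [abs_mul]; exact mul_le_one₀ (hg1 _ _) (abs_nonneg _) (hg1 _ _)
    simp_rw [Finset.sum_mul_sum]
    rw [integral_finsetSum _ fun i _ => integrable_finsetSum _ fun j _ => hi i j]
    simp_rw [integral_finsetSum _ fun j _ => hi _ j]
    have h1 : ∀ i ∈ S, ∀ j ∈ T, ∫ ω, g z (ω i) * g z (ω j) ∂(Measure.pi fun _ : Fin n => Q) =
        (∫ x, g z x ∂Q) * ∫ x, g z x ∂Q := fun i hi j hj =>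
      integral_pi_eval_mul Q (hgz z) (hgz z) fun h => Finset.disjoint_left.1 hST hi (h ▸ hj)
    rw [Finset.sum_congr rfl fun i hi => Finset.sum_congr rfl fun j hj => h1 i hi j hj]
    simp only [Finset.sum_const, nsmul_eq_mul, hS, hT]
    ring
  · exact integrable_of_abs_le ((measurable_pairIntegrand hg S T).comp measurable_swap)
      (K := S.card * T.card) fun x => abs_pairIntegrand_le hg1 S T x.2 x.1

lemma integral_pairStat_sq (hg : Measurable fun zx : Z × X => g zx.1 zx.2)
    (hg1 : ∀ z x, |g z x| ≤ 1) (hST : Disjoint S T) (hS : S.card = m) (hT : T.card = m) :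
    ∫ ω, pairStat μ g S T ω ^ 2 ∂(Measure.pi fun _ : Fin n => Q) =
      ∫ zz : Z × Z, (m * covFun Q g zz +
        (m : ℝ) ^ 2 * ((∫ x, g zz.1 x ∂Q) * ∫ x, g zz.2 x ∂Q)) ^ 2 ∂(μ.prod μ) := by
  unfold pairStat
  have hgz : ∀ z, Measurable (g z) := fun z => hg.comp measurable_prodMk_left
  rw [integral_sq_integral _ μ (measurable_pairIntegrand hg S T) (abs_pairIntegrand_le hg1 S T)]
  refine integral_congr_ae (Eventually.of_forall fun zz => ?_)
  refine (integral_congr_ae (Eventually.of_forall fun ω => mul_mul_mul_comm _ _ _ _)).trans ?_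
  rw [integral_mul_of_disjoint Q hST (hgz _) (hgz _) (hgz _) (hgz _),
    integral_sum_mul_sum Q S (hgz _) (hgz _) (hg1 _) (hg1 _),
    integral_sum_mul_sum Q T (hgz _) (hgz _) (hg1 _) (hg1 _), hS, hT]
  exact (sq _).symm

/-- Expanding `(m C + m² f f')²`, where `C` is the covariance and `f` the mean, the cross term is
absorbed by the two squares. -/
lemma variance_pairStat_le (hg : Measurable fun zx : Z × X => g zx.1 zx.2)
    (hg1 : ∀ z x, |g z x| ≤ 1) (hST : Disjoint S T) (hS : S.card = m) (hT : T.card = m)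
    {lam : ℝ} (hlam : 0 < lam) :
    ProbabilityTheory.variance (pairStat μ g S T) (Measure.pi fun _ : Fin n => Q) ≤
      (1 + lam) * (m : ℝ) ^ 2 * ∫ zz, covFun Q g zz ^ 2 ∂(μ.prod μ) +
        lam⁻¹ * ((m : ℝ) ^ 2 * ∫ z, (∫ x, g z x ∂Q) ^ 2 ∂μ) ^ 2 := by
  have hmem : MemLp (pairStat μ g S T) 2 (Measure.pi fun _ : Fin n => Q) :=
    MemLp.of_bound (measurable_pairStat μ hg S T).aestronglyMeasurable _
      (Eventually.of_forall (abs_pairStat_le μ hg1 S T))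
  rw [ProbabilityTheory.variance_eq_sub hmem]
  simp only [Pi.pow_apply]
  rw [integral_pairStat_sq Q μ hg hg1 hST hS hT, integral_pairStat Q μ hg hg1 hST hS hT]
  set f : Z → ℝ := fun z => ∫ x, g z x ∂Q with hf
  have hfm : Measurable f := measurable_mean Q hg
  have hf1 : ∀ z, |f z| ≤ 1 := abs_mean_le Q hg1
  have hCm := measurable_covFun Q hg
  have hC2 := abs_covFun_le Q hg1
  have hff : (∫ z, f z ^ 2 ∂μ) ^ 2 = ∫ zz : Z × Z, (f zz.1 * f zz.2) ^ 2 ∂(μ.prod μ) := by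
    simp_rw [mul_pow]
    rw [integral_prod_mul (fun z => f z ^ 2) (fun z => f z ^ 2), sq]
  have hffm : Measurable fun zz : Z × Z => f zz.1 * f zz.2 :=
    (hfm.comp measurable_fst).mul (hfm.comp measurable_snd)
  have hff1 : ∀ zz : Z × Z, |f zz.1 * f zz.2| ≤ 1 := fun zz => by
    rw [abs_mul]; exact mul_le_one₀ (hf1 _) (abs_nonneg _) (hf1 _)
  have i1 : Integrable (fun zz : Z × Z => covFun Q g zz ^ 2) (μ.prod μ) :=
    integrable_of_abs_le (hCm.pow_const 2) (K := 2 ^ 2) fun zz => by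
      rw [abs_pow]; exact pow_le_pow_left₀ (abs_nonneg _) (hC2 zz) 2
  have i2 : Integrable (fun zz : Z × Z => (f zz.1 * f zz.2) ^ 2) (μ.prod μ) :=
    integrable_of_abs_le (hffm.pow_const 2) (K := 1 ^ 2) fun zz => by
      rw [abs_pow]; exact pow_le_pow_left₀ (abs_nonneg _) (hff1 zz) 2
  have hpt : ∀ zz : Z × Z, (m * covFun Q g zz + (m : ℝ) ^ 2 * (f zz.1 * f zz.2)) ^ 2 ≤
      (1 + lam) * (m : ℝ) ^ 2 * covFun Q g zz ^ 2 +
        (lam⁻¹ + 1) * (m : ℝ) ^ 4 * (f zz.1 * f zz.2) ^ 2 := by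
    intro zz
    have key : ∀ a b : ℝ, (a + b) ^ 2 ≤ (1 + lam) * a ^ 2 + (lam⁻¹ + 1) * b ^ 2 := by
      intro a b
      have h0 : 0 ≤ lam⁻¹ * (lam * a - b) ^ 2 := by positivity
      have h1 : lam⁻¹ * (lam * a - b) ^ 2 = lam * a ^ 2 - 2 * a * b + lam⁻¹ * b ^ 2 := by
        field_simp
        ring
      linarith
    refine (key _ _).trans (le_of_eq ?_)
    ring
  have h1 := integral_mono_of_nonneg (μ := μ.prod μ) (Eventually.of_forall fun zz => sq_nonneg _)
    ((i1.const_mul _).add (i2.const_mul _)) (Eventually.of_forall hpt)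
  have h2 := integral_add (i1.const_mul ((1 + lam) * (m : ℝ) ^ 2))
    (i2.const_mul ((lam⁻¹ + 1) * (m : ℝ) ^ 4))
  rw [integral_const_mul, integral_const_mul, ← hff] at h2
  have h3 := h1.trans_eq h2
  calc _ ≤ _ := sub_le_sub_right h3 _
    _ = _ := by ring

end Statistic

/-! ### Counting statistics -/

section Counting

variable {X Z : Type*} [MeasurableSpace X] [MeasurableSpace Z] {n : ℕ} (Q : Measure X)
  [IsProbabilityMeasure Q] (μ : Measure Z) [IsFiniteMeasure μ]

/-- The indicator of `b z`, centred at a number `p z`. -/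
noncomputable def centredInd (b : Z → Set X) (p : Z → ℝ) (z : Z) (x : X) : ℝ :=
  (b z).indicator (fun _ => (1 : ℝ)) x - p z

variable {b : Z → Set X} {p : Z → ℝ}

lemma measurable_indicator_family (hb : MeasurableSet {zx : Z × X | zx.2 ∈ b zx.1}) :
    Measurable fun zx : Z × X => (b zx.1).indicator (fun _ => (1 : ℝ)) zx.2 :=
  (measurable_const (a := (1 : ℝ))).indicator hb

lemma measurableSet_family (hb : MeasurableSet {zx : Z × X | zx.2 ∈ b zx.1}) (z : Z) :
    MeasurableSet (b z) := hb.preimage measurable_prodMk_left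

lemma measurable_centredInd (hb : MeasurableSet {zx : Z × X | zx.2 ∈ b zx.1}) (hp : Measurable p) :
    Measurable fun zx : Z × X => centredInd b p zx.1 zx.2 :=
  (measurable_indicator_family hb).sub (hp.comp measurable_fst)

lemma abs_centredInd_le {X Z : Type*} {b : Z → Set X} {p : Z → ℝ} (hp0 : ∀ z, 0 ≤ p z)
    (hp1 : ∀ z, p z ≤ 1) (z : Z) (x : X) :
    |centredInd b p z x| ≤ 1 := by
  unfold centredInd
  have h0 := hp0 z
  have h1 := hp1 z
  by_cases hx : x ∈ b z
  · rw [indicator_of_mem hx, abs_le]; constructor <;> linarith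
  · rw [indicator_of_notMem hx, abs_le]; constructor <;> linarith

lemma integral_centredInd (hb : MeasurableSet {zx : Z × X | zx.2 ∈ b zx.1}) (z : Z) :
    ∫ x, centredInd b p z x ∂Q = Q.real (b z) - p z := by
  unfold centredInd
  have h1 : Integrable (fun x => (b z).indicator (fun _ => (1 : ℝ)) x) Q :=
    (integrable_const 1).indicator (measurableSet_family hb z)
  rw [integral_sub h1 (integrable_const _)]
  have h2 := integral_indicator_one (μ := Q) (measurableSet_family hb z)
  have h3 : ∫ x, (b z).indicator (fun _ => (1 : ℝ)) x ∂Q = Q.real (b z) := h2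
  rw [h3]
  simp

lemma covFun_centredInd (hb : MeasurableSet {zx : Z × X | zx.2 ∈ b zx.1}) (zz : Z × Z) :
    covFun Q (centredInd b p) zz =
      Q.real (b zz.1 ∩ b zz.2) - Q.real (b zz.1) * Q.real (b zz.2) := by
  unfold covFun
  rw [integral_centredInd Q hb, integral_centredInd Q hb]
  have hm := measurableSet_family hb
  have hi : ∀ s : Set X, MeasurableSet s → Integrable (s.indicator (fun _ => (1 : ℝ))) Q :=
    fun s hs => (integrable_const 1).indicator hs
  have e1 : ∀ s : Set X, MeasurableSet s → ∫ x, s.indicator (fun _ => (1 : ℝ)) x ∂Q = Q.real s :=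
    fun s hs => integral_indicator_one hs
  have h1 : ∀ x, centredInd b p zz.1 x * centredInd b p zz.2 x =
      (b zz.1 ∩ b zz.2).indicator (fun _ => (1 : ℝ)) x -
        p zz.2 * (b zz.1).indicator (fun _ => (1 : ℝ)) x -
        p zz.1 * (b zz.2).indicator (fun _ => (1 : ℝ)) x + p zz.1 * p zz.2 := by
    intro x
    unfold centredInd
    by_cases h1 : x ∈ b zz.1 <;> by_cases h2 : x ∈ b zz.2 <;> simp [h1, h2, indicator] <;> ring
  simp_rw [h1]
  have i1 := hi _ ((hm zz.1).inter (hm zz.2))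
  have i2 := (hi _ (hm zz.1)).const_mul (p zz.2)
  have i3 := (hi _ (hm zz.2)).const_mul (p zz.1)
  have i4 : Integrable (fun x => (b zz.1 ∩ b zz.2).indicator (fun _ => (1 : ℝ)) x -
        p zz.2 * (b zz.1).indicator (fun _ => (1 : ℝ)) x) Q := i1.sub i2
  have i5 : Integrable (fun x => (b zz.1 ∩ b zz.2).indicator (fun _ => (1 : ℝ)) x -
        p zz.2 * (b zz.1).indicator (fun _ => (1 : ℝ)) x -
        p zz.1 * (b zz.2).indicator (fun _ => (1 : ℝ)) x) Q := i4.sub i3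
  rw [integral_add i5 (integrable_const _), integral_sub i4 i3, integral_sub i1 i2,
    integral_const_mul, integral_const_mul, e1 _ ((hm zz.1).inter (hm zz.2)), e1 _ (hm _),
    e1 _ (hm _)]
  simp
  ring

lemma measurable_real_family (hb : MeasurableSet {zx : Z × X | zx.2 ∈ b zx.1}) :
    Measurable fun z => Q.real (b z) := by
  have h := measurable_mean Q (g := fun z => (b z).indicator fun _ => (1 : ℝ))
    (measurable_indicator_family hb)
  have e : (fun z => Q.real (b z)) = fun z => ∫ x, (b z).indicator (fun _ => (1 : ℝ)) x ∂Q :=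
    funext fun z => (integral_indicator_one (measurableSet_family hb z)).symm
  rw [e]
  exact h

lemma measurable_real_inter_family (hb : MeasurableSet {zx : Z × X | zx.2 ∈ b zx.1}) :
    Measurable fun zz : Z × Z => Q.real (b zz.1 ∩ b zz.2) := by
  have hb2 : MeasurableSet {zx : (Z × Z) × X | zx.2 ∈ b zx.1.1 ∩ b zx.1.2} :=
    (hb.preimage (measurable_fst.fst.prodMk measurable_snd)).inter
      (hb.preimage (measurable_fst.snd.prodMk measurable_snd))
  exact measurable_real_family (b := fun zz : Z × Z => b zz.1 ∩ b zz.2) Q hb2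

/-- The covariance kernel has a smaller Hilbert-Schmidt norm than the kernel `Q(b_z ∩ b_z')`: the
difference involves `∫∫ C(z,z') Q(b_z) Q(b_z')`, the variance of `∫ Q(b_z) 1_{b_z} dμ(z)`. -/
lemma integral_covFun_sq_le (hb : MeasurableSet {zx : Z × X | zx.2 ∈ b zx.1}) :
    ∫ zz, covFun Q (centredInd b p) zz ^ 2 ∂(μ.prod μ) ≤
      ∫ zz : Z × Z, Q.real (b zz.1 ∩ b zz.2) ^ 2 ∂(μ.prod μ) := by
  set q : Z → ℝ := fun z => Q.real (b z) with hq
  have hqm : Measurable q := measurable_real_family Q hb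
  have hq0 : ∀ z, 0 ≤ q z := fun z => measureReal_nonneg
  have hq1 : ∀ z, q z ≤ 1 := fun z => measureReal_le_one
  have hqabs : ∀ z, |q z| ≤ 1 := fun z => by rw [abs_of_nonneg (hq0 z)]; exact hq1 z
  have hgm := measurable_centredInd hb hqm
  have hg1 := abs_centredInd_le (b := b) hq0 hq1
  have hcov : ∀ zz, covFun Q (centredInd b p) zz = covFun Q (centredInd b q) zz := fun zz => by
    rw [covFun_centredInd Q hb, covFun_centredInd Q hb]
  simp_rw [hcov]
  have hCm := measurable_covFun Q hgm
  have hC2 := abs_covFun_le Q hg1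
  have hpsd : 0 ≤ ∫ zz : Z × Z, covFun Q (centredInd b q) zz * (q zz.1 * q zz.2) ∂(μ.prod μ) := by
    have h1 := integral_sq_integral Q μ (F := fun z x => q z * centredInd b q z x)
      ((hqm.comp measurable_fst).mul hgm) (K := 1) (fun z x => by
        rw [abs_mul]
        exact mul_le_one₀ (hqabs z) (abs_nonneg _) (hg1 z x))
    have h2 : ∀ zz : Z × Z, ∫ x, (q zz.1 * centredInd b q zz.1 x) *
        (q zz.2 * centredInd b q zz.2 x) ∂Q =
          covFun Q (centredInd b q) zz * (q zz.1 * q zz.2) := fun zz => by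
      unfold covFun
      rw [integral_centredInd Q hb]
      simp only [hq, sub_self, zero_mul, sub_zero]
      rw [← integral_mul_const]
      exact integral_congr_ae (Eventually.of_forall fun x => by simp only; ring)
    simp_rw [h2] at h1
    rw [← h1]
    exact integral_nonneg fun x => sq_nonneg _
  have hqqm : Measurable fun zz : Z × Z => q zz.1 * q zz.2 :=
    (hqm.comp measurable_fst).mul (hqm.comp measurable_snd)
  have hqq1 : ∀ zz : Z × Z, |q zz.1 * q zz.2| ≤ 1 := fun zz => by
    rw [abs_mul]; exact mul_le_one₀ (hqabs _) (abs_nonneg _) (hqabs _)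
  have i1 : Integrable (fun zz : Z × Z => covFun Q (centredInd b q) zz * (q zz.1 * q zz.2))
      (μ.prod μ) := integrable_of_abs_le (hCm.mul hqqm) (K := 2 * 1) fun zz => by
    rw [abs_mul]
    exact mul_le_mul (hC2 zz) (hqq1 zz) (abs_nonneg _) (by norm_num)
  have i2 : Integrable (fun zz : Z × Z => Q.real (b zz.1 ∩ b zz.2) ^ 2) (μ.prod μ) :=
    integrable_of_abs_le ((measurable_real_inter_family Q hb).pow_const 2) (K := 1) fun zz => by
      rw [abs_pow, abs_of_nonneg measureReal_nonneg]
      exact pow_le_one₀ measureReal_nonneg measureReal_le_one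
  have h1 : ∫ zz, covFun Q (centredInd b q) zz ^ 2 ∂(μ.prod μ) ≤
      ∫ zz : Z × Z, (Q.real (b zz.1 ∩ b zz.2) ^ 2 -
        covFun Q (centredInd b q) zz * (q zz.1 * q zz.2)) ∂(μ.prod μ) := by
    refine integral_mono_of_nonneg (Eventually.of_forall fun zz => sq_nonneg _) (i2.sub i1)
      (Eventually.of_forall fun zz => ?_)
    simp only
    rw [covFun_centredInd Q hb]
    have e1 : 0 ≤ Q.real (b zz.1 ∩ b zz.2) := measureReal_nonneg
    have e2 : 0 ≤ q zz.1 * q zz.2 := mul_nonneg (hq0 _) (hq0 _)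
    have e3 := mul_nonneg e1 e2
    simp only [hq] at e3 ⊢
    nlinarith
  rw [integral_sub i2 i1] at h1
  linarith

lemma chebyshev_real {Ω : Type*} [MeasurableSpace Ω] {P : Measure Ω} [IsFiniteMeasure P]
    {Y : Ω → ℝ} (hY : MemLp Y 2 P) {c : ℝ} (hc : 0 < c) :
    P.real {ω | c ≤ |Y ω - ∫ ω, Y ω ∂P|} ≤ ProbabilityTheory.variance Y P / c ^ 2 :=
  ENNReal.toReal_le_of_le_ofReal (div_nonneg (ProbabilityTheory.variance_nonneg _ _) (sq_nonneg _))
    (ProbabilityTheory.meas_ge_le_variance_div_sq hY hc)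

variable {S T : Finset (Fin n)} {m : ℕ}

/-- Under the null, where the centring is exact, the statistic is rarely large. -/
lemma pairStat_null_le (hb : MeasurableSet {zx : Z × X | zx.2 ∈ b zx.1}) (hST : Disjoint S T)
    (hS : S.card = m) (hT : T.card = m) {τ : ℝ} (hτ : 0 < τ) :
    (Measure.pi fun _ : Fin n => Q).real
        {ω | τ ≤ pairStat μ (centredInd b fun z => Q.real (b z)) S T ω} ≤
      2 * (m : ℝ) ^ 2 * (∫ zz : Z × Z, Q.real (b zz.1 ∩ b zz.2) ^ 2 ∂(μ.prod μ)) / τ ^ 2 := by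
  set q : Z → ℝ := fun z => Q.real (b z) with hq
  have hqm : Measurable q := measurable_real_family Q hb
  have hgm := measurable_centredInd hb hqm
  have hg1 := abs_centredInd_le (b := b) (fun z => (measureReal_nonneg : 0 ≤ q z))
    fun z => measureReal_le_one
  have hmem : MemLp (pairStat μ (centredInd b q) S T) 2 (Measure.pi fun _ : Fin n => Q) :=
    MemLp.of_bound (measurable_pairStat μ hgm S T).aestronglyMeasurable _
      (Eventually.of_forall (abs_pairStat_le μ hg1 S T))
  have h0 : ∀ z, ∫ x, centredInd b q z x ∂Q = 0 := fun z => by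
    rw [integral_centredInd Q hb, sub_self]
  have hmean := integral_pairStat Q μ hgm hg1 hST hS hT
  have hvar := variance_pairStat_le Q μ hgm hg1 hST hS hT one_pos
  simp only [h0] at hmean hvar
  norm_num at hmean hvar
  have hV := integral_covFun_sq_le (p := q) Q μ hb
  have hcheb := chebyshev_real hmem hτ
  rw [hmean] at hcheb
  simp only [sub_zero] at hcheb
  refine (measureReal_mono fun ω hω => ?_).trans (hcheb.trans ?_)
  · exact le_trans (show τ ≤ _ from hω) (le_abs_self _)
  · gcongr
    exact hvar.trans (by gcongr)

/-- Under an alternative the statistic is rarely below half of its mean. -/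
lemma pairStat_alt_le (hb : MeasurableSet {zx : Z × X | zx.2 ∈ b zx.1}) (hp : Measurable p)
    (hp0 : ∀ z, 0 ≤ p z) (hp1 : ∀ z, p z ≤ 1) (hST : Disjoint S T)
    (hS : S.card = m) (hT : T.card = m) (hm : 0 < m) {D : ℝ} (hD : 0 < D)
    (hDS : D = ∫ z, (Q.real (b z) - p z) ^ 2 ∂μ) :
    (Measure.pi fun _ : Fin n => Q).real
        {ω | pairStat μ (centredInd b p) S T ω ≤ (m : ℝ) ^ 2 * D / 2} ≤
      1 / 8 + 132 * (∫ zz : Z × Z, Q.real (b zz.1 ∩ b zz.2) ^ 2 ∂(μ.prod μ)) /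
        ((m : ℝ) * D) ^ 2 := by
  have hgm := measurable_centredInd hb hp
  have hg1 := abs_centredInd_le (b := b) hp0 hp1
  have hm' : (0 : ℝ) < m := by exact_mod_cast hm
  have hmem : MemLp (pairStat μ (centredInd b p) S T) 2 (Measure.pi fun _ : Fin n => Q) :=
    MemLp.of_bound (measurable_pairStat μ hgm S T).aestronglyMeasurable _
      (Eventually.of_forall (abs_pairStat_le μ hg1 S T))
  have hmean := integral_pairStat Q μ hgm hg1 hST hS hT
  have hvar := variance_pairStat_le Q μ hgm hg1 hST hS hT (show (0 : ℝ) < 32 by norm_num)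
  simp only [integral_centredInd Q hb] at hmean hvar
  rw [← hDS] at hmean hvar
  have hV := integral_covFun_sq_le (p := p) Q μ hb
  set V := ∫ zz : Z × Z, Q.real (b zz.1 ∩ b zz.2) ^ 2 ∂(μ.prod μ)
  have hcheb := chebyshev_real hmem (show 0 < (m : ℝ) ^ 2 * D / 2 by positivity)
  rw [hmean] at hcheb
  refine (measureReal_mono fun ω hω => ?_).trans (hcheb.trans ?_)
  · have hω : pairStat μ (centredInd b p) S T ω ≤ (m : ℝ) ^ 2 * D / 2 := hω
    show (m : ℝ) ^ 2 * D / 2 ≤ |_|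
    rw [abs_sub_comm]
    exact le_trans (by linarith) (le_abs_self _)
  · have h1 : ProbabilityTheory.variance (pairStat μ (centredInd b p) S T)
        (Measure.pi fun _ : Fin n => Q) ≤
        (1 + 32) * (m : ℝ) ^ 2 * V + 32⁻¹ * ((m : ℝ) ^ 2 * D) ^ 2 :=
      hvar.trans (by gcongr)
    calc _ ≤ ((1 + 32) * (m : ℝ) ^ 2 * V + 32⁻¹ * ((m : ℝ) ^ 2 * D) ^ 2) /
          ((m : ℝ) ^ 2 * D / 2) ^ 2 := by gcongr
      _ = _ := by field_simp; ring

end Counting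

/-! ### Counting the observations in a set -/

section Count

variable {X : Type*} [MeasurableSpace X] {n : ℕ} (Q : Measure X) [IsProbabilityMeasure Q]
  {D : Set X}

/-- The number of observations that fall into `D`. -/
noncomputable def count (D : Set X) (ω : Fin n → X) : ℝ := ∑ i, D.indicator (fun _ => (1 : ℝ)) (ω i)

lemma abs_indicator_one_le {X : Type*} (D : Set X) (x : X) :
    |D.indicator (fun _ => (1 : ℝ)) x| ≤ 1 := by
  by_cases hx : x ∈ D <;> simp [hx]

lemma measurable_count (hD : MeasurableSet D) : Measurable (count (n := n) D) :=
  Finset.measurable_sum _ fun i _ =>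
    (measurable_const.indicator hD).comp (measurable_pi_apply i)

lemma abs_count_le {X : Type*} (D : Set X) (ω : Fin n → X) : |count D ω| ≤ n := by
  have := abs_sum_le_card (Finset.univ : Finset (Fin n)) (abs_indicator_one_le D) ω
  simpa [count] using this

lemma integral_count (hD : MeasurableSet D) :
    ∫ ω, count D ω ∂(Measure.pi fun _ : Fin n => Q) = n * Q.real D := by
  have h := integral_sum_eval Q (Finset.univ : Finset (Fin n)) (u := D.indicator fun _ => (1 : ℝ))
    (measurable_const.indicator hD) (abs_indicator_one_le D)
  have e : ∫ x, D.indicator (fun _ => (1 : ℝ)) x ∂Q = Q.real D := integral_indicator_one hD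
  rw [e] at h
  simpa [count] using h

lemma variance_count_le (hD : MeasurableSet D) :
    ProbabilityTheory.variance (count D) (Measure.pi fun _ : Fin n => Q) ≤ n * Q.real D := by
  have hmem : MemLp (count D) 2 (Measure.pi fun _ : Fin n => Q) :=
    MemLp.of_bound (measurable_count hD).aestronglyMeasurable n
      (Eventually.of_forall (abs_count_le D))
  rw [ProbabilityTheory.variance_eq_sub hmem, integral_count Q hD]
  have hm : Measurable (D.indicator fun _ => (1 : ℝ)) := measurable_const.indicator hD
  have h := integral_sum_mul_sum Q (Finset.univ : Finset (Fin n)) hm hm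
    (abs_indicator_one_le D) (abs_indicator_one_le D)
  have e : ∫ x, D.indicator (fun _ => (1 : ℝ)) x ∂Q = Q.real D := integral_indicator_one hD
  have e2 : ∀ x, D.indicator (fun _ => (1 : ℝ)) x * D.indicator (fun _ => (1 : ℝ)) x =
      D.indicator (fun _ => (1 : ℝ)) x := fun x => by by_cases hx : x ∈ D <;> simp [hx]
  simp_rw [e2] at h
  rw [e] at h
  have h2 : ∫ ω, (count D ^ 2) ω ∂(Measure.pi fun _ : Fin n => Q) =
      n * (Q.real D - Q.real D * Q.real D) + (n : ℝ) ^ 2 * (Q.real D * Q.real D) := by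
    simpa [count, sq] using h
  rw [h2]
  have : 0 ≤ (n : ℝ) * (Q.real D * Q.real D) := by positivity
  nlinarith

lemma count_null_le (hD : MeasurableSet D) {c : ℝ} (hc : 0 < c) :
    (Measure.pi fun _ : Fin n => Q).real {ω | c ≤ count D ω} ≤ n * Q.real D / c := by
  have h := mul_meas_ge_le_integral_of_nonneg (μ := Measure.pi fun _ : Fin n => Q)
    (f := count D) (Eventually.of_forall fun ω => Finset.sum_nonneg fun i _ =>
      indicator_nonneg (fun _ _ => zero_le_one) _)
    (integrable_of_abs_le (measurable_count hD) (abs_count_le D)) c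
  rw [integral_count Q hD] at h
  rw [le_div_iff₀ hc, mul_comm]
  exact h

lemma count_alt_le (hD : MeasurableSet D) {c : ℝ} (hq : 0 < n * Q.real D)
    (hc : 2 * c ≤ n * Q.real D) :
    (Measure.pi fun _ : Fin n => Q).real {ω | count D ω ≤ c} ≤ 4 / (n * Q.real D) := by
  have hmem : MemLp (count D) 2 (Measure.pi fun _ : Fin n => Q) :=
    MemLp.of_bound (measurable_count hD).aestronglyMeasurable n
      (Eventually.of_forall (abs_count_le D))
  have hcheb := chebyshev_real hmem (half_pos hq)
  rw [integral_count Q hD] at hcheb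
  refine (measureReal_mono fun ω hω => ?_).trans (hcheb.trans ?_)
  · have hω : count D ω ≤ c := hω
    show n * Q.real D / 2 ≤ |_|
    rw [abs_sub_comm]
    exact le_trans (by linarith) (le_abs_self _)
  · calc _ ≤ (n * Q.real D) / (n * Q.real D / 2) ^ 2 := by
          gcongr; exact variance_count_le Q hD
      _ = _ := by field_simp; norm_num

end Count

/-! ### The bulk and its adaptive bandwidth -/

/-- The bulk `{θ p ^ γ ≤ p}`, where the optimal bandwidth is so small that `p` is nearly constant at
that scale. The condition `0 < p` removes the zeros of `p`, where the other one is trivial. -/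
def bulk (θ : ℝ) (p : E d → ℝ) : Set (E d) := {x | θ * p x ^ gam d ≤ p x ∧ 0 < p x}

/-- The bandwidth `s p ^ γ`. -/
noncomputable def bandwidth (s : ℝ) (p : E d → ℝ) (x : E d) : ℝ := s * p x ^ gam d

/-- The ratio `p ^ (1 - γ)`; the mass of a ball of radius `bandwidth` is `s ^ d` times its cube, up
to constants. -/
noncomputable def ratio (p : E d → ℝ) (x : E d) : ℝ := p x / p x ^ gam d

/-- The weight of the ball around `z` in the test statistic. With this choice the weighted integrals
that control the mean and the variance both reduce to `∫ p ^ γ`, see `ballWeight_mul_ratio_pow`. -/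
noncomputable def ballWeight (s : ℝ) (p : E d → ℝ) (z : E d) : ℝ :=
  1 / (ratio p z ^ 2 * bandwidth s p z ^ d)

/-- The measure on the bulk with density `ballWeight`. -/
noncomputable def bulkMeasure (θ s : ℝ) (p : E d → ℝ) : Measure (E d) :=
  (volume.restrict (bulk θ p)).withDensity fun z => ENNReal.ofReal (ballWeight s p z)

/-- The ball around `z` of radius `bandwidth`. -/
def ballAt (s : ℝ) (p : E d → ℝ) (z : E d) : Set (E d) := Metric.closedBall z (bandwidth s p z)

section Bulk

variable {L θ s : ℝ} {p : E d → ℝ}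

lemma measurableSet_bulk (hp : Measurable p) (θ : ℝ) : MeasurableSet (bulk θ p) :=
  (measurableSet_le (by fun_prop) hp).inter (measurableSet_lt measurable_const hp)

lemma measurable_bandwidth (hp : Measurable p) (s : ℝ) : Measurable (bandwidth s p) := by
  unfold bandwidth; fun_prop

lemma measurable_ratio (hp : Measurable p) : Measurable (ratio p) := by
  unfold ratio; fun_prop

lemma measurable_ballWeight (hp : Measurable p) (s : ℝ) : Measurable (ballWeight s p) := by
  unfold ballWeight
  exact measurable_const.div (((measurable_ratio hp).pow_const 2).mul
    ((measurable_bandwidth hp s).pow_const d))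

lemma measurableSet_ballAt (hp : Measurable p) (s : ℝ) :
    MeasurableSet {zx : E d × E d | zx.2 ∈ ballAt s p zx.1} :=
  measurableSet_le (f := fun zx : E d × E d => dist zx.2 zx.1) (by fun_prop)
    ((measurable_bandwidth hp s).comp measurable_fst)

lemma bandwidth_nonneg (hs : 0 ≤ s) (hp : ∀ x, 0 ≤ p x) (z : E d) : 0 ≤ bandwidth s p z :=
  mul_nonneg hs (Real.rpow_nonneg (hp z) _)

lemma ballWeight_nonneg (hs : 0 ≤ s) (hp : ∀ x, 0 ≤ p x) (z : E d) : 0 ≤ ballWeight s p z := by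
  have := bandwidth_nonneg hs hp z
  unfold ballWeight
  positivity

lemma rpow_pos_of_mem_bulk {z : E d} (hz : z ∈ bulk θ p) : 0 < p z ^ gam d :=
  Real.rpow_pos_of_pos hz.2 _

lemma ratio_pos {z : E d} (hz : z ∈ bulk θ p) : 0 < ratio p z :=
  div_pos hz.2 (rpow_pos_of_mem_bulk hz)

lemma bandwidth_pos (hs : 0 < s) {z : E d} (hz : z ∈ bulk θ p) : 0 < bandwidth s p z :=
  mul_pos hs (rpow_pos_of_mem_bulk hz)

lemma le_ratio {z : E d} (hz : z ∈ bulk θ p) : θ ≤ ratio p z :=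
  (le_div_iff₀ (rpow_pos_of_mem_bulk hz)).2 hz.1

lemma ratio_mul {z : E d} (hz : z ∈ bulk θ p) : ratio p z * p z ^ gam d = p z :=
  div_mul_cancel₀ _ (rpow_pos_of_mem_bulk hz).ne'

lemma ratio_sq {z : E d} (hz : z ∈ bulk θ p) : ratio p z ^ 2 = (p z ^ gam d) ^ (d + 1) := by
  have hu := rpow_pos_of_mem_bulk hz
  have h := rpow_gam_pow d hz.2.le
  rw [ratio, div_pow, ← h, div_eq_iff (by positivity), ← pow_add]

lemma ratio_sq_div {z : E d} (hs : 0 < s) (hz : z ∈ bulk θ p) :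
    ratio p z ^ 2 / bandwidth s p z ^ d = p z ^ gam d / s ^ d := by
  have hu := rpow_pos_of_mem_bulk hz
  rw [ratio_sq hz, bandwidth, mul_pow, pow_succ]
  field_simp

lemma mul_bandwidth_pow {z : E d} (hz : z ∈ bulk θ p) :
    p z * bandwidth s p z ^ d = s ^ d * ratio p z ^ 3 := by
  calc p z * bandwidth s p z ^ d = (ratio p z * p z ^ gam d) * (s ^ d * (p z ^ gam d) ^ d) := by
        rw [ratio_mul hz, bandwidth, mul_pow]
    _ = s ^ d * ratio p z * (p z ^ gam d) ^ (d + 1) := by ring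
    _ = _ := by rw [← ratio_sq hz]; ring

lemma mul_bandwidth_le (hsL : L * s ≤ θ / 4) {z : E d} (hz : z ∈ bulk θ p) :
    L * bandwidth s p z ≤ p z / 4 := by
  have hu := rpow_pos_of_mem_bulk hz
  have h1 : L * s * p z ^ gam d ≤ θ / 4 * p z ^ gam d := by gcongr
  have h2 := hz.1
  unfold bandwidth
  linarith

/-- Densities at bulk points whose balls meet agree up to a factor `2`. -/
lemma le_two_mul_of_dist_le (hL : 0 < L) (hp : p ∈ lipBall d L) (hsL : L * s ≤ θ / 4) {z y : E d}
    (hz : z ∈ bulk θ p) (hy : y ∈ bulk θ p)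
    (hzy : dist z y ≤ bandwidth s p z + bandwidth s p y) : p z ≤ 2 * p y := by
  have h1 := (le_abs_self _).trans (hp.2.2 z y)
  rw [dist_eq_norm] at hzy
  have h2 : L * ‖z - y‖ ≤ L * (bandwidth s p z + bandwidth s p y) := by gcongr
  have h3 := mul_bandwidth_le hsL hz
  have h4 := mul_bandwidth_le hsL hy
  have := hy.2
  linarith

lemma abs_sub_le_of_mem_ballAt (hL : 0 < L) (hp : p ∈ lipBall d L) (hsL : L * s ≤ θ / 4)
    {z y : E d} (hz : z ∈ bulk θ p) (hy : y ∈ ballAt s p z) : |p y - p z| ≤ p z / 4 := by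
  have hy : dist y z ≤ bandwidth s p z := hy
  rw [dist_eq_norm] at hy
  refine (hp.2.2 y z).trans (le_trans ?_ (mul_bandwidth_le hsL hz))
  gcongr

lemma law_ballAt_le (hL : 0 < L) (hp : p ∈ lipBall d L) (hs : 0 < s) (hsL : L * s ≤ θ / 4)
    {z : E d} (hz : z ∈ bulk θ p) :
    (law p).real (ballAt s p z) ≤ 2 * unitVol d * (s ^ d * ratio p z ^ 3) := by
  have hh := bandwidth_pos hs hz
  rw [law_real_apply hp (s := ballAt s p z) measurableSet_closedBall]
  calc ∫ y in ballAt s p z, p y ≤ ∫ y in ballAt s p z, 2 * p z := by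
        refine setIntegral_mono_on (integrable_of_mem hp).integrableOn
          (integrableOn_const measure_closedBall_lt_top.ne) measurableSet_closedBall fun y hy => ?_
        have := (abs_le.1 (abs_sub_le_of_mem_ballAt hL hp hsL hz hy)).2
        have := hz.2
        linarith
    _ = _ := by
        rw [setIntegral_const, ballAt, volume_real_closedBall _ hh.le, smul_eq_mul,
          ← mul_bandwidth_pow hz]
        ring

lemma le_law_ballAt (hL : 0 < L) (hp : p ∈ lipBall d L) (hs : 0 < s) (hsL : L * s ≤ θ / 4)
    {z : E d} (hz : z ∈ bulk θ p) :
    unitVol d / 2 * (s ^ d * ratio p z ^ 3) ≤ (law p).real (ballAt s p z) := by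
  have hh := bandwidth_pos hs hz
  rw [law_real_apply hp (s := ballAt s p z) measurableSet_closedBall]
  calc _ = ∫ y in ballAt s p z, p z / 2 := by
        rw [setIntegral_const, ballAt, volume_real_closedBall _ hh.le, smul_eq_mul,
          ← mul_bandwidth_pow hz]
        ring
    _ ≤ _ := by
        refine setIntegral_mono_on (integrableOn_const measure_closedBall_lt_top.ne)
          (integrable_of_mem hp).integrableOn measurableSet_closedBall fun y hy => ?_
        have := (abs_le.1 (abs_sub_le_of_mem_ballAt hL hp hsL hz hy)).1
        have := hz.2
        linarith

lemma integral_bulkMeasure (hp : Measurable p) (hp0 : ∀ x, 0 ≤ p x) (hs : 0 < s) (F : E d → ℝ) :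
    ∫ z, F z ∂(bulkMeasure θ s p) = ∫ z in bulk θ p, ballWeight s p z * F z := by
  unfold bulkMeasure
  rw [integral_withDensity_eq_integral_toReal_smul (measurable_ballWeight hp s).ennreal_ofReal
    (Eventually.of_forall fun _ => ENNReal.ofReal_lt_top)]
  simp [ENNReal.toReal_ofReal (ballWeight_nonneg hs.le hp0 _)]

lemma integrable_bulkMeasure_iff (hp : Measurable p) (hp0 : ∀ x, 0 ≤ p x) (hs : 0 < s)
    (F : E d → ℝ) :
    Integrable F (bulkMeasure θ s p) ↔
      IntegrableOn (fun z => ballWeight s p z * F z) (bulk θ p) := by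
  unfold bulkMeasure
  rw [integrable_withDensity_iff_integrable_smul' (measurable_ballWeight hp s).ennreal_ofReal
    (Eventually.of_forall fun _ => ENNReal.ofReal_lt_top)]
  simp [ENNReal.toReal_ofReal (ballWeight_nonneg hs.le hp0 _), IntegrableOn]

lemma ae_mem_bulk (hp : Measurable p) : ∀ᵐ z ∂(bulkMeasure θ s p), z ∈ bulk θ p :=
  (withDensity_absolutelyContinuous _ _).ae_le (ae_restrict_mem (measurableSet_bulk hp θ))

/-- The weight times the fourth power of the ratio is a multiple of `p ^ γ`. -/
lemma ballWeight_mul_ratio_pow {z : E d} (hs : 0 < s) (hz : z ∈ bulk θ p) :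
    ballWeight s p z * ratio p z ^ 4 = p z ^ gam d / s ^ d := by
  have hr := ratio_pos hz
  have hh := bandwidth_pos hs hz
  rw [← ratio_sq_div hs hz, ballWeight]
  field_simp

lemma integrable_ratio_pow_four (hp : p ∈ lipBall d L) (hs : 0 < s)
    (hu : IntegrableOn (fun x => p x ^ gam d) (bulk θ p)) :
    Integrable (fun z => ratio p z ^ 4) (bulkMeasure θ s p) := by
  have hm := (continuous_of_mem hp).measurable
  rw [integrable_bulkMeasure_iff hm hp.1 hs]
  refine IntegrableOn.congr_fun (f := fun z => p z ^ gam d / s ^ d) (hu.div_const (s ^ d))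
    (fun z hz => ?_) (measurableSet_bulk hm θ)
  exact (ballWeight_mul_ratio_pow hs hz).symm

lemma integral_ratio_pow_four (hp : p ∈ lipBall d L) (hs : 0 < s) :
    ∫ z, ratio p z ^ 4 ∂(bulkMeasure θ s p) = (∫ z in bulk θ p, p z ^ gam d) / s ^ d := by
  have hm := (continuous_of_mem hp).measurable
  rw [integral_bulkMeasure hm hp.1 hs, ← integral_div]
  exact setIntegral_congr_fun (measurableSet_bulk hm θ) fun z hz => ballWeight_mul_ratio_pow hs hz

lemma isFiniteMeasure_bulkMeasure (hp : p ∈ lipBall d L) (hs : 0 < s) (hθ : 0 < θ)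
    (hu : IntegrableOn (fun x => p x ^ gam d) (bulk θ p)) :
    IsFiniteMeasure (bulkMeasure θ s p) := by
  have hm := (continuous_of_mem hp).measurable
  have hint : IntegrableOn (ballWeight s p) (bulk θ p) := by
    refine Integrable.mono' (hu.div_const (s ^ d * θ ^ 4))
      (measurable_ballWeight hm s).aestronglyMeasurable ?_
    filter_upwards [ae_restrict_mem (measurableSet_bulk hm θ)] with z hz
    rw [Real.norm_of_nonneg (ballWeight_nonneg hs.le hp.1 z), ← div_div,
      ← ballWeight_mul_ratio_pow hs hz, le_div_iff₀ (by positivity)]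
    have := ballWeight_nonneg hs.le hp.1 z
    have := le_ratio hz
    gcongr
  exact isFiniteMeasure_withDensity_ofReal hint.2

/-- The mass of the bulk points whose ball meets the ball at `z`: by comparability of the bandwidths
they lie within three bandwidths of `z`, and the weight varies by a constant factor there. -/
lemma bulkMeasure_meet_le (hL : 0 < L) (hp : p ∈ lipBall d L) (hs : 0 < s) (hsL : L * s ≤ θ / 4)
    {z : E d} (hz : z ∈ bulk θ p) :
    (bulkMeasure θ s p).real {y | dist z y ≤ bandwidth s p z + bandwidth s p y} ≤
      2 ^ (2 * d + 1) * 3 ^ d * unitVol d / ratio p z ^ 2 := by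
  have hm := (continuous_of_mem hp).measurable
  have hh := bandwidth_pos hs hz
  have hr := ratio_pos hz
  have hω := unitVol_pos d
  have hM : MeasurableSet {y | dist z y ≤ bandwidth s p z + bandwidth s p y} :=
    measurableSet_le (by fun_prop) (measurable_const.add (measurable_bandwidth hm s))
  refine ENNReal.toReal_le_of_le_ofReal (by positivity) ?_
  have hG := measurableSet_bulk hm θ
  have hsub : ∀ y ∈ {y | dist z y ≤ bandwidth s p z + bandwidth s p y} ∩ bulk θ p,
      y ∈ Metric.closedBall z (3 * bandwidth s p z) ∧
        ballWeight s p y ≤ 2 ^ (2 * d + 1) * ballWeight s p z := by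
    rintro y ⟨hy, hyG⟩
    have hy : dist z y ≤ bandwidth s p z + bandwidth s p y := hy
    have h1 := le_two_mul_of_dist_le hL hp hsL hz hyG hy
    have h2 := le_two_mul_of_dist_le hL hp hsL hyG hz (by rw [dist_comm]; linarith)
    have h3 := rpow_gam_le_two_mul d (hp.1 y) (hp.1 z) h2
    have h4 := rpow_gam_le_two_mul d (hp.1 z) (hp.1 y) h1
    have hu := rpow_pos_of_mem_bulk hz
    have huy := rpow_pos_of_mem_bulk hyG
    constructor
    · rw [Metric.mem_closedBall, dist_comm]
      have : bandwidth s p y ≤ 2 * bandwidth s p z := by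
        unfold bandwidth; nlinarith
      linarith
    · unfold ballWeight
      rw [ratio_sq hz, ratio_sq hyG, bandwidth, bandwidth, mul_one_div,
        div_le_div_iff₀ (by positivity) (by positivity), one_mul]
      calc (p z ^ gam d) ^ (d + 1) * (s * p z ^ gam d) ^ d
          ≤ (2 * p y ^ gam d) ^ (d + 1) * (s * (2 * p y ^ gam d)) ^ d := by gcongr
        _ = _ := by rw [mul_pow, mul_pow s, mul_pow s, mul_pow]; ring
  unfold bulkMeasure
  rw [withDensity_apply _ hM, Measure.restrict_restrict hM]
  calc ∫⁻ y in {y | dist z y ≤ bandwidth s p z + bandwidth s p y} ∩ bulk θ p,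
        ENNReal.ofReal (ballWeight s p y)
      ≤ ∫⁻ y in {y | dist z y ≤ bandwidth s p z + bandwidth s p y} ∩ bulk θ p,
        ENNReal.ofReal (2 ^ (2 * d + 1) * ballWeight s p z) :=
        setLIntegral_mono' (hM.inter hG) fun y hy => ENNReal.ofReal_le_ofReal (hsub y hy).2
    _ ≤ ∫⁻ y in Metric.closedBall z (3 * bandwidth s p z),
        ENNReal.ofReal (2 ^ (2 * d + 1) * ballWeight s p z) :=
        lintegral_mono_set fun y hy => (hsub y hy).1
    _ = _ := by
        have h0 := ballWeight_nonneg hs.le hp.1 z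
        rw [setLIntegral_const, volume_closedBall _ (by positivity),
          ← ENNReal.ofReal_mul (by positivity)]
        congr 1
        unfold ballWeight
        rw [mul_pow]
        field_simp

/-- The Hilbert-Schmidt norm of the kernel `Q(b_z ∩ b_z')` is controlled by the separation
`∫ (Q(b_z) - P(b_z))²`. -/
lemma integral_inter_sq_le (hL : 0 < L) (hp : p ∈ lipBall d L) (hs : 0 < s) (hθ : 0 < θ)
    (hsL : L * s ≤ θ / 4) (hu : IntegrableOn (fun x => p x ^ gam d) (bulk θ p))
    (Q : Measure (E d)) [IsProbabilityMeasure Q] :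
    ∫ zz : E d × E d, Q.real (ballAt s p zz.1 ∩ ballAt s p zz.2) ^ 2
        ∂((bulkMeasure θ s p).prod (bulkMeasure θ s p)) ≤
      2 ^ (2 * d + 1) * 3 ^ d * unitVol d *
        (8 * unitVol d ^ 2 * s ^ d * (∫ z in bulk θ p, p z ^ gam d) +
          2 / θ ^ 2 * ∫ z, (Q.real (ballAt s p z) - (law p).real (ballAt s p z)) ^ 2
            ∂(bulkMeasure θ s p)) := by
  have hm := (continuous_of_mem hp).measurable
  have hpr := isProbabilityMeasure_law hp
  have hfin := isFiniteMeasure_bulkMeasure hp hs hθ hu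
  have hω := unitVol_pos d
  have hb := measurableSet_ballAt hm s
  set μ := bulkMeasure θ s p with hμ
  set K : ℝ := 2 ^ (2 * d + 1) * 3 ^ d * unitVol d with hK
  have hKpos : 0 < K := by positivity
  set q : E d → ℝ := fun z => Q.real (ballAt s p z) with hq
  set q0 : E d → ℝ := fun z => (law p).real (ballAt s p z) with hq0
  have hqm : Measurable q := measurable_real_family Q hb
  have hq0m : Measurable q0 := measurable_real_family (law p) hb
  have hqn : ∀ z, 0 ≤ q z := fun z => measureReal_nonneg
  have hq1 : ∀ z, q z ≤ 1 := fun z => measureReal_le_one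
  have hq0n : ∀ z, 0 ≤ q0 z := fun z => measureReal_nonneg
  have hq01 : ∀ z, q0 z ≤ 1 := fun z => measureReal_le_one
  -- the set of pairs of points whose balls may meet
  set M : Set (E d × E d) :=
    {zz | dist zz.1 zz.2 ≤ bandwidth s p zz.1 + bandwidth s p zz.2} with hMdef
  have hM : MeasurableSet M := measurableSet_le (by fun_prop)
    (((measurable_bandwidth hm s).comp measurable_fst).add
      ((measurable_bandwidth hm s).comp measurable_snd))
  set F : E d × E d → ℝ := fun zz => q zz.1 ^ 2 * M.indicator (fun _ => 1) zz with hF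
  have hFm : Measurable F :=
    ((hqm.comp measurable_fst).pow_const 2).mul (measurable_const.indicator hM)
  have hF1 : ∀ zz, |F zz| ≤ 1 := fun zz => by
    simp only [hF]
    rw [abs_mul, abs_pow, abs_of_nonneg (hqn _)]
    exact mul_le_one₀ (pow_le_one₀ (hqn _) (hq1 _)) (abs_nonneg _) (abs_indicator_one_le M zz)
  have hFi : Integrable F (μ.prod μ) := integrable_of_abs_le hFm hF1
  have hFs : Integrable (fun zz : E d × E d => F zz.swap) (μ.prod μ) :=
    integrable_of_abs_le (hFm.comp measurable_swap) fun zz => hF1 _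
  have hMs : ∀ zz : E d × E d, M.indicator (fun _ => (1 : ℝ)) zz.swap =
      M.indicator (fun _ => (1 : ℝ)) zz := fun zz => by
    have : zz.swap ∈ M ↔ zz ∈ M := by
      simp only [hMdef, mem_ofPred_eq, Prod.fst_swap, Prod.snd_swap, dist_comm zz.2, add_comm]
    by_cases h : zz ∈ M
    · rw [indicator_of_mem h, indicator_of_mem (this.2 h)]
    · rw [indicator_of_notMem h, indicator_of_notMem fun h' => h (this.1 h')]
  have hpt : ∀ zz : E d × E d, Q.real (ballAt s p zz.1 ∩ ballAt s p zz.2) ^ 2 ≤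
      (F zz + F zz.swap) / 2 := by
    intro zz
    simp only [hF, hMs, Prod.fst_swap]
    by_cases h : zz ∈ M
    · rw [indicator_of_mem h]
      have h1 : Q.real (ballAt s p zz.1 ∩ ballAt s p zz.2) ≤ q zz.1 :=
        measureReal_mono inter_subset_left
      have h2 : Q.real (ballAt s p zz.1 ∩ ballAt s p zz.2) ≤ q zz.2 :=
        measureReal_mono inter_subset_right
      have h0 : 0 ≤ Q.real (ballAt s p zz.1 ∩ ballAt s p zz.2) := measureReal_nonneg
      have := pow_le_pow_left₀ h0 h1 2
      have := pow_le_pow_left₀ h0 h2 2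
      linarith
    · have : ballAt s p zz.1 ∩ ballAt s p zz.2 = ∅ := by
        refine eq_empty_of_forall_notMem fun x hx => h ?_
        have h1 : dist x zz.1 ≤ bandwidth s p zz.1 := hx.1
        have h2 : dist x zz.2 ≤ bandwidth s p zz.2 := hx.2
        have := dist_triangle_left zz.1 zz.2 x
        show dist zz.1 zz.2 ≤ _
        linarith
      rw [this, indicator_of_notMem h]
      simp
  have h1 : ∫ zz : E d × E d, Q.real (ballAt s p zz.1 ∩ ballAt s p zz.2) ^ 2 ∂(μ.prod μ) ≤
      ∫ zz, F zz ∂(μ.prod μ) := by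
    have hFF : Integrable (fun zz : E d × E d => (F zz + F zz.swap) / 2) (μ.prod μ) :=
      (hFi.add hFs).div_const 2
    refine (integral_mono_of_nonneg (Eventually.of_forall fun zz => sq_nonneg _) hFF
      (Eventually.of_forall hpt)).trans_eq ?_
    rw [integral_div, integral_add hFi hFs, integral_prod_swap]
    ring
  have hint : ∀ (f : E d → ℝ), Measurable f → (∀ z, |f z| ≤ 1) →
      Integrable (fun z => f z ^ 2 / ratio p z ^ 2) μ := by
    intro f hf hf1
    refine Integrable.mono' (integrable_const (1 / θ ^ 2)) ((hf.pow_const 2).div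
      ((measurable_ratio hm).pow_const 2)).aestronglyMeasurable ?_
    filter_upwards [ae_mem_bulk hm] with z hz
    have hr := le_ratio hz
    rw [Real.norm_of_nonneg (by positivity)]
    gcongr
    rw [← sq_abs]
    exact pow_le_one₀ (abs_nonneg _) (hf1 z)
  have hqabs : ∀ z, |q z| ≤ 1 := fun z => by rw [abs_of_nonneg (hqn z)]; exact hq1 z
  have hq0abs : ∀ z, |q0 z| ≤ 1 := fun z => by rw [abs_of_nonneg (hq0n z)]; exact hq01 z
  have hdabs : ∀ z, |q z - q0 z| ≤ 1 := fun z => by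
    rw [abs_le]; constructor <;> linarith [hqn z, hq1 z, hq0n z, hq01 z]
  have h2 : ∫ zz, F zz ∂(μ.prod μ) ≤ ∫ z, K * (q z ^ 2 / ratio p z ^ 2) ∂μ := by
    rw [integral_prod _ hFi]
    refine integral_mono_ae hFi.integral_prod_left ((hint q hqm hqabs).const_mul K) ?_
    filter_upwards [ae_mem_bulk hm] with z hz
    simp only [hF]
    rw [integral_const_mul]
    have e1 : ∫ y, M.indicator (fun _ => (1 : ℝ)) (z, y) ∂μ =
        μ.real {y | dist z y ≤ bandwidth s p z + bandwidth s p y} :=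
      integral_indicator_one (hM.preimage measurable_prodMk_left)
    rw [e1]
    have e2 := bulkMeasure_meet_le hL hp hs hsL hz
    calc _ ≤ q z ^ 2 * (K / ratio p z ^ 2) := by gcongr
      _ = _ := by ring
  have hdi : Integrable (fun z => (q z - q0 z) ^ 2 / ratio p z ^ 2) μ :=
    hint _ (hqm.sub hq0m) hdabs
  have hq0i := hint q0 hq0m hq0abs
  have h3 : ∫ z, q z ^ 2 / ratio p z ^ 2 ∂μ ≤ 2 * ∫ z, q0 z ^ 2 / ratio p z ^ 2 ∂μ +
      2 * ∫ z, (q z - q0 z) ^ 2 / ratio p z ^ 2 ∂μ := by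
    rw [← integral_const_mul, ← integral_const_mul,
      ← integral_add (hq0i.const_mul 2) (hdi.const_mul 2)]
    refine integral_mono_ae (hint q hqm hqabs) ((hq0i.const_mul 2).add (hdi.const_mul 2)) ?_
    filter_upwards [ae_mem_bulk hm] with z hz
    have hr := ratio_pos hz
    rw [mul_div_assoc', mul_div_assoc', ← add_div]
    gcongr
    nlinarith [sq_nonneg (q z - 2 * q0 z)]
  have h4 : ∫ z, q0 z ^ 2 / ratio p z ^ 2 ∂μ ≤
      4 * unitVol d ^ 2 * s ^ d * ∫ z in bulk θ p, p z ^ gam d := by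
    have e0 := integral_ratio_pow_four (θ := θ) hp hs
    have e1 := (integrable_ratio_pow_four hp hs hu).const_mul (4 * unitVol d ^ 2 * s ^ d * s ^ d)
    calc _ ≤ ∫ z, 4 * unitVol d ^ 2 * s ^ d * s ^ d * ratio p z ^ 4 ∂μ := by
          refine integral_mono_ae hq0i e1 ?_
          filter_upwards [ae_mem_bulk hm] with z hz
          have hr := ratio_pos hz
          have h5 := pow_le_pow_left₀ (hq0n z) (law_ballAt_le hL hp hs hsL hz) 2
          rw [div_le_iff₀ (by positivity)]
          refine h5.trans_eq ?_
          ring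
      _ = _ := by
          rw [integral_const_mul, e0]
          field_simp
  have h5 : ∫ z, (q z - q0 z) ^ 2 / ratio p z ^ 2 ∂μ ≤
      1 / θ ^ 2 * ∫ z, (q z - q0 z) ^ 2 ∂μ := by
    rw [← integral_const_mul]
    refine integral_mono_ae hdi ((integrable_of_abs_le ((hqm.sub hq0m).pow_const 2)
      (K := 1) fun z => ?_).const_mul _) ?_
    · rw [abs_pow]; exact pow_le_one₀ (abs_nonneg _) (hdabs z)
    · filter_upwards [ae_mem_bulk hm] with z hz
      have hr := le_ratio hz
      rw [one_div, inv_mul_eq_div]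
      gcongr
  rw [integral_const_mul] at h2
  calc _ ≤ K * ∫ z, q z ^ 2 / ratio p z ^ 2 ∂μ := h1.trans h2
    _ ≤ _ := by
        gcongr
        have h6 : 2 / θ ^ 2 * ∫ z, (q z - q0 z) ^ 2 ∂μ =
          2 * (1 / θ ^ 2 * ∫ z, (q z - q0 z) ^ 2 ∂μ) := by ring
        linarith

end Bulk

/-! ### Separation on the bulk -/

section Separation

variable {L θ s : ℝ} {p q : E d → ℝ}

/-- A Lipschitz function is recovered from its average over a small ball. -/
lemma unitVol_mul_abs_sub_le (hL : 0 < L) (hp : p ∈ lipBall d L) (hq : q ∈ lipBall d L)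
    (hs : 0 < s) {z : E d} (hz : z ∈ bulk θ p) :
    unitVol d * |q z - p z| ≤
      |(law q).real (ballAt s p z) - (law p).real (ballAt s p z)| / bandwidth s p z ^ d +
        2 * L * unitVol d * bandwidth s p z := by
  have hh := bandwidth_pos hs hz
  have hω := unitVol_pos d
  have hbm : MeasurableSet (ballAt s p z) := measurableSet_closedBall
  have hvol : volume.real (ballAt s p z) = unitVol d * bandwidth s p z ^ d :=
    volume_real_closedBall _ hh.le
  have hvf : volume (ballAt s p z) ≠ ⊤ := measure_closedBall_lt_top.ne
  have hpi := (integrable_of_mem hp).integrableOn (s := ballAt s p z)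
  have hqi := (integrable_of_mem hq).integrableOn (s := ballAt s p z)
  set f : E d → ℝ := fun y => q y - p y with hf
  have hfi : IntegrableOn f (ballAt s p z) := hqi.sub hpi
  have hci : IntegrableOn (fun _ => f z) (ballAt s p z) := integrableOn_const hvf
  have e1 : (law q).real (ballAt s p z) - (law p).real (ballAt s p z) =
      ∫ y in ballAt s p z, f y := by
    rw [law_real_apply hp hbm, law_real_apply hq hbm, ← integral_sub hqi hpi]
  have e2 : ∫ _ in ballAt s p z, f z = unitVol d * bandwidth s p z ^ d * f z := by
    rw [setIntegral_const, hvol, smul_eq_mul]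
  have e3 : |∫ y in ballAt s p z, (f z - f y)| ≤
      2 * L * bandwidth s p z * (unitVol d * bandwidth s p z ^ d) := by
    rw [← hvol]
    refine norm_setIntegral_le_of_norm_le_const (f := fun y => f z - f y) hvf.lt_top
      fun y hy => ?_
    have hy : dist y z ≤ bandwidth s p z := hy
    rw [dist_eq_norm, norm_sub_rev] at hy
    have h1 := hq.2.2 z y
    have h2 := hp.2.2 z y
    have h3 : L * ‖z - y‖ ≤ L * bandwidth s p z := by gcongr
    have h4 : f z - f y = (q z - q y) - (p z - p y) := by simp only [hf]; ring
    rw [Real.norm_eq_abs, h4]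
    refine (abs_sub _ _).trans ?_
    linarith
  rw [integral_sub hci hfi, e2] at e3
  have h5 : unitVol d * bandwidth s p z ^ d * |f z| ≤ |∫ y in ballAt s p z, f y| +
      2 * L * bandwidth s p z * (unitVol d * bandwidth s p z ^ d) := by
    have h6 : unitVol d * bandwidth s p z ^ d * |f z| =
        |unitVol d * bandwidth s p z ^ d * f z| := by
      rw [abs_mul, abs_of_pos (show 0 < unitVol d * bandwidth s p z ^ d by positivity)]
    have h7 := abs_sub_abs_le_abs_sub (unitVol d * bandwidth s p z ^ d * f z)
      (∫ y in ballAt s p z, f y)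
    linarith
  rw [e1]
  have h8 : 0 < bandwidth s p z ^ d := by positivity
  calc unitVol d * |f z| = unitVol d * bandwidth s p z ^ d * |f z| / bandwidth s p z ^ d := by
        field_simp
    _ ≤ _ := by
        rw [div_le_iff₀ h8]
        refine h5.trans_eq ?_
        field_simp

/-- If `p` and `q` are separated on the bulk by more than the discretization bias, then the mean of
the test statistic is large. -/
lemma sq_separation_le (hL : 0 < L) (hp : p ∈ lipBall d L) (hq : q ∈ lipBall d L) (hs : 0 < s)
    (hθ : 0 < θ) (hu : IntegrableOn (fun x => p x ^ gam d) (bulk θ p)) {Y : ℝ} (hY : 0 < Y)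
    (hYle : Y ≤ (∫ z in bulk θ p, |q z - p z|) - 2 * L * s * ∫ z in bulk θ p, p z ^ gam d) :
    (unitVol d * Y) ^ 2 ≤ ((∫ z in bulk θ p, p z ^ gam d) / s ^ d) *
      ∫ z, ((law q).real (ballAt s p z) - (law p).real (ballAt s p z)) ^ 2
        ∂(bulkMeasure θ s p) := by
  have hm := (continuous_of_mem hp).measurable
  have hpr := isProbabilityMeasure_law hp
  have hqr := isProbabilityMeasure_law hq
  have hfin := isFiniteMeasure_bulkMeasure hp hs hθ hu
  have hω := unitVol_pos d
  have hb := measurableSet_ballAt hm s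
  have hG := measurableSet_bulk hm θ
  set μ := bulkMeasure θ s p with hμ
  set g : E d → ℝ := fun z => (law q).real (ballAt s p z) - (law p).real (ballAt s p z) with hg
  have hgm : Measurable g :=
    (measurable_real_family (law q) hb).sub (measurable_real_family (law p) hb)
  have hgabs : ∀ z, |g z| ≤ 1 := fun z => by
    have h1 : 0 ≤ (law q).real (ballAt s p z) := measureReal_nonneg
    have h2 : (law q).real (ballAt s p z) ≤ 1 := measureReal_le_one
    have h3 : 0 ≤ (law p).real (ballAt s p z) := measureReal_nonneg
    have h4 : (law p).real (ballAt s p z) ≤ 1 := measureReal_le_one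
    rw [abs_le]; constructor <;> simp only [hg] <;> linarith
  have hr4 := integrable_ratio_pow_four hp hs hu
  have hgr : Integrable (fun z => |g z| * ratio p z ^ 2) μ := by
    refine Integrable.mono' (hr4.div_const (θ ^ 2))
      (hgm.abs.mul ((measurable_ratio hm).pow_const 2)).aestronglyMeasurable ?_
    filter_upwards [ae_mem_bulk hm] with z hz
    have hr := le_ratio hz
    have hr0 := ratio_pos hz
    rw [Real.norm_of_nonneg (by positivity), le_div_iff₀ (by positivity)]
    calc |g z| * ratio p z ^ 2 * θ ^ 2 ≤ 1 * ratio p z ^ 2 * ratio p z ^ 2 := by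
          gcongr
          exact hgabs z
      _ = _ := by ring
  have hg2 : Integrable (fun z => g z ^ 2) μ := integrable_of_abs_le (hgm.pow_const 2) (K := 1)
    fun z => by rw [abs_pow]; exact pow_le_one₀ (abs_nonneg _) (hgabs z)
  have hXeq : ∫ z, |g z| * ratio p z ^ 2 ∂μ = ∫ z in bulk θ p, |g z| / bandwidth s p z ^ d := by
    rw [hμ, integral_bulkMeasure hm hp.1 hs]
    refine setIntegral_congr_fun hG fun z hz => ?_
    have hr := ratio_pos hz
    have hh := bandwidth_pos hs hz
    simp only [ballWeight]
    field_simp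
  have hXi : IntegrableOn (fun z => |g z| / bandwidth s p z ^ d) (bulk θ p) := by
    have := (integrable_bulkMeasure_iff hm hp.1 hs _).1 hgr
    refine this.congr_fun (fun z hz => ?_) hG
    have hr := ratio_pos hz
    have hh := bandwidth_pos hs hz
    simp only [ballWeight]
    field_simp
  set X := ∫ z, |g z| * ratio p z ^ 2 ∂μ with hX
  set J := ∫ z in bulk θ p, p z ^ gam d with hJ
  -- integrate the pointwise bound over the bulk
  have h1 : unitVol d * Y ≤ X := by
    have hbi : IntegrableOn (fun z => 2 * L * unitVol d * bandwidth s p z) (bulk θ p) := by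
      unfold bandwidth
      exact (hu.const_mul s).const_mul _
    have hdi : IntegrableOn (fun z => unitVol d * |q z - p z|) (bulk θ p) :=
      (((integrable_of_mem hq).sub (integrable_of_mem hp)).abs.const_mul _).integrableOn
    have h2 := setIntegral_mono_on hdi (hXi.add hbi) hG fun z hz =>
      unitVol_mul_abs_sub_le hL hp hq hs hz
    have h3 := integral_add hXi hbi
    have h4 : ∫ z in bulk θ p, 2 * L * unitVol d * bandwidth s p z =
        2 * L * unitVol d * (s * J) := by
      unfold bandwidth
      rw [integral_const_mul, integral_const_mul]
    simp only [Pi.add_apply] at h2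
    rw [h3, h4, ← hXeq, integral_const_mul] at h2
    have h5 := mul_le_mul_of_nonneg_left hYle hω.le
    linarith
  have hXpos : 0 < X := lt_of_lt_of_le (by positivity) h1
  -- Cauchy-Schwarz
  set S := ∫ z, g z ^ 2 ∂μ with hS
  set K := J / s ^ d with hK
  have hr4eq : ∫ z, ratio p z ^ 4 ∂μ = K := integral_ratio_pow_four hp hs
  have hCS : ∀ t : ℝ, 2 * t * X ≤ S + t ^ 2 * K := by
    intro t
    have h6 : ∀ z, 2 * t * (|g z| * ratio p z ^ 2) ≤ g z ^ 2 + t ^ 2 * ratio p z ^ 4 := fun z => by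
      have := sq_nonneg (|g z| - t * ratio p z ^ 2)
      have h7 : |g z| ^ 2 = g z ^ 2 := sq_abs _
      nlinarith
    have h8 := integral_mono (hgr.const_mul (2 * t)) (hg2.add (hr4.const_mul (t ^ 2))) h6
    have h9 := integral_add hg2 (hr4.const_mul (t ^ 2))
    simp only [Pi.add_apply] at h8
    rw [h9, integral_const_mul, integral_const_mul, hr4eq] at h8
    exact h8
  have hKnn : 0 ≤ K := hr4eq ▸ integral_nonneg fun z => by positivity
  have hSnn : 0 ≤ S := integral_nonneg fun z => sq_nonneg _
  have hKpos : 0 < K := by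
    by_contra h
    have hK0 : K = 0 := le_antisymm (not_lt.1 h) hKnn
    have := hCS ((S + 1) / X)
    rw [hK0] at this
    have e : 2 * ((S + 1) / X) * X = 2 * (S + 1) := by field_simp
    linarith
  have h10 := hCS (X / K)
  have e1 : 2 * (X / K) * X = 2 * (X ^ 2 / K) := by ring
  have e2 : (X / K) ^ 2 * K = X ^ 2 / K := by field_simp
  rw [e1, e2] at h10
  have h11 : X ^ 2 / K ≤ S := by linarith
  rw [div_le_iff₀ hKpos] at h11
  calc (unitVol d * Y) ^ 2 ≤ X ^ 2 := pow_le_pow_left₀ (by positivity) h1 2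
    _ ≤ K * S := by linarith

/-- The balls cannot be too heavy: since every ball has mass at most one, the ratio is bounded by a
multiple of `s ^ (-d / 3)`, while `p` is the product of the ratio and of `p ^ γ`. -/
lemma pow_le_of_half_le (hL : 0 < L) (hp : p ∈ lipBall d L) (hs : 0 < s) (hsL : L * s ≤ θ / 4)
    (hu : IntegrableOn (fun x => p x ^ gam d) (bulk θ p))
    (hhalf : 1 / 2 ≤ (law p).real (bulk θ p)) :
    s ^ d ≤ 128 / unitVol d * (∫ z in bulk θ p, p z ^ gam d) ^ 3 := by
  have hm := (continuous_of_mem hp).measurable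
  have hpr := isProbabilityMeasure_law hp
  have hω := unitVol_pos d
  have hG := measurableSet_bulk hm θ
  set J := ∫ z in bulk θ p, p z ^ gam d with hJ
  rw [law_real_apply hp hG] at hhalf
  have key : ∀ R : ℝ, (∀ z ∈ bulk θ p, ratio p z ≤ R) → 1 / 2 ≤ R * J := by
    intro R hR
    refine hhalf.trans ?_
    rw [hJ, ← integral_const_mul]
    refine setIntegral_mono_on (integrable_of_mem hp).integrableOn (hu.const_mul R) hG
      fun z hz => ?_
    have h0 := rpow_pos_of_mem_bulk hz
    calc p z = ratio p z * p z ^ gam d := (ratio_mul hz).symm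
      _ ≤ _ := by gcongr; exact hR z hz
  have hJ0 : 0 ≤ J := setIntegral_nonneg hG fun z hz => (rpow_pos_of_mem_bulk hz).le
  have hJpos : 0 < J := by
    rcases hJ0.eq_or_lt with h | h
    · exfalso
      have h0 : 1 / 2 ≤ (2 / (unitVol d * s ^ d) + 1) * J := key _ fun z hz => by
        have h1 := (le_law_ballAt hL hp hs hsL hz).trans measureReal_le_one
        have hr := ratio_pos hz
        have h2 : ratio p z ^ 3 ≤ 2 / (unitVol d * s ^ d) := by
          rw [le_div_iff₀ (by positivity)]; linarith
        rcases le_total (ratio p z) 1 with h3 | h3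
        · have : 0 ≤ 2 / (unitVol d * s ^ d) := by positivity
          linarith
        · have : ratio p z ≤ ratio p z ^ 3 := le_self_pow₀ h3 (by norm_num)
          linarith
      rw [← h] at h0
      norm_num at h0
    · exact h
  by_contra! hcon
  have h1 : 1 / 2 ≤ 1 / (4 * J) * J := key _ fun z hz => by
    have h1 := (le_law_ballAt hL hp hs hsL hz).trans measureReal_le_one
    have hr := ratio_pos hz
    refine le_of_pow_le_pow_left₀ (n := 3) (by norm_num) (by positivity) ?_
    rw [div_pow, one_pow, le_div_iff₀ (by positivity)]
    have h2 : unitVol d / 2 * (128 / unitVol d * J ^ 3 * ratio p z ^ 3) ≤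
        unitVol d / 2 * (s ^ d * ratio p z ^ 3) := by gcongr
    have h3 : unitVol d / 2 * (128 / unitVol d * J ^ 3 * ratio p z ^ 3) =
        ratio p z ^ 3 * (4 * J) ^ 3 := by field_simp; ring
    linarith
  have h2 : 1 / (4 * J) * J = 1 / 4 := by field_simp
  rw [h2] at h1
  norm_num at h1

end Separation

/-- The bulk at the level `θ = w / I` carries all but `3 w` of the mass and at most three times the
truncated functional. -/
lemma bulk_spec {L : ℝ} {p : E d → ℝ} (hp : p ∈ lipBall d L) {w I : ℝ} (hw : 0 < w) (hI : 0 < I)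
    {B : Set (E d)} (hB : MeasurableSet B) (hBp : 1 - w ≤ (law p).real B)
    (hBI : ∫⁻ x in B, ENNReal.ofReal (p x ^ gam d) ≤ ENNReal.ofReal (2 * I)) :
    (law p).real (bulk (w / I) p)ᶜ ≤ 3 * w ∧
      IntegrableOn (fun x => p x ^ gam d) (bulk (w / I) p) ∧
      ∫ x in bulk (w / I) p, p x ^ gam d ≤ 3 * I := by
  have hm := (continuous_of_mem hp).measurable
  have hpr := isProbabilityMeasure_law hp
  set θ := w / I with hθ
  have hθ0 : 0 < θ := by positivity
  have hG := measurableSet_bulk hm θ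
  have hBc : (law p).real Bᶜ ≤ w := by
    rw [probReal_compl_eq_one_sub hB]; linarith
  constructor
  · have h1 : (law p).real ((bulk θ p)ᶜ ∩ B) ≤ 2 * w := by
      refine ENNReal.toReal_le_of_le_ofReal (by positivity) ?_
      rw [law_apply p (hG.compl.inter hB)]
      calc ∫⁻ x in (bulk θ p)ᶜ ∩ B, ENNReal.ofReal (p x)
          ≤ ∫⁻ x in (bulk θ p)ᶜ ∩ B, ENNReal.ofReal θ * ENNReal.ofReal (p x ^ gam d) := by
            refine setLIntegral_mono' (hG.compl.inter hB) fun x hx => ?_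
            rw [← ENNReal.ofReal_mul hθ0.le]
            refine ENNReal.ofReal_le_ofReal ?_
            have hx1 : ¬ (θ * p x ^ gam d ≤ p x ∧ 0 < p x) := hx.1
            rcases (hp.1 x).eq_or_lt with h | h
            · rw [← h]
              exact mul_nonneg hθ0.le (Real.rpow_nonneg le_rfl _)
            · by_contra! hcon
              exact hx1 ⟨hcon.le, h⟩
        _ = ENNReal.ofReal θ * ∫⁻ x in (bulk θ p)ᶜ ∩ B, ENNReal.ofReal (p x ^ gam d) :=
            lintegral_const_mul' _ _ ENNReal.ofReal_ne_top
        _ ≤ ENNReal.ofReal θ * ENNReal.ofReal (2 * I) := by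
            gcongr
            exact (lintegral_mono_set inter_subset_right).trans hBI
        _ = ENNReal.ofReal (2 * w) := by
            rw [← ENNReal.ofReal_mul hθ0.le, hθ]; congr 1; field_simp
    have h2 : (bulk θ p)ᶜ ⊆ ((bulk θ p)ᶜ ∩ B) ∪ Bᶜ := fun x hx => by
      by_cases hxB : x ∈ B
      · exact Or.inl ⟨hx, hxB⟩
      · exact Or.inr hxB
    have h3 := (measureReal_mono (μ := law p) h2).trans (measureReal_union_le _ _)
    linarith
  · have h1 : ∫⁻ x in bulk θ p, ENNReal.ofReal (p x ^ gam d) ≤ ENNReal.ofReal (3 * I) := by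
      rw [← lintegral_inter_add_sdiff _ (bulk θ p) hB]
      have h2 : ∫⁻ x in bulk θ p ∩ B, ENNReal.ofReal (p x ^ gam d) ≤ ENNReal.ofReal (2 * I) :=
        (lintegral_mono_set inter_subset_right).trans hBI
      have h3 : ∫⁻ x in bulk θ p \ B, ENNReal.ofReal (p x ^ gam d) ≤ ENNReal.ofReal I := by
        calc ∫⁻ x in bulk θ p \ B, ENNReal.ofReal (p x ^ gam d)
            ≤ ∫⁻ x in bulk θ p \ B, ENNReal.ofReal θ⁻¹ * ENNReal.ofReal (p x) := by
              refine setLIntegral_mono' (hG.diff hB) fun x hx => ?_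
              rw [← ENNReal.ofReal_mul (by positivity)]
              refine ENNReal.ofReal_le_ofReal ?_
              rw [inv_mul_eq_div, le_div_iff₀ hθ0, mul_comm]
              exact hx.1.1
          _ = ENNReal.ofReal θ⁻¹ * law p (bulk θ p \ B) := by
              rw [lintegral_const_mul' _ _ ENNReal.ofReal_ne_top, law_apply p (hG.diff hB)]
          _ ≤ ENNReal.ofReal θ⁻¹ * ENNReal.ofReal w := by
              gcongr
              rw [← ofReal_measureReal]
              exact ENNReal.ofReal_le_ofReal
                ((measureReal_mono fun x hx => hx.2).trans hBc)
          _ = ENNReal.ofReal I := by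
              rw [← ENNReal.ofReal_mul (by positivity), hθ]; congr 1; field_simp
      calc _ ≤ ENNReal.ofReal (2 * I) + ENNReal.ofReal I := add_le_add h2 h3
        _ = _ := by rw [← ENNReal.ofReal_add (by positivity) hI.le]; congr 1; ring
    have hum : Measurable fun x => p x ^ gam d := by fun_prop
    have hnn : ∀ x, 0 ≤ p x ^ gam d := fun x => Real.rpow_nonneg (hp.1 x) _
    refine ⟨⟨hum.aestronglyMeasurable, ?_⟩, ?_⟩
    · rw [hasFiniteIntegral_iff_ofReal (Eventually.of_forall hnn)]
      exact h1.trans_lt ENNReal.ofReal_lt_top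
    · rw [integral_eq_lintegral_of_nonneg_ae (Eventually.of_forall hnn) hum.aestronglyMeasurable]
      exact ENNReal.toReal_le_of_le_ofReal (by positivity) h1

/-! ### The `ℓ₁` distance of densities -/

section Distance

variable {L : ℝ} {p q : E d → ℝ}

lemma l1Dist_eq (hp : p ∈ lipBall d L) (hq : q ∈ lipBall d L) :
    l1Dist q p = ENNReal.ofReal (∫ x, |q x - p x|) :=
  (ofReal_integral_eq_lintegral_ofReal ((integrable_of_mem hq).sub (integrable_of_mem hp)).abs
    (Eventually.of_forall fun _ => abs_nonneg _)).symm

lemma setIntegral_abs_sub_le (hp : p ∈ lipBall d L) (hq : q ∈ lipBall d L) {D : Set (E d)}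
    (hD : MeasurableSet D) :
    ∫ x in D, |q x - p x| ≤ (law q).real D + (law p).real D := by
  rw [law_real_apply hp hD, law_real_apply hq hD,
    ← integral_add (integrable_of_mem hq).integrableOn (integrable_of_mem hp).integrableOn]
  refine integral_mono ((integrable_of_mem hq).sub (integrable_of_mem hp)).abs.integrableOn
    ((integrable_of_mem hq).add (integrable_of_mem hp)).integrableOn fun x => ?_
  have h1 := hp.1 x
  have h2 := hq.1 x
  simp only [abs_le]
  constructor <;> linarith

lemma integral_abs_sub_le_two (hp : p ∈ lipBall d L) (hq : q ∈ lipBall d L) :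
    ∫ x, |q x - p x| ≤ 2 := by
  have h1 := isProbabilityMeasure_law hp
  have h2 := isProbabilityMeasure_law hq
  have h := setIntegral_abs_sub_le hp hq MeasurableSet.univ
  simp only [probReal_univ, setIntegral_univ] at h
  linarith

/-- There are no alternatives at distance more than two. -/
lemma minimaxRisk_le_of_two_lt {α : ℝ} (n : ℕ) (hp : p ∈ lipBall d L) {r : ℝ} (hr : 2 < r) :
    minimaxRisk n α p (ENNReal.ofReal r) (lipBall d L) ≤ 1 / 2 := by
  have h0 : (fun _ => false : (Fin n → E d) → Bool) ∈ levelTests n α p :=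
    ⟨measurable_const, by simp⟩
  refine (iInf₂_le _ h0).trans (iSup₂_le fun q hq => ?_)
  exfalso
  have h1 := hq.2
  rw [l1Dist_eq hp hq.1, ENNReal.ofReal_le_ofReal_iff (integral_nonneg fun _ => abs_nonneg _)] at h1
  linarith [integral_abs_sub_le_two hp hq.1]

end Distance

/-! ### The test -/

/-- The test that rejects if too many observations fall outside the bulk, or if the quadratic
statistic over the balls inside the bulk is too large. -/
noncomputable def bulkTest {n : ℕ} (θ s : ℝ) (p : E d → ℝ) (S T : Finset (Fin n)) (τ₁ τ : ℝ)
    (x : Fin n → E d) : Bool :=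
  open Classical in
  decide (τ₁ ≤ count (bulk θ p)ᶜ x ∨
    τ ≤ pairStat (bulkMeasure θ s p)
      (centredInd (ballAt s p) fun z => (law p).real (ballAt s p z)) S T x)

section Test

variable {L θ s : ℝ} {p q : E d → ℝ} {n m : ℕ} {S T : Finset (Fin n)} {τ₁ τ : ℝ}

lemma measurable_bulkTest (hp : p ∈ lipBall d L) (hs : 0 < s) (hθ : 0 < θ)
    (hu : IntegrableOn (fun x => p x ^ gam d) (bulk θ p)) :
    Measurable (bulkTest θ s p S T τ₁ τ) := by
  have hm := (continuous_of_mem hp).measurable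
  have hpr := isProbabilityMeasure_law hp
  have hfin := isFiniteMeasure_bulkMeasure hp hs hθ hu
  have hb := measurableSet_ballAt hm s
  refine measurable_to_bool ?_
  have e : bulkTest θ s p S T τ₁ τ ⁻¹' {true} = {x | τ₁ ≤ count (bulk θ p)ᶜ x} ∪
      {x | τ ≤ pairStat (bulkMeasure θ s p)
        (centredInd (ballAt s p) fun z => (law p).real (ballAt s p z)) S T x} := by
    ext x; simp [bulkTest]
  rw [e]
  exact (measurableSet_le measurable_const (measurable_count (measurableSet_bulk hm θ).compl)).union
    (measurableSet_le measurable_const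
      (measurable_pairStat _ (measurable_centredInd hb (measurable_real_family _ hb)) S T))

lemma bulkTest_mem_levelTests {α V : ℝ} (hp : p ∈ lipBall d L) (hs : 0 < s) (hθ : 0 < θ)
    (hu : IntegrableOn (fun x => p x ^ gam d) (bulk θ p)) (hST : Disjoint S T)
    (hS : S.card = m) (hT : T.card = m) (hτ₁ : 0 < τ₁) (hτ : 0 < τ)
    (h₁ : n * (law p).real (bulk θ p)ᶜ / τ₁ ≤ α / 2)
    (hV : ∫ zz : E d × E d, (law p).real (ballAt s p zz.1 ∩ ballAt s p zz.2) ^ 2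
        ∂((bulkMeasure θ s p).prod (bulkMeasure θ s p)) ≤ V)
    (h₂ : 2 * (m : ℝ) ^ 2 * V / τ ^ 2 ≤ α / 2) :
    bulkTest θ s p S T τ₁ τ ∈ levelTests n α p := by
  have hm := (continuous_of_mem hp).measurable
  have hpr := isProbabilityMeasure_law hp
  have hfin := isFiniteMeasure_bulkMeasure hp hs hθ hu
  have hb := measurableSet_ballAt hm s
  refine ⟨measurable_bulkTest hp hs hθ hu, ?_⟩
  have e : {x | bulkTest θ s p S T τ₁ τ x = true} = {x | τ₁ ≤ count (bulk θ p)ᶜ x} ∪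
      {x | τ ≤ pairStat (bulkMeasure θ s p)
        (centredInd (ballAt s p) fun z => (law p).real (ballAt s p z)) S T x} := by
    ext x; simp [bulkTest]
  have hpi : IsProbabilityMeasure (sampleLaw n p) := by unfold sampleLaw; infer_instance
  rw [← ofReal_measureReal]
  refine ENNReal.ofReal_le_ofReal ?_
  rw [e]
  refine (measureReal_union_le _ _).trans ?_
  have a1 := count_null_le (n := n) (law p) (measurableSet_bulk hm θ).compl hτ₁
  have a2 := pairStat_null_le (law p) (bulkMeasure θ s p) hb hST hS hT hτ
  have a3 : 2 * (m : ℝ) ^ 2 * (∫ zz : E d × E d,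
      (law p).real (ballAt s p zz.1 ∩ ballAt s p zz.2) ^ 2
        ∂((bulkMeasure θ s p).prod (bulkMeasure θ s p))) / τ ^ 2 ≤ 2 * (m : ℝ) ^ 2 * V / τ ^ 2 := by
    gcongr
  unfold sampleLaw
  linarith

/-- Many observations outside the bulk lead to a rejection. -/
lemma bulkTest_false_le_of_count (hp : p ∈ lipBall d L) (hq : q ∈ lipBall d L)
    (h8 : 8 ≤ n * (law q).real (bulk θ p)ᶜ) (hc : 2 * τ₁ ≤ n * (law q).real (bulk θ p)ᶜ) :
    sampleLaw n q {x | bulkTest θ s p S T τ₁ τ x = false} ≤ 1 / 2 := by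
  have hm := (continuous_of_mem hp).measurable
  have hqr := isProbabilityMeasure_law hq
  have h := count_alt_le (n := n) (law q) (measurableSet_bulk hm θ).compl (by linarith) hc
  have hpi : IsProbabilityMeasure (sampleLaw n q) := by unfold sampleLaw; infer_instance
  have h2 : (sampleLaw n q).real {x | bulkTest θ s p S T τ₁ τ x = false} ≤ 1 / 2 := by
    refine (measureReal_mono (fun x hx => ?_)).trans (h.trans ?_)
    · have hx' : bulkTest θ s p S T τ₁ τ x = false := hx
      simp only [bulkTest, decide_eq_false_iff_not, not_or, not_le] at hx'
      exact hx'.1.le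
    · rw [div_le_iff₀ (by linarith)]
      linarith
  rw [← ofReal_measureReal]
  refine (ENNReal.ofReal_le_ofReal h2).trans_eq ?_
  rw [ENNReal.ofReal_div_of_pos two_pos]; simp

/-- A large mean of the quadratic statistic leads to a rejection. -/
lemma bulkTest_false_le_of_pairStat (hp : p ∈ lipBall d L) (hq : q ∈ lipBall d L) (hs : 0 < s)
    (hθ : 0 < θ) (hu : IntegrableOn (fun x => p x ^ gam d) (bulk θ p)) (hST : Disjoint S T)
    (hS : S.card = m) (hT : T.card = m) (hm0 : 0 < m) {D : ℝ} (hD : 0 < D)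
    (hDS : D = ∫ z, ((law q).real (ballAt s p z) - (law p).real (ballAt s p z)) ^ 2
      ∂(bulkMeasure θ s p)) (hτ : τ ≤ (m : ℝ) ^ 2 * D / 2)
    (hV : 132 * (∫ zz : E d × E d, (law q).real (ballAt s p zz.1 ∩ ballAt s p zz.2) ^ 2
        ∂((bulkMeasure θ s p).prod (bulkMeasure θ s p))) / ((m : ℝ) * D) ^ 2 ≤ 1 / 8) :
    sampleLaw n q {x | bulkTest θ s p S T τ₁ τ x = false} ≤ 1 / 2 := by
  have hm := (continuous_of_mem hp).measurable
  have hpr := isProbabilityMeasure_law hp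
  have hqr := isProbabilityMeasure_law hq
  have hfin := isFiniteMeasure_bulkMeasure hp hs hθ hu
  have hb := measurableSet_ballAt hm s
  have h := pairStat_alt_le (law q) (bulkMeasure θ s p) hb
    (p := fun z => (law p).real (ballAt s p z)) (measurable_real_family (law p) hb)
    (fun _ => measureReal_nonneg) (fun _ => measureReal_le_one) hST hS hT hm0 hD hDS
  have hpi : IsProbabilityMeasure (sampleLaw n q) := by unfold sampleLaw; infer_instance
  have h2 : (sampleLaw n q).real {x | bulkTest θ s p S T τ₁ τ x = false} ≤ 1 / 2 := by
    refine (measureReal_mono (fun x hx => ?_)).trans (h.trans ?_)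
    · have hx' : bulkTest θ s p S T τ₁ τ x = false := hx
      simp only [bulkTest, decide_eq_false_iff_not, not_or, not_le] at hx'
      exact hx'.2.le.trans hτ
    · linarith
  rw [← ofReal_measureReal]
  refine (ENNReal.ofReal_le_ofReal h2).trans_eq ?_
  rw [ENNReal.ofReal_div_of_pos two_pos]; simp

end Test

/-! ### The upper bound -/

/-- The arithmetic of the second-moment method. Here `X = s ^ d`, `V` is the Hilbert-Schmidt norm
under the alternative, and the left side of the second conclusion is the square of the null
threshold. The separation makes the mean `m² D` of the quadratic statistic at least
`(ω² δ / 432) C² / θ²`, so that for large `C` it exceeds twice the threshold and dominates the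
standard deviation under the alternative. The constants are `432 = 9 * 48`,
`18432 = 16 * 24 * 48` and `1218624 = 8 * 132 * (24 * 48 + 2)`. -/
lemma standard_deviation_bounds {ω δ K θ w X m n C D V α : ℝ} (hω : 0 < ω) (hδ : 0 < δ)
    (hK : 0 < K) (hθ : 0 < θ) (hw : 0 < w) (hX : 0 < X) (hm : 0 < m) (hn : 0 < n) (hα : 0 < α)
    (hkey : n ^ 2 * X * θ ^ 3 * w = δ) (hmn : n ≤ 3 * m) (hC : 1 ≤ C)
    (hsep : (ω * (C * w / 4)) ^ 2 ≤ 3 * w / θ / X * D)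
    (hV : V ≤ K * (24 * ω ^ 2 * (X * w / θ) + 2 * D / θ ^ 2))
    (hC₁ : 1218624 * K / (ω ^ 2 * δ / 432) ≤ C)
    (hC₂ : 18432 * K / (α * (ω ^ 2 * δ / 432)) ≤ C) :
    0 < D ∧ 4 * m ^ 2 * (24 * K * ω ^ 2 * (X * w / θ)) / α ≤ (m ^ 2 * D / 2) ^ 2 ∧
      132 * V / (m * D) ^ 2 ≤ 1 / 8 := by
  have hCC : C ≤ C ^ 2 := by nlinarith
  have hC0 : 0 < C := by linarith
  have hD : ω ^ 2 * C ^ 2 / 48 * (w * θ * X) ≤ D := by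
    calc ω ^ 2 * C ^ 2 / 48 * (w * θ * X)
        = (ω * (C * w / 4)) ^ 2 * (θ * X / (3 * w)) := by field_simp; ring
      _ ≤ 3 * w / θ / X * D * (θ * X / (3 * w)) := by gcongr
      _ = D := by field_simp
  have hDpos : 0 < D := lt_of_lt_of_le (by positivity) hD
  refine ⟨hDpos, ?_⟩
  set k := ω ^ 2 * δ / 432 with hk
  have hk0 : 0 < k := by positivity
  have hmean : k * C ^ 2 ≤ m ^ 2 * D * θ ^ 2 := by
    calc k * C ^ 2 = n ^ 2 / 9 * (ω ^ 2 * C ^ 2 / 48 * (w * θ * X)) * θ ^ 2 := by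
          rw [hk, ← hkey]; ring
      _ ≤ m ^ 2 * D * θ ^ 2 := by
          gcongr
          nlinarith
  have hW : ω ^ 2 * (X * w / θ) ≤ 48 * D / θ ^ 2 := by
    rw [le_div_iff₀ (by positivity)]
    have e : ω ^ 2 * (X * w / θ) * θ ^ 2 = ω ^ 2 * (w * θ * X) := by field_simp
    rw [e]
    have : ω ^ 2 * 1 / 48 * (w * θ * X) ≤ ω ^ 2 * C ^ 2 / 48 * (w * θ * X) := by
      gcongr; nlinarith
    linarith
  have b1 : 1218624 * K ≤ m ^ 2 * D * θ ^ 2 := by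
    rw [div_le_iff₀ hk0] at hC₁
    nlinarith
  have b2 : 18432 * K / α ≤ m ^ 2 * D * θ ^ 2 := by
    rw [div_le_iff₀ (by positivity)] at hC₂
    rw [div_le_iff₀ hα]
    nlinarith
  constructor
  · calc 4 * m ^ 2 * (24 * K * ω ^ 2 * (X * w / θ)) / α
        = m ^ 2 * (96 * K / α) * (ω ^ 2 * (X * w / θ)) := by ring
      _ ≤ m ^ 2 * (96 * K / α) * (48 * D / θ ^ 2) := by gcongr
      _ = m ^ 2 * D / (4 * θ ^ 2) * (18432 * K / α) := by field_simp; ring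
      _ ≤ m ^ 2 * D / (4 * θ ^ 2) * (m ^ 2 * D * θ ^ 2) := by gcongr
      _ = _ := by field_simp; ring
  · rw [div_le_iff₀ (by positivity)]
    calc 132 * V ≤ 132 * (K * (24 * (48 * D / θ ^ 2) + 2 * D / θ ^ 2)) := by
          gcongr
          refine hV.trans ?_
          rw [mul_assoc 24]
          gcongr
      _ = D / (8 * θ ^ 2) * (1218624 * K) := by field_simp; ring
      _ ≤ D / (8 * θ ^ 2) * (m ^ 2 * D * θ ^ 2) := by gcongr
      _ = _ := by field_simp

/-- The critical separation is at least of the order `n ^ (-1/2)`, since the bandwidth is bounded by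
`pow_le_of_half_le`. -/
lemma le_mul_sq_of_half_le {L θ s w δ : ℝ} {n : ℕ} {p : E d → ℝ} (hL : 0 < L)
    (hp : p ∈ lipBall d L) (hθ : 0 < θ) (hs : 0 < s) (hsL : L * s ≤ θ / 4) (hw : 0 < w)
    (hu : IntegrableOn (fun x => p x ^ gam d) (bulk θ p))
    (hJ : ∫ z in bulk θ p, p z ^ gam d ≤ 3 * w / θ)
    (hhalf : 1 / 2 ≤ (law p).real (bulk θ p)) (hkey : (n : ℝ) ^ 2 * s ^ d * θ ^ 3 * w = δ) :
    Real.sqrt (unitVol d * δ / 3456) ≤ n * w ^ 2 := by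
  have hω := unitVol_pos d
  have h := pow_le_of_half_le hL hp hs hsL hu hhalf
  have hJ0 : 0 ≤ ∫ z in bulk θ p, p z ^ gam d :=
    integral_nonneg fun x => Real.rpow_nonneg (hp.1 x) _
  refine Real.sqrt_le_iff.2 ⟨by positivity, ?_⟩
  rw [← hkey]
  calc unitVol d * ((n : ℝ) ^ 2 * s ^ d * θ ^ 3 * w) / 3456
      ≤ unitVol d * ((n : ℝ) ^ 2 * (128 / unitVol d * (3 * w / θ) ^ 3) * θ ^ 3 * w) / 3456 := by
        gcongr
        exact h.trans (by gcongr)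
    _ = _ := by field_simp; ring

/-- The bound `integral_inter_sq_le` when the bulk is that of the critical separation `w`. -/
lemma integral_ballAt_inter_sq_le {L θ s w : ℝ} {p q : E d → ℝ} (hL : 0 < L)
    (hp : p ∈ lipBall d L) (hq : q ∈ lipBall d L) (hs : 0 < s) (hθ : 0 < θ) (hsL : L * s ≤ θ / 4)
    (hu : IntegrableOn (fun x => p x ^ gam d) (bulk θ p))
    (hJ : ∫ z in bulk θ p, p z ^ gam d ≤ 3 * w / θ) :
    ∫ zz : E d × E d, (law q).real (ballAt s p zz.1 ∩ ballAt s p zz.2) ^ 2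
        ∂((bulkMeasure θ s p).prod (bulkMeasure θ s p)) ≤
      2 ^ (2 * d + 1) * 3 ^ d * unitVol d * (24 * unitVol d ^ 2 * (s ^ d * w / θ) +
        2 * (∫ z, ((law q).real (ballAt s p z) - (law p).real (ballAt s p z)) ^ 2
          ∂(bulkMeasure θ s p)) / θ ^ 2) := by
  have hω := unitVol_pos d
  have hqr := isProbabilityMeasure_law hq
  refine (integral_inter_sq_le hL hp hs hθ hsL hu (law q)).trans ?_
  gcongr _ * (?_ + ?_)
  · calc 8 * unitVol d ^ 2 * s ^ d * (∫ z in bulk θ p, p z ^ gam d)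
        ≤ 8 * unitVol d ^ 2 * s ^ d * (3 * w / θ) := by gcongr
      _ = _ := by ring
  · exact le_of_eq (by ring)

/-- An alternative that differs from the null inside the bulk is detected by the quadratic
statistic. -/
lemma bulkTest_false_le_of_separation {α L θ s w δ C : ℝ} {n m : ℕ} {S T : Finset (Fin n)}
    {p q : E d → ℝ} {τ₁ : ℝ} (hα : 0 < α) (hL : 0 < L) (hp : p ∈ lipBall d L)
    (hq : q ∈ lipBall d L) (hθ : 0 < θ) (hs : 0 < s) (hLs : L * s = θ / 4) (hw : 0 < w)
    (hu : IntegrableOn (fun x => p x ^ gam d) (bulk θ p))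
    (hJ : ∫ z in bulk θ p, p z ^ gam d ≤ 3 * w / θ) (hδ : 0 < δ)
    (hkey : (n : ℝ) ^ 2 * s ^ d * θ ^ 3 * w = δ) (hST : Disjoint S T) (hS : S.card = m)
    (hT : T.card = m) (hm : 0 < m) (hn : (0 : ℝ) < n) (hmn : (n : ℝ) ≤ 3 * m) (hC : 12 ≤ C)
    (hC₁ : 1218624 * (2 ^ (2 * d + 1) * 3 ^ d * unitVol d) / (unitVol d ^ 2 * δ / 432) ≤ C)
    (hC₂ : 18432 * (2 ^ (2 * d + 1) * 3 ^ d * unitVol d) / (α * (unitVol d ^ 2 * δ / 432)) ≤ C)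
    (hsep : C * w / 2 ≤ ∫ x in bulk θ p, |q x - p x|) :
    sampleLaw n q {x | bulkTest θ s p S T τ₁ (Real.sqrt (4 * m ^ 2 *
      (24 * (2 ^ (2 * d + 1) * 3 ^ d * unitVol d) * unitVol d ^ 2 * (s ^ d * w / θ)) / α)) x =
        false} ≤ 1 / 2 := by
  have hω := unitVol_pos d
  have hX : 0 < s ^ d := by positivity
  -- the discretization bias is at most `3 w / 2`
  have hbias : 2 * L * s * (∫ z in bulk θ p, p z ^ gam d) ≤ 3 * w / 2 := by
    calc 2 * L * s * (∫ z in bulk θ p, p z ^ gam d) ≤ 2 * L * s * (3 * w / θ) := by gcongr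
      _ = 2 * (L * s) * (3 * w / θ) := by ring
      _ = 2 * (θ / 4) * (3 * w / θ) := by rw [hLs]
      _ = _ := by field_simp; ring
  have hCw : 6 * w ≤ C * w := by gcongr; linarith
  have hC0 : 0 < C := by linarith
  have hY := sq_separation_le hL hp hq hs hθ hu (Y := C * w / 4) (by positivity) (by linarith)
  have hHS := integral_ballAt_inter_sq_le hL hp hq hs hθ hLs.le hu hJ
  obtain ⟨D, hD⟩ : ∃ D, D = ∫ z, ((law q).real (ballAt s p z) - (law p).real (ballAt s p z)) ^ 2
    ∂(bulkMeasure θ s p) := ⟨_, rfl⟩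
  have hD0 : 0 ≤ D := hD ▸ integral_nonneg fun _ => sq_nonneg _
  rw [← hD] at hY hHS
  have hY' : (unitVol d * (C * w / 4)) ^ 2 ≤ 3 * w / θ / s ^ d * D := hY.trans (by gcongr)
  obtain ⟨hDpos, hb1, hb2⟩ := standard_deviation_bounds hω hδ (by positivity) hθ hw hX
    (Nat.cast_pos.2 hm) hn hα hkey hmn (by linarith) hY' hHS hC₁ hC₂
  refine bulkTest_false_le_of_pairStat hp hq hs hθ hu hST hS hT hm hDpos hD ?_ hb2
  exact Real.sqrt_le_iff.2 ⟨by positivity, hb1⟩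

/-- At a separation that is a large multiple of the critical one, the test `bulkTest` has type II
error at most `1 / 2`. -/
theorem upper_bound [Nonempty (Fin d)] {α : ℝ} (hα : 0 < α) :
    ∃ C : ℝ, 0 < C ∧ ∀ (n : ℕ) (L : ℝ) (p : E d → ℝ), 1 ≤ n → 0 < L → p ∈ lipBall d L →
      ∀ w : ℝ, SolvesCriticalEq n L 1 p w →
        criticalRadius n α p (lipBall d L) ≤ ENNReal.ofReal (C * w) := by
  have hω := unitVol_pos d
  set δ : ℝ := (1 / 4) ^ d with hδ
  have hδ0 : 0 < δ := by positivity
  set K : ℝ := 2 ^ (2 * d + 1) * 3 ^ d * unitVol d with hK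
  have hK0 : 0 < K := by positivity
  set c₀ : ℝ := Real.sqrt (unitVol d * δ / 3456) with hc₀
  have hc₀0 : 0 < c₀ := Real.sqrt_pos.2 (by positivity)
  obtain ⟨C, hC12, hCα, hCc, hC₁, hC₂⟩ : ∃ C : ℝ, 12 ≤ C ∧ 12 + 24 / α ≤ C ∧ 32 / c₀ ≤ C ∧
      1218624 * K / (unitVol d ^ 2 * δ / 432) ≤ C ∧
      18432 * K / (α * (unitVol d ^ 2 * δ / 432)) ≤ C := by
    have z1 : 0 ≤ 24 / α := by positivity
    have z2 : 0 ≤ 32 / c₀ := by positivity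
    have z3 : 0 ≤ 1218624 * K / (unitVol d ^ 2 * δ / 432) := by positivity
    have z4 : 0 ≤ 18432 * K / (α * (unitVol d ^ 2 * δ / 432)) := by positivity
    refine ⟨12 + 24 / α + 32 / c₀ + 1218624 * K / (unitVol d ^ 2 * δ / 432) +
      18432 * K / (α * (unitVol d ^ 2 * δ / 432)), ?_, ?_, ?_, ?_, ?_⟩ <;> linarith
  have hC0 : 0 < C := by linarith
  refine ⟨C, hC0, fun n L p hn hL hp w hw => sInf_le ?_⟩
  show minimaxRisk n α p (ENNReal.ofReal (C * w)) (lipBall d L) ≤ 1 / 2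
  obtain ⟨hw0, hw1, I, hI, hkey, -, B, hB, hBp, hBI⟩ := hw.spec hn hL hp
  -- `ℓ₁` distances of densities are at most two
  rcases lt_or_ge 2 (C * w) with hbig | hsmall
  · exact minimaxRisk_le_of_two_lt n hp hbig
  have hpr := isProbabilityMeasure_law hp
  have hm := (continuous_of_mem hp).measurable
  obtain ⟨hGc, hu, hJ⟩ := bulk_spec hp hw0 hI hB hBp hBI
  set θ := w / I with hθ
  have hθ0 : 0 < θ := by positivity
  set s := θ / (4 * L) with hs
  have hs0 : 0 < s := by positivity
  have hLs : L * s = θ / 4 := by rw [hs]; field_simp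
  have hG := measurableSet_bulk hm θ
  have hJ : ∫ z in bulk θ p, p z ^ gam d ≤ 3 * w / θ := by
    refine hJ.trans_eq ?_
    rw [hθ]; field_simp
  have hkey : (n : ℝ) ^ 2 * s ^ d * θ ^ 3 * w = δ := by
    have e : (n : ℝ) ^ 2 * s ^ d * θ ^ 3 * w =
        (n : ℝ) ^ 2 * w ^ (d + 4) * δ / (L ^ d * I ^ (d + 3)) := by
      rw [hs, hθ, hδ, one_div, inv_pow]
      simp only [div_pow, mul_pow, pow_add]
      field_simp
    rw [e, hkey]; field_simp
  have hw6 : w ≤ 1 / 6 := by nlinarith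
  have hhalf : 1 / 2 ≤ (law p).real (bulk θ p) := by
    have := probReal_compl_eq_one_sub (μ := law p) hG
    linarith
  have hnw : c₀ ≤ n * w ^ 2 := le_mul_sq_of_half_le hL hp hθ0 hs0 hLs.le hw0 hu hJ hhalf hkey
  have hn0 : (0 : ℝ) < n := by exact_mod_cast hn
  have hnw1 : c₀ ≤ n * w := hnw.trans (by nlinarith [mul_pos hn0 hw0])
  have hCc : 32 ≤ C * c₀ := by rwa [div_le_iff₀ hc₀0] at hCc
  have hn2 : 2 ≤ n := by
    have h1 : c₀ * C ^ 2 ≤ n * 2 ^ 2 := by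
      calc c₀ * C ^ 2 ≤ n * w ^ 2 * C ^ 2 := by gcongr
        _ = n * (C * w) ^ 2 := by ring
        _ ≤ _ := by gcongr
    have h2 : (2 : ℝ) ≤ n := by nlinarith
    exact_mod_cast h2
  obtain ⟨m, hm0, hm2, hmn⟩ : ∃ m : ℕ, 0 < m ∧ 2 * m ≤ n ∧ n ≤ 3 * m :=
    ⟨n / 2, by omega, by omega, by omega⟩
  have hm0' : (0 : ℝ) < m := by exact_mod_cast hm0
  have hmn' : (n : ℝ) ≤ 3 * m := by exact_mod_cast hmn
  obtain ⟨S, -, hS⟩ := Finset.exists_subset_card_eq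
    (s := (Finset.univ : Finset (Fin n))) (n := m) (by simp; omega)
  obtain ⟨T, hTS, hT⟩ := Finset.exists_subset_card_eq (s := Sᶜ) (n := m)
    (by rw [Finset.card_compl, hS, Fintype.card_fin]; omega)
  have hST : Disjoint S T := (disjoint_compl_right (a := S)).mono_right hTS
  have hX : 0 < s ^ d := by positivity
  -- the thresholds make each of the two type I errors at most `α / 2`
  set τ₁ := 6 * n * w / α with hτ₁
  have hτ₁0 : 0 < τ₁ := by positivity
  set W := 24 * K * unitVol d ^ 2 * (s ^ d * w / θ) with hW
  have hW0 : 0 < W := by positivity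
  set τ := Real.sqrt (4 * m ^ 2 * W / α) with hτ
  have hτ0 : 0 < τ := Real.sqrt_pos.2 (by positivity)
  have hτ2 : τ ^ 2 = 4 * m ^ 2 * W / α := Real.sq_sqrt (by positivity)
  have hlevel : bulkTest θ s p S T τ₁ τ ∈ levelTests n α p := by
    refine bulkTest_mem_levelTests (V := W) hp hs0 hθ0 hu hST hS hT hτ₁0 hτ0 ?_ ?_ ?_
    · rw [div_le_iff₀ hτ₁0, hτ₁]
      calc n * (law p).real (bulk θ p)ᶜ ≤ n * (3 * w) := by gcongr
        _ = _ := by field_simp; ring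
    · refine (integral_ballAt_inter_sq_le hL hp hp hs0 hθ0 hLs.le hu hJ).trans_eq ?_
      simp only [sub_self]
      norm_num
      rw [hW]; ring
    · rw [hτ2]
      exact le_of_eq (by field_simp; ring)
  refine (iInf₂_le _ hlevel).trans (iSup₂_le fun q hq => ?_)
  obtain ⟨hq, hdist⟩ := hq
  have hint : Integrable fun x => |q x - p x| :=
    ((integrable_of_mem hq).sub (integrable_of_mem hp)).abs
  rw [l1Dist_eq hp hq, ENNReal.ofReal_le_ofReal_iff (integral_nonneg fun _ => abs_nonneg _),
    ← integral_add_compl hG hint] at hdist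
  -- at least half of the separation lies outside the bulk, or at least half lies inside
  rcases le_total (C * w / 2) (∫ x in (bulk θ p)ᶜ, |q x - p x|) with hcase | hcase
  · have h1 := setIntegral_abs_sub_le hp hq hG.compl
    have h2 : (C / 2 - 3) * w ≤ (law q).real (bulk θ p)ᶜ := by linarith
    have h3 : n * ((C / 2 - 3) * w) ≤ n * (law q).real (bulk θ p)ᶜ := by gcongr
    refine bulkTest_false_le_of_count hp hq ?_ ?_
    · refine le_trans ?_ h3
      calc (8 : ℝ) ≤ C / 4 * c₀ := by linarith
        _ ≤ C / 4 * (n * w) := by gcongr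
        _ ≤ (C / 2 - 3) * (n * w) := by
            gcongr
            linarith
        _ = _ := by ring
    · refine le_trans ?_ h3
      calc 2 * τ₁ = (12 / α) * (n * w) := by rw [hτ₁]; ring
        _ ≤ (C / 2 - 3) * (n * w) := by
            gcongr
            have : 24 / α = 2 * (12 / α) := by ring
            linarith
        _ = _ := by ring
  · exact bulkTest_false_le_of_separation hα hL hp hq hθ0 hs0 hLs hw0 hu hJ hδ0 hkey hST hS hT hm0
      hn0 hmn' hC12 hC₁ hC₂ (by linarith)

end LipschitzTesting

theorem theorem3 (d : ℕ) (hd : 1 ≤ d) (α : ℝ) (hα : 0 < α) (hα' : α < 1 / 2) :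
    ∃ cT CT : ℝ, 0 < cT ∧ cT ≤ CT ∧
      -- the critical equations define `v_n(p₀)` and `w_n(p₀)`
      (∀ (n : ℕ) (L : ℝ) (p₀ : LipschitzTesting.E d → ℝ), 1 ≤ n → 0 < L →
        p₀ ∈ LipschitzTesting.lipBall d L →
          (∃! v : ℝ, LipschitzTesting.SolvesCriticalEq n L CT p₀ v) ∧
          (∃! w : ℝ, LipschitzTesting.SolvesCriticalEq n L cT p₀ w)) ∧
      -- upper bound
      (∃ C : ℝ, 0 < C ∧
        ∀ (n : ℕ) (L : ℝ) (p₀ : LipschitzTesting.E d → ℝ), 1 ≤ n → 0 < L →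
          p₀ ∈ LipschitzTesting.lipBall d L →
            ∀ w : ℝ, LipschitzTesting.SolvesCriticalEq n L cT p₀ w →
              LipschitzTesting.criticalRadius n α p₀ (LipschitzTesting.lipBall d L) ≤
                ENNReal.ofReal (C * w)) ∧
      -- lower bound
      (∀ cint : ℝ, 0 ≤ cint → cint < 1 →
        ∃ c : ℝ, 0 < c ∧
          ∀ (n : ℕ) (L : ℝ) (p₀ : LipschitzTesting.E d → ℝ), 1 ≤ n → 0 < L →
            p₀ ∈ LipschitzTesting.lipBall d (cint * L) →
              ∀ v : ℝ, LipschitzTesting.SolvesCriticalEq n L CT p₀ v →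
                ENNReal.ofReal (c * v) ≤
                  LipschitzTesting.criticalRadius n α p₀ (LipschitzTesting.lipBall d L)) := by
  have : Nonempty (Fin d) := ⟨⟨0, by omega⟩⟩
  exact ⟨1, 1, one_pos, le_rfl,
    fun n L p hn hL hp => ⟨LipschitzTesting.existsUnique_solvesCriticalEq hn hL hp,
      LipschitzTesting.existsUnique_solvesCriticalEq hn hL hp⟩,
    LipschitzTesting.upper_bound hα,
    fun cint h0 h1 => LipschitzTesting.lower_bound hα hα' h0 h1⟩
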